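/- Let $n\ge 3$ and $-2n-1\le p<-n$. Let $\mathcal K_+^2$ be the class of convex bodies $K\subset\mathbb R^n$ that contain the origin in their interior and have $C^2$ boundary with positive Gaussian curvature. For $K\in\mathcal K_+^2$ let $h_K(x)=\max_{y\in K}\langle x,y\rangle$, $x\in\mathbb S^{n-1}$, be its support function, let $\mu$ be the spherical Lebesgue measure on $\mathbb S^{n-1}$, let $\nabla$ be the Levi-Civita connection of the round metric, and write $D^2f=\nabla^2 f+f\,I$ for $f\in C^2(\mathbb S^{n-1})$. Put $dV_K=\frac1n h_K\det(D^2h_K)\,d\mu$ and $dS_2K=h_K^{-1}\det(D^2h_K)\,d\mu$. The Hilbert–Brunn–Minkowski operator of $K$ is $$L_Kz=\frac1{n-1}\operatorname{tr}\big((D^2h_K)^{-1}D^2(zh_K)\big)-z,\qquad z\in C^2(\mathbb S^{n-1}).$$ The operator $-L_K$ is symmetric and positive semi-definite in $L^2(V_K)$; its unique self-adjoint extension (the closure) has discrete spectrum, whose distinct points in increasing order are denoted $\lambda_0(-L_K)<\lambda_1(-L_K)<\lambda_2(-L_K)<\cdots$ (so $\lambda_0=0$ and $\lambda_1=1$). Suppose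 that $K\in\mathcal K_+^2$ has its centroid at the origin; that $K$ is $S_2$-isotropic, i.e. $\int_{\mathbb S^{n-1}}\langle x,w\rangle^2\,dS_2K(x)=\frac{S_2K(\mathbb S^{n-1})}{n}|w|^2$ for all $w\in\mathbb R^n$; that $$h_K^{1-p}\det(\nabla^2h_K+h_KI)=1\quad\text{on }\mathbb S^{n-1};$$ and that $$\lambda_2(-L_K)\ge\frac{-p-1}{n-1}.$$ Then $K$ is the (closed, origin-centred) unit ball. -/

import Mathlib

open MeasureTheory Metric Set Module
open scoped ENNReal InnerProductSpace

noncomputable section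

namespace IsotropicLp

/-- Euclidean space `ℝⁿ`. -/
abbrev E (n : ℕ) : Type := EuclideanSpace ℝ (Fin n)

/-- The unit sphere `S^{n-1}` in `ℝⁿ`. -/
abbrev S (n : ℕ) : Type := sphere (0 : E n) 1

variable {n : ℕ}

/-! ### Calculus on the sphere -/

/-- The radial projection `x / |x|` of a nonzero vector. -/
def radial (x : E n) (hx : x ≠ 0) : S n :=
  ⟨‖x‖⁻¹ • x, by simp [norm_smul, norm_ne_zero_iff.mpr hx]⟩

open Classical in
/-- The 1-homogeneous extension `x ↦ |x| f(x / |x|)` (and `0 ↦ 0`) of a function on the sphere. -/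
def homExt (f : S n → ℝ) (x : E n) : ℝ :=
  if hx : x = 0 then 0 else ‖x‖ * f (radial x hx)

/-- `f ∈ C²(S^{n-1})`: the 1-homogeneous extension of `f` is `C²` away from the origin. As
`x ↦ x / |x|` and `x ↦ |x|` are smooth there and `S^{n-1}` is a smooth submanifold, this is the
usual notion. -/
def IsC2 (f : S n → ℝ) : Prop := ContDiffOn ℝ 2 (homExt f) {0}ᶜ

/-- The tangent space `T_x S^{n-1} = x^⊥`. -/
abbrev Tan (x : S n) : Submodule ℝ (E n) := (ℝ ∙ (x : E n))ᗮ

/-- `D² f = ∇² f + f I` at `x`, as an endomorphism of `T_x S^{n-1}`: the restriction to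
`T_x S^{n-1}` of the Euclidean Hessian of the 1-homogeneous extension of `f`. -/
def D2 (f : S n → ℝ) (x : S n) : Module.End ℝ (Tan x) :=
  ((Tan x).orthogonalProjectionOnto ∘L fderiv ℝ (gradient (homExt f)) (x : E n) ∘L
    (Tan x).subtypeL : Tan x →L[ℝ] Tan x)

/-! ### Convex bodies -/

/-- The support function `h_K(x) = max_{y ∈ K} ⟨x, y⟩` on the unit sphere. -/
def supp (K : ConvexBody (E n)) (x : S n) : ℝ :=
  sSup ((fun y : E n => ⟪(x : E n), y⟫_ℝ) '' (K : Set (E n)))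

/-- The class `𝒦₊²`: the convex body `K` contains the origin in its interior, and its boundary is
of class `C²` with positive Gaussian curvature. That is, near each boundary point `a` the body is
`{φ ≤ 0}` with `φ` of class `C²`, `∇φ(a) ≠ 0`, and the second fundamental form at `a`, which is the
Hessian of `φ` on the tangent space `∇φ(a)^⊥` divided by `|∇φ(a)|`, is positive definite (it is
always positive semidefinite by convexity, hence positive definite iff its determinant, the
Gaussian curvature, is positive). -/
def IsKPlusTwo (K : ConvexBody (E n)) : Prop :=
  (0 : E n) ∈ interior (K : Set (E n)) ∧
  ∀ a ∈ frontier (K : Set (E n)), ∃ (U : Set (E n)) (φ : E n → ℝ),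
    IsOpen U ∧ a ∈ U ∧ ContDiffOn ℝ 2 φ U ∧ (K : Set (E n)) ∩ U = {y ∈ U | φ y ≤ 0} ∧
    gradient φ a ≠ 0 ∧
    ∀ v : E n, v ≠ 0 → ⟪gradient φ a, v⟫_ℝ = 0 → 0 < ⟪fderiv ℝ (gradient φ) a v, v⟫_ℝ

/-- The centroid of `K` is the origin. -/
def IsOriginCentred (K : ConvexBody (E n)) : Prop :=
  (⨍ x in (K : Set (E n)), x) = 0

/-- The `L_p`-surface-area measure `dS_p K = h_K^{1-p} det(∇² h_K + h_K I) dμ`, where `μ` is the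
spherical Lebesgue measure. -/
def lpSurfaceArea (p : ℝ) (K : ConvexBody (E n)) : Measure (S n) :=
  (volume : Measure (E n)).toSphere.withDensity
    (fun x => ENNReal.ofReal (supp K x ^ (1 - p) * LinearMap.det (D2 (supp K) x)))

/-- The cone-volume measure `V_K = (1/n) S_0 K`. -/
def coneVolume (K : ConvexBody (E n)) : Measure (S n) :=
  (n : ℝ≥0∞)⁻¹ • lpSurfaceArea 0 K

/-- A measure `m` on the sphere is isotropic if `∫ ⟨x, w⟩² dm(x) = (‖m‖ / n) |w|²` for all `w`. -/
def IsIsotropicMeasure (m : Measure (S n)) : Prop :=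
  ∀ w : E n, ∫ x : S n, ⟪(x : E n), w⟫_ℝ ^ 2 ∂m = m.real univ / n * ‖w‖ ^ 2

/-- `K` is `S₂`-isotropic: its `L_2`-surface-area measure is isotropic. -/
def IsS2Isotropic (K : ConvexBody (E n)) : Prop := IsIsotropicMeasure (lpSurfaceArea 2 K)

/-- `K` solves the isotropic `L_p` Minkowski problem `h_K^{1-p} det(∇² h_K + h_K I) = 1`. -/
def SolvesIsotropicLpMinkowski (p : ℝ) (K : ConvexBody (E n)) : Prop :=
  ∀ x : S n, supp K x ^ (1 - p) * LinearMap.det (D2 (supp K) x) = 1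

/-! ### The Hilbert-Brunn-Minkowski operator and its spectrum -/

/-- The Hilbert-Brunn-Minkowski operator
`L_K z = (1/(n-1)) tr((D² h_K)⁻¹ D²(z h_K)) - z`. -/
def hbm (K : ConvexBody (E n)) (z : S n → ℝ) (x : S n) : ℝ :=
  1 / ((n : ℝ) - 1) *
    LinearMap.trace ℝ (Tan x) (Ring.inverse (D2 (supp K) x) * D2 (z * supp K) x) - z x

/-- The graph of `-L_K` on `C²(S^{n-1})`, inside `L²(V_K) × L²(V_K)`. -/
def negHbmGraph (K : ConvexBody (E n)) :
    Set (Lp ℝ 2 (coneVolume K) × Lp ℝ 2 (coneVolume K)) :=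
  {q | ∃ z : S n → ℝ, IsC2 z ∧ q.1 =ᵐ[coneVolume K] z ∧
    q.2 =ᵐ[coneVolume K] fun x => -hbm K z x}

/-- The spectrum `σ(-L_K)` of the self-adjoint extension `T` of `-L_K` in `L²(V_K)`. The graph of
`T` is the closure of the graph of `-L_K` on `C²(S^{n-1})`. A real number `t` lies in the resolvent
set iff `T - t` is a bijection from the domain of `T` onto `L²(V_K)` (its inverse is then bounded,
since `T` is closed); as `T` is self-adjoint, its spectrum is real. -/
def negHbmSpectrum (K : ConvexBody (E n)) : Set ℝ :=
  {t | ¬ ∀ w : Lp ℝ 2 (coneVolume K), ∃! q : Lp ℝ 2 (coneVolume K) × Lp ℝ 2 (coneVolume K),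
    q ∈ closure (negHbmGraph K) ∧ q.2 - t • q.1 = w}

/-- The points `λ_0(-L_K) < λ_1(-L_K) < λ_2(-L_K) < ⋯` of the (discrete) spectrum of `-L_K` in
increasing order, each listed once: `λ_0` is the smallest one and `λ_{i+1}` the smallest one above
`λ_i`. -/
def lam (K : ConvexBody (E n)) : ℕ → ℝ
  | 0 => sInf (negHbmSpectrum K)
  | i + 1 => sInf {t ∈ negHbmSpectrum K | lam K i < t}

end IsotropicLp

end

/-!
Let `h` be the support function of `K`, extended to a `1`-homogeneous function `H`, let `X = ∇H` be
the boundary point with a given normal, and let `V` be the cone-volume measure. The proof tests the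
spectral gap of `T = -L_K` on the coordinate functions of `X`.

The map `Ψ x = |x| ∇H x` is a `C¹` diffeomorphism of the punctured space that takes the unit ball to
`K`, its Jacobian on the sphere is `h det (D² h)`, and `L_K z` is, up to normalization, the trace of
`(Hess F) (DΨ)⁻¹` for `F = z H`. The divergence theorem on the image side gives an integration by
parts formula for homogeneous vector fields (`IsRegSupport.integral_ctrace`), from which everything
else follows. It yields the Dirichlet form of `T`, hence that `T` is symmetric and nonnegative; and,
applied to the second elementary symmetric function of `(Hess F) (DΨ)⁻¹`, the identity behind the
local Alexandrov-Fenchel inequality (`IsRegSupport.integral_sq_ctrace`). Together with a Poincaré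
inequality on the sphere these identify the eigenspaces of the closure of `T`: the constants for `0`
and the functions `⟪x, w⟫ / h` for `1` (`exists_smul_of_mem_zero`, `exists_linHom_of_mem_one`).

The hypothesis on `λ₂` says that the spectrum has no points below `Λ = (-p-1)/(n-1) > 1` other than
`0` and `1`. In particular `1/2` is a resolvent point, so the closure of `T` is self-adjoint, and
the resolvent at `1/2` turns the gap into the inequality `Λ ‖u‖² ≤ ⟪T u, u⟫` for every `u` in
the domain orthogonal to both eigenspaces (`IsClosedSymm.le_inner_of_orthogonal`). No discreteness
of the spectrum is needed.

Because `h ^ (1 - p) det (D² h) = 1`, integration by parts on the round sphere shows that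
`X_w = ⟪X, w⟫` satisfies, weakly and therefore in the domain of the closure,
`(n-1) T X_w = -(p+1) X_w + (n+p) h ⟪x, w⟫`. The centroid condition says that `X_w` is orthogonal
to the constants, and `S₂`-isotropy that `u = X_w - c ⟪x, w⟫ / h` is orthogonal to the eigenspace
of `1` for `c = V(S) / ∫ h⁻² dV`. As `n + p < 0`, the gap inequality for `u` reads
`∫ h ⟪x, w⟫ u dV ≤ 0`. Summed over an orthonormal basis of vectors `w` it gives
`∫ h² dV ∫ h⁻² dV ≤ V(S)²`, the equality case of the Cauchy-Schwarz inequality. Hence `h` is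
constant, and the equation forces `h = 1`.
-/

set_option linter.unusedSectionVars false

noncomputable section

namespace IsotropicLp

/-! ### Positively homogeneous functions -/

section Homogeneous

variable {V W : Type*} [NormedAddCommGroup V] [InnerProductSpace ℝ V] [FiniteDimensional ℝ V]
  [NormedAddCommGroup W] [NormedSpace ℝ W]

/-- `w` is positively homogeneous of degree `0`. -/
def Hom0 (w : V → W) : Prop := ∀ ⦃t : ℝ⦄, 0 < t → ∀ x, w (t • x) = w x

/-- `f` is positively homogeneous of degree `1`. -/
def Hom1 (f : V → W) : Prop := ∀ ⦃t : ℝ⦄, 0 < t → ∀ x, f (t • x) = t • f x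

/-- The Hessian, as an endomorphism. -/
abbrev hess (F : V → ℝ) (x : V) : V →L[ℝ] V := fderiv ℝ (gradient F) x

lemma Hom0.fderiv_smul {w : V → W} (hw : Hom0 w) {t : ℝ} (ht : 0 < t) (x : V) :
    fderiv ℝ w (t • x) = t⁻¹ • fderiv ℝ w x := by
  have h : (fun y => w (t • y)) = w := funext (hw ht)
  have h2 := fderiv_comp_smul (𝕜 := ℝ) (f := w) (x := x) t
  rw [h] at h2
  rw [h2, smul_smul, inv_mul_cancel₀ ht.ne', one_smul]

lemma Hom0.fderiv_self {w : V → W} (hw : Hom0 w) {x : V} (hd : DifferentiableAt ℝ w x) :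
    fderiv ℝ w x x = 0 := by
  have h1 : HasDerivAt (fun t : ℝ => t • x) x 1 := by
    simpa using (hasDerivAt_id (1 : ℝ)).smul_const x
  have h2 : HasDerivAt (fun t : ℝ => w (t • x)) (fderiv ℝ w x x) 1 :=
    HasFDerivAt.comp_hasDerivAt (x := (1 : ℝ)) (f := fun t : ℝ => t • x)
      (by simpa using hd.hasFDerivAt) h1
  have h3 : (fun t : ℝ => w (t • x)) =ᶠ[nhds 1] fun _ => w x := by
    filter_upwards [lt_mem_nhds (zero_lt_one' ℝ)] with t ht using hw ht x
  exact h2.unique ((hasDerivAt_const (1 : ℝ) (w x)).congr_of_eventuallyEq h3)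

lemma Hom1.fderiv_smul {f : V → W} (hf : Hom1 f) {t : ℝ} (ht : 0 < t) (x : V) :
    fderiv ℝ f (t • x) = fderiv ℝ f x := by
  have h : (fun y => f (t • y)) = t • f := funext (hf ht)
  have h2 := fderiv_comp_smul (𝕜 := ℝ) (f := f) (x := x) t
  rw [h, fderiv_const_smul_field] at h2
  have h3 := congrArg (fun L => t⁻¹ • L) h2
  simpa [smul_smul, inv_mul_cancel₀ ht.ne'] using h3.symm

lemma Hom1.fderiv_self {f : V → W} (hf : Hom1 f) {x : V} (hd : DifferentiableAt ℝ f x) :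
    fderiv ℝ f x x = f x := by
  have h1 : HasDerivAt (fun t : ℝ => t • x) x 1 := by
    simpa using (hasDerivAt_id (1 : ℝ)).smul_const x
  have h2 : HasDerivAt (fun t : ℝ => f (t • x)) (fderiv ℝ f x x) 1 :=
    HasFDerivAt.comp_hasDerivAt (x := (1 : ℝ)) (f := fun t : ℝ => t • x)
      (by simpa using hd.hasFDerivAt) h1
  have h3 : (fun t : ℝ => f (t • x)) =ᶠ[nhds 1] fun t => t • f x := by
    filter_upwards [lt_mem_nhds (zero_lt_one' ℝ)] with t ht using hf ht x
  refine h2.unique (HasDerivAt.congr_of_eventuallyEq ?_ h3)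
  simpa using (hasDerivAt_id (1 : ℝ)).smul_const (f x)

lemma Hom1.gradient {f : V → ℝ} (hf : Hom1 f) : Hom0 (gradient f) := by
  intro t ht x
  simp only [_root_.gradient, hf.fderiv_smul ht]

lemma Hom1.inner_gradient {f : V → ℝ} (hf : Hom1 f) {x : V} (hd : DifferentiableAt ℝ f x) :
    ⟪_root_.gradient f x, x⟫_ℝ = f x := by
  rw [inner_gradient_left, hf.fderiv_self hd]

lemma Hom1.map_zero {f : V → ℝ} (hf : Hom1 f) : f 0 = 0 := by
  have := hf (t := 2) two_pos 0
  simp at this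
  linarith

lemma compl_zero_mem_nhds {x : V} (hx : x ≠ 0) : ({0}ᶜ : Set V) ∈ nhds x :=
  isOpen_compl_singleton.mem_nhds hx

lemma contDiffOn_gradient {f : V → ℝ} {s : Set V} (hs : IsOpen s) (hf : ContDiffOn ℝ 2 f s) :
    ContDiffOn ℝ 1 (gradient f) s := by
  have h : ContDiffOn ℝ 1 (fderiv ℝ f) s := hf.fderiv_of_isOpen hs (by norm_num)
  exact (InnerProductSpace.toDual ℝ V).symm.toContinuousLinearEquiv.contDiff.comp_contDiffOn h

lemma differentiableAt_of_contDiffOn {f : V → W} {m : WithTop ℕ∞} (hm : m ≠ 0)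
    (hf : ContDiffOn ℝ m f {0}ᶜ) {x : V} (hx : x ≠ 0) : DifferentiableAt ℝ f x :=
  (hf.contDiffAt (compl_zero_mem_nhds hx)).differentiableAt hm

lemma differentiableAt_gradient {f : V → ℝ} (hf : ContDiffOn ℝ 2 f {0}ᶜ) {x : V} (hx : x ≠ 0) :
    DifferentiableAt ℝ (gradient f) x :=
  differentiableAt_of_contDiffOn one_ne_zero (contDiffOn_gradient isOpen_compl_singleton hf) hx

lemma hess_self {f : V → ℝ} (hf : ContDiffOn ℝ 2 f {0}ᶜ) (h1 : Hom1 f) {x : V} (hx : x ≠ 0) :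
    hess f x x = 0 :=
  h1.gradient.fderiv_self (differentiableAt_gradient hf hx)

lemma inner_hess {f : V → ℝ} {x : V} (hf : ContDiffAt ℝ 2 f x) (v u : V) :
    ⟪hess f x v, u⟫_ℝ = fderiv ℝ (fderiv ℝ f) x v u := by
  have hd : DifferentiableAt ℝ (fderiv ℝ f) x :=
    (hf.fderiv_right (m := 1) (by norm_num)).differentiableAt one_ne_zero
  have h2 : hess f x = (InnerProductSpace.toDual ℝ V).symm.toContinuousLinearEquiv.toContinuousLinearMap ∘L
      fderiv ℝ (fderiv ℝ f) x :=
    ((InnerProductSpace.toDual ℝ V).symm.toContinuousLinearEquiv.hasFDerivAt.comp x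
      hd.hasFDerivAt).fderiv
  rw [h2]
  simp

lemma hess_symm {f : V → ℝ} {x : V} (hf : ContDiffAt ℝ 2 f x) (v u : V) :
    ⟪hess f x v, u⟫_ℝ = ⟪v, hess f x u⟫_ℝ := by
  rw [real_inner_comm _ v, inner_hess hf, inner_hess hf]
  exact hf.isSymmSndFDerivAt (by simp) v u

lemma contDiffAt_of_ne {f : V → W} {m : WithTop ℕ∞}
    (hf : ContDiffOn ℝ m f {0}ᶜ) {x : V} (hx : x ≠ 0) : ContDiffAt ℝ m f x :=
  hf.contDiffAt (compl_zero_mem_nhds hx)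

lemma continuousOn_fderiv {f : V → W} (hf : ContDiffOn ℝ 1 f {0}ᶜ) :
    ContinuousOn (fderiv ℝ f) {0}ᶜ :=
  hf.continuousOn_fderiv_of_isOpen isOpen_compl_singleton (by norm_num)

lemma continuousOn_hess {f : V → ℝ} (hf : ContDiffOn ℝ 2 f {0}ᶜ) :
    ContinuousOn (hess f) {0}ᶜ :=
  continuousOn_fderiv (contDiffOn_gradient isOpen_compl_singleton hf)

lemma gradient_add' {f g : V → ℝ} {x : V} (hf : DifferentiableAt ℝ f x)
    (hg : DifferentiableAt ℝ g x) :
    gradient (fun y => f y + g y) x = gradient f x + gradient g x := by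
  simp [gradient, fderiv_fun_add hf hg]

lemma gradient_mul' {f g : V → ℝ} {x : V} (hf : DifferentiableAt ℝ f x)
    (hg : DifferentiableAt ℝ g x) :
    gradient (fun y => f y * g y) x = f x • gradient g x + g x • gradient f x := by
  simp [gradient, fderiv_fun_mul hf hg]

lemma gradient_inner_const (w x : V) : gradient (fun y : V => ⟪y, w⟫_ℝ) x = w := by
  have : HasGradientAt (fun y : V => ⟪y, w⟫_ℝ) w x := by
    rw [hasGradientAt_iff_hasFDerivAt]
    have h := (innerSL ℝ w).hasFDerivAt (x := x)
    have e : (fun y : V => ⟪y, w⟫_ℝ) = innerSL ℝ w := by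
      ext y; simp [real_inner_comm]
    rw [e]
    exact h
  exact this.gradient

lemma hess_add {f g : V → ℝ} (hf : ContDiffOn ℝ 2 f {0}ᶜ) (hg : ContDiffOn ℝ 2 g {0}ᶜ) {x : V}
    (hx : x ≠ 0) : hess (fun y => f y + g y) x = hess f x + hess g x := by
  have : gradient (fun y => f y + g y) =ᶠ[nhds x] fun y => gradient f y + gradient g y := by
    filter_upwards [compl_zero_mem_nhds hx] with y hy
    exact gradient_add' (differentiableAt_of_contDiffOn two_ne_zero hf hy)
      (differentiableAt_of_contDiffOn two_ne_zero hg hy)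
  rw [hess, this.fderiv_eq, fderiv_fun_add (differentiableAt_gradient hf hx)
    (differentiableAt_gradient hg hx)]

lemma hess_const_mul (c : ℝ) {f : V → ℝ} (hf : ContDiffOn ℝ 2 f {0}ᶜ) {x : V}
    (hx : x ≠ 0) : hess (fun y => c * f y) x = c • hess f x := by
  have : gradient (fun y => c * f y) =ᶠ[nhds x] fun y => c • gradient f y := by
    filter_upwards [compl_zero_mem_nhds hx] with y hy
    simp [gradient, fderiv_const_mul (differentiableAt_of_contDiffOn two_ne_zero hf hy)]
  rw [hess, this.fderiv_eq, fderiv_fun_const_smul (differentiableAt_gradient hf hx)]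

end Homogeneous

/-! ### Regular support functions and the parametrization of the body they bound -/

section Support

variable {V W : Type*} [NormedAddCommGroup V] [InnerProductSpace ℝ V] [FiniteDimensional ℝ V]
  [NormedAddCommGroup W] [NormedSpace ℝ W]

/-- `H` is the support function of a convex body of class `𝒦₊²`, on the whole space: it is
`1`-homogeneous, positive and `C²` off the origin, its gradient at any point lies in the body
`{y | ∀ x, ⟪y, x⟫ ≤ H x}`, and its Hessian at `x` is positive definite on `x^⊥`. -/
structure IsRegSupport (H : V → ℝ) : Prop where
  smooth : ContDiffOn ℝ 2 H {0}ᶜ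
  hom : Hom1 H
  pos : ∀ x, x ≠ 0 → 0 < H x
  sub : ∀ x, x ≠ 0 → ∀ z, ⟪gradient H x, z⟫_ℝ ≤ H z
  pd : ∀ x, x ≠ 0 → ∀ v, v ≠ 0 → ⟪x, v⟫_ℝ = 0 → 0 < ⟪hess H x v, v⟫_ℝ

/-- The `1`-homogeneous map `x ↦ |x| ∇H(x)`. It takes the unit ball onto the body with support
function `H`, and a unit vector `x` to the boundary point with outer normal `x`. -/
def bdMap (H : V → ℝ) (x : V) : V := ‖x‖ • gradient H x

/-- The derivative of `bdMap H` at `x`. -/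
def dbd (H : V → ℝ) (x : V) : V →L[ℝ] V :=
  (‖x‖⁻¹ • innerSL ℝ x).smulRight (gradient H x) + ‖x‖ • hess H x

lemma dbd_apply (H : V → ℝ) (x v : V) :
    dbd H x v = (‖x‖⁻¹ * ⟪x, v⟫_ℝ) • gradient H x + ‖x‖ • hess H x v := by
  simp [dbd]

lemma hasFDerivAt_norm_of_ne {x : V} (hx : x ≠ 0) :
    HasFDerivAt (fun y : V => ‖y‖) (‖x‖⁻¹ • innerSL ℝ x) x := by
  have h := ((hasStrictFDerivAt_norm_sq x).hasFDerivAt).sqrt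
    (pow_ne_zero 2 (norm_ne_zero_iff.mpr hx))
  have e : (fun y : V => ‖y‖) = fun y => Real.sqrt (‖y‖ ^ 2) := by
    ext y; rw [Real.sqrt_sq (norm_nonneg y)]
  rw [e]
  convert h using 1
  rw [Real.sqrt_sq (norm_nonneg x)]
  ext v
  simp
  field_simp

variable {H : V → ℝ} (hH : IsRegSupport H)
include hH

namespace IsRegSupport

lemma diff {x : V} (hx : x ≠ 0) : DifferentiableAt ℝ H x :=
  differentiableAt_of_contDiffOn two_ne_zero hH.smooth hx

lemma gradient_contDiffOn : ContDiffOn ℝ 1 (gradient H) {0}ᶜ :=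
  contDiffOn_gradient isOpen_compl_singleton hH.smooth

lemma inner_gradient {x : V} (hx : x ≠ 0) : ⟪gradient H x, x⟫_ℝ = H x :=
  hH.hom.inner_gradient (hH.diff hx)

lemma nonneg (x : V) : 0 ≤ H x := by
  rcases eq_or_ne x 0 with rfl | h
  · rw [hH.hom.map_zero]
  · exact (hH.pos x h).le

lemma gradient_ne_zero {x : V} (hx : x ≠ 0) : gradient H x ≠ 0 := by
  intro h
  have := hH.inner_gradient hx
  rw [h, inner_zero_left] at this
  exact (hH.pos x hx).ne this

lemma hess_symm {x : V} (hx : x ≠ 0) (v u : V) : ⟪hess H x v, u⟫_ℝ = ⟪v, hess H x u⟫_ℝ :=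
  IsotropicLp.hess_symm (contDiffAt_of_ne hH.smooth hx) v u

lemma hess_self {x : V} (hx : x ≠ 0) : hess H x x = 0 :=
  IsotropicLp.hess_self hH.smooth hH.hom hx

lemma inner_hess_self {x : V} (hx : x ≠ 0) (v : V) : ⟪x, hess H x v⟫_ℝ = 0 := by
  rw [← hH.hess_symm hx, hH.hess_self hx, inner_zero_left]

lemma exists_smul_of_hess_eq_zero {x v : V} (hx : x ≠ 0) (h : hess H x v = 0) :
    ∃ c : ℝ, v = c • x := by
  refine ⟨⟪x, v⟫_ℝ / ⟪x, x⟫_ℝ, ?_⟩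
  by_contra hne
  set c := ⟪x, v⟫_ℝ / ⟪x, x⟫_ℝ
  have hxx : ⟪x, x⟫_ℝ ≠ 0 := inner_self_ne_zero.mpr hx
  have := hH.pd x hx (v - c • x) (sub_ne_zero.mpr hne) (by
    rw [inner_sub_right, inner_smul_right, div_mul_cancel₀ _ hxx, sub_self])
  rw [map_sub, map_smul, h, hH.hess_self hx] at this
  simp at this

lemma hasFDerivAt_bdMap {x : V} (hx : x ≠ 0) : HasFDerivAt (bdMap H) (dbd H x) x := by
  have h := (hasFDerivAt_norm_of_ne hx).smul (differentiableAt_gradient hH.smooth hx).hasFDerivAt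
  rw [dbd, add_comm]
  exact h

lemma contDiffOn_bdMap : ContDiffOn ℝ 1 (bdMap H) {0}ᶜ := by
  intro x hx
  exact ((contDiffAt_norm ℝ hx).contDiffWithinAt).smul (hH.gradient_contDiffOn x hx)

lemma bdMap_hom : Hom1 (bdMap H) := by
  intro t ht x
  simp [bdMap, hH.hom.gradient ht, norm_smul, abs_of_pos ht, smul_smul]

lemma bdMap_ne_zero {x : V} (hx : x ≠ 0) : bdMap H x ≠ 0 :=
  smul_ne_zero (norm_ne_zero_iff.mpr hx) (hH.gradient_ne_zero hx)

lemma dbd_self {x : V} (hx : x ≠ 0) : dbd H x x = bdMap H x := by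
  rw [dbd_apply, hH.hess_self hx, real_inner_self_eq_norm_sq, smul_zero, add_zero, bdMap]
  congr 1
  have := norm_ne_zero_iff.mpr hx
  field_simp

lemma inner_dbd {x : V} (hx : x ≠ 0) (v : V) :
    ⟪x, dbd H x v⟫_ℝ = ‖x‖⁻¹ * ⟪x, v⟫_ℝ * H x := by
  rw [dbd_apply, inner_add_right, inner_smul_right, inner_smul_right, hH.inner_hess_self hx,
    real_inner_comm (gradient H x) x, hH.inner_gradient hx]
  ring

lemma dbd_injective {x : V} (hx : x ≠ 0) : Function.Injective (dbd H x) := by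
  rw [injective_iff_map_eq_zero]
  intro v hv
  have hn := norm_ne_zero_iff.mpr hx
  have h1 := hH.inner_dbd hx v
  rw [hv, inner_zero_right] at h1
  have h2 : ⟪x, v⟫_ℝ = 0 := by
    have := (hH.pos x hx).ne'
    have h3 : ‖x‖⁻¹ ≠ 0 := inv_ne_zero hn
    simpa [this, h3, hx] using h1.symm
  rw [dbd_apply, h2, mul_zero, zero_smul, zero_add] at hv
  by_contra hne
  have := hH.pd x hx v hne h2
  rw [(smul_eq_zero.mp hv).resolve_left hn, inner_zero_left] at this
  exact this.false

lemma isUnit_dbd {x : V} (hx : x ≠ 0) : IsUnit (dbd H x) := by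
  rw [ContinuousLinearMap.isUnit_iff_bijective]
  exact ⟨hH.dbd_injective hx,
    LinearMap.surjective_of_injective (f := (dbd H x).toLinearMap) (hH.dbd_injective hx)⟩

lemma dbd_smul {t : ℝ} (ht : 0 < t) (x : V) : dbd H (t • x) = dbd H x := by
  ext v
  rw [dbd_apply, dbd_apply, hH.hom.gradient ht, hess, hH.hom.gradient.fderiv_smul ht, norm_smul,
    Real.norm_of_nonneg ht.le, inner_smul_left]
  simp only [RCLike.conj_to_real, FunLike.coe_smul, Pi.smul_apply, smul_smul]
  congr 2 <;> field_simp

lemma continuousOn_dbd : ContinuousOn (dbd H) {0}ᶜ := by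
  refine (continuousOn_fderiv hH.contDiffOn_bdMap).congr fun x hx => ?_
  exact (hH.hasFDerivAt_bdMap hx).fderiv.symm

lemma continuousOn_inverse_dbd : ContinuousOn (fun x => Ring.inverse (dbd H x)) {0}ᶜ := by
  intro x hx
  obtain ⟨u, hu⟩ := hH.isUnit_dbd hx
  refine ContinuousAt.comp_continuousWithinAt (g := Ring.inverse) ?_ (hH.continuousOn_dbd x hx)
  rw [← hu]
  exact NormedRing.inverse_continuousAt u

lemma dbd_inverse {x : V} (hx : x ≠ 0) (v : V) : dbd H x (Ring.inverse (dbd H x) v) = v := by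
  have := Ring.mul_inverse_cancel _ (hH.isUnit_dbd hx)
  exact congrArg (fun L : V →L[ℝ] V => L v) this

lemma inverse_dbd {x : V} (hx : x ≠ 0) (v : V) : Ring.inverse (dbd H x) (dbd H x v) = v := by
  have := Ring.inverse_mul_cancel _ (hH.isUnit_dbd hx)
  exact congrArg (fun L : V →L[ℝ] V => L v) this

lemma inner_inverse_dbd {x : V} (hx : x ≠ 0) (v : V) :
    ⟪x, Ring.inverse (dbd H x) v⟫_ℝ = ‖x‖ * ⟪x, v⟫_ℝ / H x := by
  have h := hH.inner_dbd hx (Ring.inverse (dbd H x) v)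
  rw [hH.dbd_inverse hx] at h
  have := (hH.pos x hx).ne'
  have hn := norm_ne_zero_iff.mpr hx
  rw [h]
  field_simp

/-- If the outer normals of the body at a common boundary point were `x` and `x'`, the gradient of
`H` would be constant on the segment from `x` to `x'`, so `x' - x` would be in the kernel of the
Hessian of `H` at `x`. -/
lemma eq_of_gradient_eq {x x' : V} (hx : x ≠ 0) (hx' : x' ≠ 0) (hn : ‖x‖ = ‖x'‖)
    (h : gradient H x = gradient H x') : x = x' := by
  set X := gradient H x with hX
  have hx1 : ⟪X, x⟫_ℝ = H x := hH.inner_gradient hx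
  have hx2 : ⟪X, x'⟫_ℝ = H x' := by rw [h]; exact hH.inner_gradient hx'
  have hp := hH.pos x hx
  have hp' := hH.pos x' hx'
  have hseg : ∀ t ∈ Icc (0 : ℝ) 1, gradient H (x + t • (x' - x)) = X := by
    intro t ht
    set z := x + t • (x' - x) with hz
    have hzX : ⟪X, z⟫_ℝ = (1 - t) * H x + t * H x' := by
      rw [hz, inner_add_right, inner_smul_right, inner_sub_right, hx1, hx2]; ring
    have hzpos : 0 < (1 - t) * H x + t * H x' := by
      rcases ht.2.lt_or_eq with h1 | h1
      · have := mul_pos (sub_pos.mpr h1) hp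
        have := mul_nonneg ht.1 hp'.le
        linarith
      · rw [h1]; linarith
    have hz0 : z ≠ 0 := by
      intro h0
      rw [h0, inner_zero_right] at hzX
      linarith
    have hle : H z ≤ ⟪X, z⟫_ℝ := by
      rw [hzX, ← hH.inner_gradient hz0]
      have e : ⟪gradient H z, z⟫_ℝ = (1 - t) * ⟪gradient H z, x⟫_ℝ + t * ⟪gradient H z, x'⟫_ℝ := by
        conv_lhs => rw [hz, inner_add_right, inner_smul_right, inner_sub_right]
        ring
      rw [e]
      have h1 := mul_le_mul_of_nonneg_left (hH.sub z hz0 x) (sub_nonneg.mpr ht.2)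
      have h2 := mul_le_mul_of_nonneg_left (hH.sub z hz0 x') ht.1
      linarith
    have hmin : IsLocalMin (fun y => H y - ⟪y, X⟫_ℝ) z := by
      refine Filter.Eventually.of_forall fun y => ?_
      have := hH.sub x hx y
      rw [← hX, real_inner_comm] at this
      rw [real_inner_comm] at hle
      show H z - ⟪z, X⟫_ℝ ≤ H y - ⟪y, X⟫_ℝ
      linarith
    have hd := hmin.fderiv_eq_zero
    have hd2 : DifferentiableAt ℝ (fun y : V => ⟪y, X⟫_ℝ) z :=
      differentiableAt_id.inner ℝ (differentiableAt_const X)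
    rw [fderiv_fun_sub (hH.diff hz0) hd2, sub_eq_zero] at hd
    have : gradient H z = gradient (fun y : V => ⟪y, X⟫_ℝ) z := by simp only [gradient, hd]
    rw [this, gradient_inner_const]
  have hker : hess H x (x' - x) = 0 := by
    have h1 : HasDerivWithinAt (fun t : ℝ => gradient H (x + t • (x' - x))) (hess H x (x' - x))
        (Icc 0 1) 0 := by
      have h2 : HasDerivAt (fun t : ℝ => x + t • (x' - x)) (x' - x) 0 := by
        simpa using ((hasDerivAt_id (0 : ℝ)).smul_const (x' - x)).const_add x
      exact (HasFDerivAt.comp_hasDerivAt (x := (0 : ℝ)) (f := fun t : ℝ => x + t • (x' - x))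
        (by simpa using (differentiableAt_gradient hH.smooth hx).hasFDerivAt) h2).hasDerivWithinAt
    have h3 : HasDerivWithinAt (fun t : ℝ => gradient H (x + t • (x' - x))) 0 (Icc 0 1) 0 :=
      (hasDerivWithinAt_const 0 _ X).congr hseg (hseg 0 (by simp))
    exact (uniqueDiffOn_Icc (zero_lt_one' ℝ) 0 (by simp)).eq_deriv _ h1 h3
  obtain ⟨c, hc⟩ := hH.exists_smul_of_hess_eq_zero hx hker
  have hx'e : x' = (1 + c) • x := by rw [add_smul, one_smul, ← hc]; abel
  have h1 : 0 < 1 + c := by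
    rw [hx'e, inner_smul_right, hx1, ← hx'e] at hx2
    by_contra hcon
    nlinarith
  rw [hx'e, norm_smul, Real.norm_of_nonneg h1.le] at hn
  have : (1 + c) = 1 := by
    have := norm_pos_iff.mpr hx
    nlinarith
  rw [hx'e, this, one_smul]

lemma bdMap_injOn : InjOn (bdMap H) {0}ᶜ := by
  have key : ∀ x x' : V, x ≠ 0 → x' ≠ 0 → bdMap H x = bdMap H x' → ‖x‖ ≤ ‖x'‖ := by
    intro x x' hx hx' h
    have h1 := congrArg (fun y => ⟪y, x⟫_ℝ) h
    simp only [bdMap, inner_smul_left, hH.inner_gradient hx, RCLike.conj_to_real] at h1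
    have h2 := mul_le_mul_of_nonneg_left (hH.sub x' hx' x) (norm_nonneg x')
    rw [← h1] at h2
    exact le_of_mul_le_mul_right h2 (hH.pos x hx)
  intro x hx x' hx' h
  have hn := le_antisymm (key x x' hx hx' h) (key x' x hx' hx h.symm)
  refine hH.eq_of_gradient_eq hx hx' hn ?_
  simp only [bdMap, ← hn] at h
  exact smul_right_injective V (norm_ne_zero_iff.mpr hx) h

/-- A maximizer `x₀` of `⟪x, y⟫ / H x` over the unit sphere is the outer normal of the body on the
ray through `y`. -/
lemma bdMap_surjOn : SurjOn (bdMap H) {0}ᶜ {0}ᶜ := by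
  intro y hy
  have hy : y ≠ 0 := hy
  have hnt : Nontrivial V := ⟨⟨y, 0, hy⟩⟩
  have hne : (sphere (0 : V) 1).Nonempty := NormedSpace.sphere_nonempty.mpr zero_le_one
  have hs0 : ∀ x ∈ sphere (0 : V) 1, x ≠ 0 := fun x hx => ne_zero_of_mem_unit_sphere ⟨x, hx⟩
  have hcont : ContinuousOn (fun x => ⟪x, y⟫_ℝ / H x) (sphere (0 : V) 1) := by
    refine ContinuousOn.div (by fun_prop) (hH.smooth.continuousOn.mono hs0) ?_
    exact fun x hx => (hH.pos x (hs0 x hx)).ne'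
  obtain ⟨x₀, hx₀, hmax⟩ := (isCompact_sphere (0 : V) 1).exists_isMaxOn hne hcont
  set m := ⟪x₀, y⟫_ℝ / H x₀ with hm
  have hx₀0 := hs0 x₀ hx₀
  have hH0 := hH.pos x₀ hx₀0
  have hle : ∀ x : V, x ≠ 0 → ⟪x, y⟫_ℝ ≤ m * H x := by
    intro x hx
    have hn := norm_pos_iff.mpr hx
    have h1 := hmax (a := ‖x‖⁻¹ • x) (by simp [norm_smul, hn.ne'])
    simp only [mem_ofPred_eq, ← hm] at h1
    rw [hH.hom (inv_pos.mpr hn), inner_smul_left, smul_eq_mul, RCLike.conj_to_real,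
      mul_div_mul_left _ _ (inv_ne_zero hn.ne'), div_le_iff₀ (hH.pos x hx)] at h1
    exact h1
  have hmpos : 0 < m := by
    have h1 := hle y hy
    have h2 : 0 < ⟪y, y⟫_ℝ := real_inner_self_pos.mpr hy
    exact pos_of_mul_pos_left (h2.trans_le h1) (hH.nonneg y)
  have hmin : IsLocalMin (fun x => m * H x - ⟪x, y⟫_ℝ) x₀ := by
    filter_upwards [compl_zero_mem_nhds hx₀0] with x hx
    have := hle x hx
    have e : m * H x₀ = ⟪x₀, y⟫_ℝ := by rw [hm, div_mul_cancel₀ _ hH0.ne']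
    linarith
  have hd := hmin.fderiv_eq_zero
  have hd2 : DifferentiableAt ℝ (fun x : V => ⟪x, y⟫_ℝ) x₀ :=
    differentiableAt_id.inner ℝ (differentiableAt_const y)
  rw [fderiv_fun_sub ((hH.diff hx₀0).const_mul m) hd2, sub_eq_zero,
    fderiv_const_mul (hH.diff hx₀0)] at hd
  have hg : m • gradient H x₀ = y := by
    have := gradient_inner_const y x₀
    simpa only [gradient, ← hd, map_smul] using this
  refine ⟨m • x₀, smul_ne_zero hmpos.ne' hx₀0, ?_⟩
  rw [hH.bdMap_hom hmpos, bdMap, mem_sphere_zero_iff_norm.mp hx₀, one_smul, hg]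

end IsRegSupport

open Classical in
/-- The inverse of `bdMap H`. -/
def bdInv (H : V → ℝ) (y : V) : V := if y = 0 then 0 else Function.invFunOn (bdMap H) {0}ᶜ y

omit hH in
lemma bdInv_zero : bdInv H 0 = 0 := if_pos rfl

namespace IsRegSupport

lemma image_bdMap : bdMap H '' {0}ᶜ = {0}ᶜ :=
  (SurjOn.image_eq_of_mapsTo hH.bdMap_surjOn fun _ hx => hH.bdMap_ne_zero hx)

lemma bdInv_ne_zero {y : V} (hy : y ≠ 0) : bdInv H y ≠ 0 := by
  rw [bdInv, if_neg hy]
  exact Function.invFunOn_mem (hH.bdMap_surjOn hy)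

lemma bdMap_bdInv {y : V} (hy : y ≠ 0) : bdMap H (bdInv H y) = y := by
  rw [bdInv, if_neg hy]
  exact Function.invFunOn_eq (hH.bdMap_surjOn hy)

lemma bdInv_bdMap {x : V} (hx : x ≠ 0) : bdInv H (bdMap H x) = x :=
  hH.bdMap_injOn (hH.bdInv_ne_zero (hH.bdMap_ne_zero hx)) hx
    (hH.bdMap_bdInv (hH.bdMap_ne_zero hx))

lemma contDiffAt_bdInv {y : V} (hy : y ≠ 0) :
    ContDiffAt ℝ 1 (bdInv H) y ∧ HasFDerivAt (bdInv H) (Ring.inverse (dbd H (bdInv H y))) y := by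
  set x := bdInv H y with hxdef
  have hx : x ≠ 0 := hH.bdInv_ne_zero hy
  have hxy : bdMap H x = y := hH.bdMap_bdInv hy
  obtain ⟨u, hu⟩ := hH.isUnit_dbd hx
  have hc : ContDiffAt ℝ 1 (bdMap H) x := contDiffAt_of_ne hH.contDiffOn_bdMap hx
  have hd : HasFDerivAt (bdMap H)
      ((ContinuousLinearEquiv.ofUnit u : V ≃L[ℝ] V) : V →L[ℝ] V) x := by
    have e : ((ContinuousLinearEquiv.ofUnit u : V ≃L[ℝ] V) : V →L[ℝ] V) = dbd H x := by
      rw [← hu]; rfl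
    rw [e]; exact hH.hasFDerivAt_bdMap hx
  have hs := hc.hasStrictFDerivAt' hd one_ne_zero
  have hloc := hc.to_localInverse hd one_ne_zero
  have hcont := hloc.continuousAt
  rw [hxy] at hloc hcont
  have himg : hc.localInverse hd one_ne_zero y = x := by
    rw [← hxy]; exact hc.localInverse_apply_image hd one_ne_zero
  have hr : ∀ᶠ z in nhds y, bdMap H (hc.localInverse hd one_ne_zero z) = z := by
    have := hs.eventually_right_inverse
    rwa [hxy] at this
  have heq : bdInv H =ᶠ[nhds y] hc.localInverse hd one_ne_zero := by
    have h0 : ∀ᶠ z in nhds y, hc.localInverse hd one_ne_zero z ≠ 0 :=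
      hcont.eventually_ne (by rw [himg]; exact hx)
    filter_upwards [hr, h0] with z hz hz0
    conv_lhs => rw [← hz]
    exact hH.bdInv_bdMap hz0
  have hcd := hloc.congr_of_eventuallyEq heq
  refine ⟨hcd, ?_⟩
  have hdi := (hcd.differentiableAt one_ne_zero).hasFDerivAt
  have hcomp : (fderiv ℝ (bdInv H) y).comp (dbd H x) = ContinuousLinearMap.id ℝ V := by
    have h1 : HasFDerivAt (bdInv H ∘ bdMap H) ((fderiv ℝ (bdInv H) y).comp (dbd H x)) x :=
      HasFDerivAt.comp x (by rw [hxy]; exact hdi) (hH.hasFDerivAt_bdMap hx)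
    have h2 : bdInv H ∘ bdMap H =ᶠ[nhds x] id := by
      filter_upwards [compl_zero_mem_nhds hx] with z hz using hH.bdInv_bdMap hz
    exact h1.unique ((hasFDerivAt_id x).congr_of_eventuallyEq h2)
  have : fderiv ℝ (bdInv H) y = Ring.inverse (dbd H x) := by
    have h3 : fderiv ℝ (bdInv H) y * dbd H x = 1 := hcomp
    calc fderiv ℝ (bdInv H) y = fderiv ℝ (bdInv H) y * (dbd H x * Ring.inverse (dbd H x)) := by
          rw [Ring.mul_inverse_cancel _ (hH.isUnit_dbd hx), mul_one]
      _ = _ := by rw [← mul_assoc, h3, one_mul]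
  rwa [this] at hdi

end IsRegSupport
end Support

/-! ### Integration in the coordinates of the parametrization -/

section Radial

variable {χ : ℝ → ℝ}

lemma hasCompactSupport_of_eq_zero (hs : ∀ r, r ∉ Icc (1 : ℝ) 3 → χ r = 0) :
    HasCompactSupport χ :=
  HasCompactSupport.intro isCompact_Icc hs

/-- A smooth bump supported in `[1, 3]`. -/
lemma exists_radial_cutoff : ∃ χ : ℝ → ℝ, ContDiff ℝ 1 χ ∧ (∀ r, r ∉ Icc (1 : ℝ) 3 → χ r = 0) ∧
    (∀ r, 0 ≤ χ r) ∧ 0 < χ 2 := by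
  let f : ContDiffBump (2 : ℝ) := ⟨1 / 2, 1, by norm_num, by norm_num⟩
  refine ⟨f, f.contDiff, fun r hr => f.zero_of_le_dist ?_, fun r => f.nonneg, ?_⟩
  · by_contra hcon
    push Not at hcon
    have h1 : |r - 2| < 1 := hcon
    rw [abs_lt] at h1
    exact hr ⟨by linarith, by linarith⟩
  · rw [f.one_of_mem_closedBall (by simp; norm_num)]
    exact one_pos

lemma integral_pow_mul_pos (hχ : Continuous χ) (hs : ∀ r, r ∉ Icc (1 : ℝ) 3 → χ r = 0)
    (h0 : ∀ r, 0 ≤ χ r) (h2 : 0 < χ 2) (k : ℕ) : 0 < ∫ r in Ioi (0 : ℝ), r ^ k * χ r := by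
  rw [setIntegral_eq_integral_of_forall_compl_eq_zero]
  · refine ((continuous_pow k).mul hχ).integral_pos_of_hasCompactSupport_nonneg_nonzero (x := 2)
      (hasCompactSupport_of_eq_zero hs).mul_left (fun r => ?_)
      (mul_pos (by positivity) h2).ne'
    by_cases hr : r ∈ Icc (1 : ℝ) 3
    · exact mul_nonneg (pow_nonneg (by linarith [hr.1]) k) (h0 r)
    · simp [hs r hr]
  · intro r hr
    rw [hs r fun h => hr (lt_of_lt_of_le one_pos h.1), mul_zero]

lemma continuous_inv_pow_mul (hχ : Continuous χ) (hs : ∀ r, r ∉ Icc (1 : ℝ) 3 → χ r = 0) (j : ℕ) :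
    Continuous fun r => r⁻¹ ^ j * χ r := by
  rw [continuous_iff_continuousAt]
  intro r
  rcases eq_or_ne r 0 with rfl | hr
  · have : (fun r => r⁻¹ ^ j * χ r) =ᶠ[nhds 0] fun _ => 0 := by
      filter_upwards [gt_mem_nhds (zero_lt_one' ℝ)] with s h
      rw [hs s fun h2 => absurd h2.1 (not_le.mpr h), mul_zero]
    exact continuousAt_const.congr this.symm
  · exact ((continuousAt_inv₀ hr).pow j).mul hχ.continuousAt

lemma integral_pow_mul_deriv (hχ : ContDiff ℝ 1 χ) (hs : ∀ r, r ∉ Icc (1 : ℝ) 3 → χ r = 0)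
    (k : ℕ) : ∫ r in Ioi (0 : ℝ), r ^ (k + 1) * deriv χ r =
      -((k + 1 : ℝ) * ∫ r in Ioi (0 : ℝ), r ^ k * χ r) := by
  have hc := hasCompactSupport_of_eq_zero hs
  have hd0 : ∀ r, r ≤ 0 → deriv χ r = 0 := by
    intro r hr
    have : χ =ᶠ[nhds r] fun _ => 0 := by
      filter_upwards [gt_mem_nhds (lt_of_le_of_lt hr one_pos)] with s h
      exact hs s fun h2 => absurd h2.1 (not_le.mpr h)
    rw [this.deriv_eq, deriv_const]
  rw [setIntegral_eq_integral_of_forall_compl_eq_zero,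
    setIntegral_eq_integral_of_forall_compl_eq_zero]
  · have hdc : Continuous (deriv χ) := hχ.continuous_deriv le_rfl
    have h := integral_mul_deriv_eq_deriv_mul_of_integrable (u := fun r : ℝ => r ^ (k + 1))
      (u' := fun r : ℝ => (k + 1 : ℝ) * r ^ k) (v := χ) (v' := deriv χ)
      (fun r _ => by simpa using hasDerivAt_pow (k + 1) r)
      (fun r _ => (hχ.differentiable one_ne_zero r).hasDerivAt)
      (((continuous_pow (k + 1)).mul hdc).integrable_of_hasCompactSupport hc.deriv.mul_left)
      ((((continuous_pow k).const_mul _).mul hχ.continuous).integrable_of_hasCompactSupport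
        hc.mul_left)
      (((continuous_pow (k + 1)).mul hχ.continuous).integrable_of_hasCompactSupport hc.mul_left)
    rw [h, ← integral_const_mul]
    simp only [mul_assoc]
  · intro r hr
    rw [hs r fun h => hr (lt_of_lt_of_le one_pos h.1), mul_zero]
  · intro r hr
    rw [hd0 r (not_lt.mp hr), mul_zero]

lemma deriv_eq_zero_of_notMem (hs : ∀ r, r ∉ Icc (1 : ℝ) 3 → χ r = 0) (r : ℝ)
    (hr : r ∉ Icc (1 : ℝ) 3) : deriv χ r = 0 := by
  have : χ =ᶠ[nhds r] fun _ => 0 := by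
    filter_upwards [isClosed_Icc.isOpen_compl.mem_nhds hr] with s h using hs s h
  rw [this.deriv_eq, deriv_const]

end Radial

section Polar

variable {V W : Type*} [NormedAddCommGroup V] [InnerProductSpace ℝ V] [FiniteDimensional ℝ V]
  [Nontrivial V] [MeasurableSpace V] [BorelSpace V] {μ : Measure V} [μ.IsAddHaarMeasure]
  [NormedAddCommGroup W] [NormedSpace ℝ W]

lemma integral_polar {g : V → ℝ} (hg : Hom0 g) (χ : ℝ → ℝ) :
    ∫ x, χ ‖x‖ * g x ∂μ =
      (∫ s : sphere (0 : V) 1, g s ∂μ.toSphere) *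
        ∫ r in Ioi (0 : ℝ), r ^ (finrank ℝ V - 1) * χ r := by
  calc
    ∫ x, χ ‖x‖ * g x ∂μ = ∫ x : ({(0)}ᶜ : Set V), χ ‖x.1‖ * g x.1 ∂(μ.comap (↑)) := by
      rw [integral_subtype_comap (measurableSet_singleton _).compl fun x ↦ χ ‖x‖ * g x,
        restrict_compl_singleton]
    _ = ∫ x : sphere (0 : V) 1 × Ioi (0 : ℝ), g x.1 * χ x.2
          ∂μ.toSphere.prod (.volumeIoiPow (finrank ℝ V - 1)) := by
      rw [← μ.measurePreserving_homeomorphUnitSphereProd.integral_comp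
        (Homeomorph.measurableEmbedding _)]
      refine integral_congr_ae (Filter.Eventually.of_forall fun x => ?_)
      have hx : x.1 ≠ 0 := x.2
      simp only [homeomorphUnitSphereProd_apply_snd_coe, homeomorphUnitSphereProd_apply_fst_coe]
      rw [hg (inv_pos.mpr (norm_pos_iff.mpr hx)), mul_comm]
    _ = (∫ s : sphere (0 : V) 1, g s ∂μ.toSphere) *
          ∫ x : Ioi (0 : ℝ), χ x ∂.volumeIoiPow (finrank ℝ V - 1) :=
      integral_prod_mul (fun s : sphere (0 : V) 1 => g s) (fun x : Ioi (0 : ℝ) => χ x)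
    _ = _ := by
      congr 1
      simp only [Measure.volumeIoiPow, ENNReal.ofReal]
      rw [integral_withDensity_eq_integral_smul]
      · rw [integral_subtype_comap measurableSet_Ioi
          fun a : ℝ => Real.toNNReal (a ^ (finrank ℝ V - 1)) • χ a]
        refine setIntegral_congr_fun measurableSet_Ioi fun x hx => ?_
        rw [NNReal.smul_def, Real.coe_toNNReal _ (pow_nonneg hx.out.le _), smul_eq_mul]
      · exact (measurable_subtype_coe.pow_const _).real_toNNReal

/-- The trace as a continuous linear functional on endomorphisms. -/
def ctrace : (V →L[ℝ] V) →L[ℝ] ℝ :=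
  LinearMap.toContinuousLinearMap (LinearMap.trace ℝ V ∘ₗ ContinuousLinearMap.coeLM ℝ)

lemma ctrace_apply (L : V →L[ℝ] V) : ctrace L = LinearMap.trace ℝ V (L : V →ₗ[ℝ] V) := rfl

lemma ctrace_eq_sum {ι : Type*} [Fintype ι] (b : OrthonormalBasis ι ℝ V) (L : V →L[ℝ] V) :
    ctrace L = ∑ i, ⟪b i, L (b i)⟫_ℝ :=
  LinearMap.trace_eq_sum_inner _ b

lemma ctrace_mul_comm (L M : V →L[ℝ] V) : ctrace (L * M) = ctrace (M * L) :=
  LinearMap.trace_mul_comm ℝ (L : V →ₗ[ℝ] V) (M : V →ₗ[ℝ] V)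

lemma ctrace_smulRight (l : V →L[ℝ] ℝ) (v : V) : ctrace (l.smulRight v) = l v :=
  LinearMap.trace_smulRight (l : V →ₗ[ℝ] ℝ) v

lemma integral_fderiv_apply_eq_zero {f : V → ℝ} (hf : ContDiff ℝ 1 f) (hc : HasCompactSupport f)
    (v : V) : ∫ y, fderiv ℝ f y v ∂μ = 0 := by
  have hcont : Continuous fun y => fderiv ℝ f y v :=
    (hf.continuous_fderiv one_ne_zero).clm_apply continuous_const
  have h := integral_mul_fderiv_eq_neg_fderiv_mul_of_integrable (𝕜 := ℝ) (μ := μ)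
    (f := fun _ : V => (1 : ℝ)) (g := f) (v := v) (by simp)
    (by simpa using hcont.integrable_of_hasCompactSupport (hc.fderiv_apply ℝ v))
    (by simpa using hf.continuous.integrable_of_hasCompactSupport hc)
    (fun _ _ => differentiableAt_const _) (fun x _ => hf.differentiable one_ne_zero x)
  simpa using h

/-- The divergence theorem for a compactly supported vector field. -/
lemma integral_ctrace_fderiv_eq_zero {U : V → V} (hU : ContDiff ℝ 1 U)
    (hc : HasCompactSupport U) : ∫ y, ctrace (fderiv ℝ U y) ∂μ = 0 := by
  set b := stdOrthonormalBasis ℝ V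
  have hcont : Continuous (fderiv ℝ U) := hU.continuous_fderiv one_ne_zero
  simp only [ctrace_eq_sum b]
  have hi : ∀ i, ContDiff ℝ 1 fun y => ⟪b i, U y⟫_ℝ := fun i => contDiff_const.inner ℝ hU
  have hci : ∀ i, HasCompactSupport fun y => ⟪b i, U y⟫_ℝ := fun i =>
    hc.comp_left (g := fun z => ⟪b i, z⟫_ℝ) (inner_zero_right _)
  have he : ∀ i y, ⟪b i, fderiv ℝ U y (b i)⟫_ℝ = fderiv ℝ (fun y => ⟪b i, U y⟫_ℝ) y (b i) := by
    intro i y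
    rw [fderiv_inner_apply ℝ (differentiableAt_const _) (hU.differentiable one_ne_zero y)]
    simp
  rw [integral_finsetSum]
  · refine Finset.sum_eq_zero fun i _ => ?_
    simp only [he]
    exact integral_fderiv_apply_eq_zero (hi i) (hci i) _
  · intro i _
    refine Continuous.integrable_of_hasCompactSupport
      (continuous_const.inner (hcont.clm_apply continuous_const)) ?_
    exact (hc.fderiv (𝕜 := ℝ)).comp_left (g := fun L : V →L[ℝ] V => ⟪b i, L (b i)⟫_ℝ) (by simp)

variable {H : V → ℝ} (hH : IsRegSupport H)
include hH

namespace IsRegSupport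

/-- The gradient of `H` is bounded above and away from zero. -/
lemma exists_bounds : ∃ c C : ℝ, 0 < c ∧ 0 < C ∧
    ∀ y, c * ‖bdInv H y‖ ≤ ‖y‖ ∧ ‖y‖ ≤ C * ‖bdInv H y‖ := by
  have hne : (sphere (0 : V) 1).Nonempty := NormedSpace.sphere_nonempty.mpr zero_le_one
  have hs0 : ∀ x ∈ sphere (0 : V) 1, x ≠ 0 := fun x hx => ne_zero_of_mem_unit_sphere ⟨x, hx⟩
  have hcont : ContinuousOn (fun x => ‖gradient H x‖) (sphere (0 : V) 1) :=
    (hH.gradient_contDiffOn.continuousOn.mono hs0).norm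
  obtain ⟨a, ha, hmin⟩ := (isCompact_sphere (0 : V) 1).exists_isMinOn hne hcont
  obtain ⟨b, hb, hmax⟩ := (isCompact_sphere (0 : V) 1).exists_isMaxOn hne hcont
  refine ⟨‖gradient H a‖, ‖gradient H b‖, norm_pos_iff.mpr (hH.gradient_ne_zero (hs0 a ha)),
    norm_pos_iff.mpr (hH.gradient_ne_zero (hs0 b hb)), fun y => ?_⟩
  rcases eq_or_ne y 0 with rfl | hy
  · simp [bdInv_zero]
  · have hx := hH.bdInv_ne_zero hy
    have hxy := hH.bdMap_bdInv hy
    set x := bdInv H y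
    have hn := norm_pos_iff.mpr hx
    have hmem : ‖x‖⁻¹ • x ∈ sphere (0 : V) 1 := by simp [norm_smul, hn.ne']
    have h1 : ‖gradient H a‖ ≤ ‖gradient H (‖x‖⁻¹ • x)‖ := hmin hmem
    have h2 : ‖gradient H (‖x‖⁻¹ • x)‖ ≤ ‖gradient H b‖ := hmax hmem
    rw [hH.hom.gradient (inv_pos.mpr hn)] at h1 h2
    rw [← hxy, bdMap, norm_smul, norm_norm, mul_comm]
    refine ⟨mul_le_mul_of_nonneg_left h1 hn.le, ?_⟩
    rw [mul_comm (‖gradient H b‖)]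
    exact mul_le_mul_of_nonneg_left h2 hn.le

lemma eventually_norm_bdInv_lt_one : ∀ᶠ y in nhds (0 : V), ‖bdInv H y‖ < 1 := by
  obtain ⟨c, C, hc, -, h⟩ := hH.exists_bounds
  filter_upwards [Metric.ball_mem_nhds (0 : V) hc] with y hy
  have h1 := (h y).1
  rw [mem_ball_zero_iff] at hy
  by_contra hcon
  push Not at hcon
  nlinarith

variable {χ : ℝ → ℝ}

lemma cutoff_eventually_zero (hs : ∀ r, r ∉ Icc (1 : ℝ) 3 → χ r = 0) (a : V → W) :
    (fun y => χ ‖bdInv H y‖ • a (bdInv H y)) =ᶠ[nhds 0] fun _ => 0 := by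
  filter_upwards [hH.eventually_norm_bdInv_lt_one] with y hy
  rw [hs _ fun h => absurd h.1 (not_le.mpr hy), zero_smul]

lemma hasCompactSupport_cutoff (hs : ∀ r, r ∉ Icc (1 : ℝ) 3 → χ r = 0) (a : V → W) :
    HasCompactSupport fun y => χ ‖bdInv H y‖ • a (bdInv H y) := by
  obtain ⟨c, C, hc, hC, h⟩ := hH.exists_bounds
  refine HasCompactSupport.intro (isCompact_closedBall (0 : V) (C * 3)) fun y hy => ?_
  rw [hs, zero_smul]
  intro h1
  rw [mem_closedBall_zero_iff] at hy
  exact hy ((h y).2.trans (mul_le_mul_of_nonneg_left h1.2 hC.le))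

lemma continuous_cutoff (hχ : Continuous χ) (hs : ∀ r, r ∉ Icc (1 : ℝ) 3 → χ r = 0) {a : V → W}
    (ha : ContinuousOn a {0}ᶜ) : Continuous fun y => χ ‖bdInv H y‖ • a (bdInv H y) := by
  rw [continuous_iff_continuousAt]
  intro y
  rcases eq_or_ne y 0 with rfl | hy
  · exact (continuousAt_const).congr (hH.cutoff_eventually_zero hs a).symm
  · have hξ := (hH.contDiffAt_bdInv hy).1.continuousAt
    have hx := hH.bdInv_ne_zero hy
    exact (hχ.continuousAt.comp hξ.norm).smul
      (ContinuousAt.comp (ha.continuousAt (compl_zero_mem_nhds hx)) hξ)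

lemma contDiff_cutoff (hχ : ContDiff ℝ 1 χ) (hs : ∀ r, r ∉ Icc (1 : ℝ) 3 → χ r = 0) {a : V → W}
    (ha : ContDiffOn ℝ 1 a {0}ᶜ) : ContDiff ℝ 1 fun y => χ ‖bdInv H y‖ • a (bdInv H y) := by
  rw [contDiff_iff_contDiffAt]
  intro y
  rcases eq_or_ne y 0 with rfl | hy
  · exact (contDiffAt_const).congr_of_eventuallyEq (hH.cutoff_eventually_zero hs a)
  · have hξ := (hH.contDiffAt_bdInv hy).1
    have hx := hH.bdInv_ne_zero hy
    exact (hχ.contDiffAt.comp y (hξ.norm ℝ hx)).smul (ContDiffAt.comp y (contDiffAt_of_ne ha hx) hξ)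

lemma fderiv_comp_bdInv {a : V → W} (ha : ContDiffOn ℝ 1 a {0}ᶜ) {y : V} (hy : y ≠ 0) :
    HasFDerivAt (fun z => a (bdInv H z))
      (fderiv ℝ a (bdInv H y) ∘L Ring.inverse (dbd H (bdInv H y))) y :=
  HasFDerivAt.comp y (differentiableAt_of_contDiffOn one_ne_zero ha
    (hH.bdInv_ne_zero hy)).hasFDerivAt (hH.contDiffAt_bdInv hy).2

/-- `|ξ(y)|`, with `ξ` the inverse of `bdMap H`, is the gauge of the body; its gradient is
`ξ / H(ξ)`. -/
lemma hasFDerivAt_norm_bdInv {y : V} (hy : y ≠ 0) :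
    HasFDerivAt (fun z => ‖bdInv H z‖) ((H (bdInv H y))⁻¹ • innerSL ℝ (bdInv H y)) y := by
  have hx := hH.bdInv_ne_zero hy
  have h := HasFDerivAt.comp y (hasFDerivAt_norm_of_ne hx) (hH.contDiffAt_bdInv hy).2
  refine h.congr_fderiv ?_
  ext v
  have hn := norm_ne_zero_iff.mpr hx
  simp only [ContinuousLinearMap.comp_apply, FunLike.coe_smul, Pi.smul_apply, innerSL_apply_apply,
    hH.inner_inverse_dbd hx, smul_eq_mul]
  field_simp

lemma fderiv_cutoff (hχ : ContDiff ℝ 1 χ) {a : V → W}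
    (ha : ContDiffOn ℝ 1 a {0}ᶜ) {y : V} (hy : y ≠ 0) :
    fderiv ℝ (fun y => χ ‖bdInv H y‖ • a (bdInv H y)) y =
      χ ‖bdInv H y‖ • (fderiv ℝ a (bdInv H y) ∘L Ring.inverse (dbd H (bdInv H y))) +
      ((deriv χ ‖bdInv H y‖ * (H (bdInv H y))⁻¹) • innerSL ℝ (bdInv H y)).smulRight
        (a (bdInv H y)) := by
  have h1 : HasFDerivAt (fun z => χ ‖bdInv H z‖)
      (deriv χ ‖bdInv H y‖ • (H (bdInv H y))⁻¹ • innerSL ℝ (bdInv H y)) y :=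
    ((hχ.differentiable one_ne_zero _).hasDerivAt).comp_hasFDerivAt y (hH.hasFDerivAt_norm_bdInv hy)
  rw [smul_smul] at h1
  exact (h1.smul (hH.fderiv_comp_bdInv ha hy)).fderiv

/-- Polar coordinates `y = bdMap H x`: the cone volume element is `|det dbd H|` times the spherical
measure. -/
lemma integral_comp_bdInv {g : V → ℝ} (hg : Hom0 g) (χ : ℝ → ℝ) :
    ∫ y, χ ‖bdInv H y‖ * g (bdInv H y) ∂μ =
      (∫ s : sphere (0 : V) 1, |(dbd H s).det| * g s ∂μ.toSphere) *
        ∫ r in Ioi (0 : ℝ), r ^ (finrank ℝ V - 1) * χ r := by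
  have h := integral_image_eq_integral_abs_det_fderiv_smul μ
    (measurableSet_singleton (0 : V)).compl
    (fun x hx => (hH.hasFDerivAt_bdMap hx).hasFDerivWithinAt) hH.bdMap_injOn
    (fun y => χ ‖bdInv H y‖ * g (bdInv H y))
  rw [hH.image_bdMap, restrict_compl_singleton] at h
  rw [h, ← integral_polar (μ := μ) (g := fun x => |(dbd H x).det| * g x)]
  · rw [← restrict_compl_singleton (μ := μ) 0]
    refine setIntegral_congr_fun (measurableSet_singleton (0 : V)).compl fun x hx => ?_
    simp only [hH.bdInv_bdMap hx, smul_eq_mul]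
    ring
  · intro t ht x
    simp only [hH.dbd_smul ht, hg ht]

lemma hom0_div {w : V → W} (hw : Hom0 w) :
    Hom0 fun x => ‖x‖ • (fderiv ℝ w x ∘L Ring.inverse (dbd H x)) := by
  intro t ht x
  simp only [hw.fderiv_smul ht, hH.dbd_smul ht, norm_smul, Real.norm_of_nonneg ht.le,
    ContinuousLinearMap.smul_comp, smul_smul]
  congr 1
  field_simp

lemma continuousOn_fderiv_comp {w : V → W} (hw : ContDiffOn ℝ 1 w {0}ᶜ) :
    ContinuousOn (fun x => fderiv ℝ w x ∘L Ring.inverse (dbd H x)) {0}ᶜ :=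
  (continuousOn_fderiv hw).clm_comp hH.continuousOn_inverse_dbd

/-- The divergence theorem on the boundary of the body with support function `H`: integrate the
divergence of `y ↦ χ(|ξ|) w(ξ)`, where `ξ` is the inverse of `bdMap H` and `χ` is a radial
cutoff. -/
theorem integral_ctrace (hd : 2 ≤ finrank ℝ V) {w : V → V} (hw : ContDiffOn ℝ 1 w {0}ᶜ)
    (hw0 : Hom0 w) :
    ∫ s : sphere (0 : V) 1,
        |(dbd H s).det| * ctrace (fderiv ℝ w s ∘L Ring.inverse (dbd H s)) ∂μ.toSphere =
      ((finrank ℝ V : ℝ) - 1) *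
        ∫ s : sphere (0 : V) 1, |(dbd H s).det| * (⟪(s : V), w s⟫_ℝ / H s) ∂μ.toSphere := by
  obtain ⟨χ, hχ, hs, hχ0, hχ2⟩ := exists_radial_cutoff
  obtain ⟨k, hk⟩ : ∃ k, finrank ℝ V = k + 2 := ⟨_, (Nat.sub_add_cancel hd).symm⟩
  have h0 := integral_ctrace_fderiv_eq_zero (μ := μ) (hH.contDiff_cutoff hχ hs hw)
    (hH.hasCompactSupport_cutoff hs w)
  set g1 : V → ℝ := fun x => ctrace (‖x‖ • (fderiv ℝ w x ∘L Ring.inverse (dbd H x))) with hg1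
  set g2 : V → ℝ := fun x => ⟪x, w x⟫_ℝ / H x with hg2
  have hg10 : Hom0 g1 := fun t ht x => congrArg ctrace (hH.hom0_div hw0 ht x)
  have hg20 : Hom0 g2 := by
    intro t ht x
    simp only [hg2, hw0 ht, hH.hom ht, inner_smul_left, smul_eq_mul, RCLike.conj_to_real]
    rw [mul_div_mul_left _ _ ht.ne']
  have hc1 : ContinuousOn g1 {0}ᶜ :=
    ctrace.continuous.comp_continuousOn (continuousOn_id.norm.smul (hH.continuousOn_fderiv_comp hw))
  have hc2 : ContinuousOn g2 {0}ᶜ :=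
    (continuousOn_id.inner hw.continuousOn).div hH.smooth.continuousOn fun x hx => (hH.pos x hx).ne'
  have hχ1 : ∀ r, r ∉ Icc (1 : ℝ) 3 → r⁻¹ * χ r = 0 := fun r hr => by rw [hs r hr, mul_zero]
  have hχc : Continuous fun r => r⁻¹ * χ r := by
    simpa using continuous_inv_pow_mul hχ.continuous hs 1
  have hsplit : ∫ y, ctrace (fderiv ℝ (fun y => χ ‖bdInv H y‖ • w (bdInv H y)) y) ∂μ =
      ∫ y, ((‖bdInv H y‖⁻¹ * χ ‖bdInv H y‖) * g1 (bdInv H y) +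
        deriv χ ‖bdInv H y‖ * g2 (bdInv H y)) ∂μ := by
    rw [← restrict_compl_singleton (μ := μ) 0]
    refine setIntegral_congr_fun (measurableSet_singleton (0 : V)).compl fun y hy => ?_
    have hx := norm_ne_zero_iff.mpr (hH.bdInv_ne_zero hy)
    simp only [hH.fderiv_cutoff hχ hw hy, map_add, map_smul, ctrace_smulRight, hg1, hg2,
      FunLike.coe_smul, Pi.smul_apply, innerSL_apply_apply, smul_eq_mul]
    field_simp
  rw [h0, integral_add] at hsplit
  rotate_left
  · simpa only [smul_eq_mul] using (hH.continuous_cutoff hχc hχ1 hc1).integrable_of_hasCompactSupport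
      (hH.hasCompactSupport_cutoff hχ1 g1)
  · simpa only [smul_eq_mul] using (hH.continuous_cutoff (hχ.continuous_deriv le_rfl)
      (deriv_eq_zero_of_notMem hs) hc2).integrable_of_hasCompactSupport
      (hH.hasCompactSupport_cutoff (deriv_eq_zero_of_notMem hs) g2)
  rw [hH.integral_comp_bdInv hg10 (fun r => r⁻¹ * χ r), hH.integral_comp_bdInv hg20 (deriv χ)] at hsplit
  have e1 : ∫ r in Ioi (0 : ℝ), r ^ (finrank ℝ V - 1) * (r⁻¹ * χ r) =
      ∫ r in Ioi (0 : ℝ), r ^ k * χ r := by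
    refine setIntegral_congr_fun measurableSet_Ioi fun r hr => ?_
    have hr0 : r ≠ 0 := ne_of_gt hr
    simp only [hk, show k + 2 - 1 = k + 1 from rfl, pow_succ]
    field_simp
  have e2 : finrank ℝ V - 1 = k + 1 := by rw [hk]; rfl
  rw [e1, e2, integral_pow_mul_deriv hχ hs k] at hsplit
  have e3 : ((finrank ℝ V : ℝ) - 1) = k + 1 := by rw [hk]; push_cast; ring
  have e4 : ∀ s : sphere (0 : V) 1, g1 s = ctrace (fderiv ℝ w s ∘L Ring.inverse (dbd H s)) := by
    intro s
    simp [hg1]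
  rw [e3]
  simp only [e4, hg2] at hsplit
  refine mul_right_cancel₀ (integral_pow_mul_pos hχ.continuous hs hχ0 hχ2 k).ne' ?_
  linear_combination -hsplit

end IsRegSupport
end Polar

/-! ### The quadratic identity for mixed volumes -/

section Curl

variable {V W : Type*} [NormedAddCommGroup V] [InnerProductSpace ℝ V] [FiniteDimensional ℝ V]
  [Nontrivial V] [MeasurableSpace V] [BorelSpace V] {μ : Measure V} [μ.IsAddHaarMeasure]
  [NormedAddCommGroup W] [NormedSpace ℝ W]

/-- Two directional derivatives can be exchanged under the integral although `f` and `g` are only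
`C¹`: one of them is replaced by difference quotients. -/
lemma integral_fderiv_mul_fderiv_comm {f g : V → ℝ} (hf : ContDiff ℝ 1 f) (hg : ContDiff ℝ 1 g)
    (hfc : HasCompactSupport f) (hgc : HasCompactSupport g) (u v : V) :
    ∫ y, fderiv ℝ f y u * fderiv ℝ g y v ∂μ = ∫ y, fderiv ℝ f y v * fderiv ℝ g y u ∂μ := by
  obtain ⟨C, hC⟩ := hf.lipschitzWith_of_hasCompactSupport hfc one_ne_zero
  obtain ⟨D, hD⟩ := hg.lipschitzWith_of_hasCompactSupport hgc one_ne_zero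
  have hcf : ∀ w, Continuous fun y => fderiv ℝ f y w := fun w =>
    (hf.continuous_fderiv one_ne_zero).clm_apply continuous_const
  have hcg : ∀ w, Continuous fun y => fderiv ℝ g y w := fun w =>
    (hg.continuous_fderiv one_ne_zero).clm_apply continuous_const
  have hif : ∀ w, Integrable (fun y => fderiv ℝ f y w) μ := fun w =>
    (hcf w).integrable_of_hasCompactSupport (hfc.fderiv_apply ℝ w)
  have hig : ∀ w, Integrable (fun y => fderiv ℝ g y w) μ := fun w =>
    (hcg w).integrable_of_hasCompactSupport (hgc.fderiv_apply ℝ w)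
  have A := hC.integral_inv_smul_sub_mul_tendsto_integral_lineDeriv_mul (hig v) u
  have B := hD.integral_inv_smul_sub_mul_tendsto_integral_lineDeriv_mul (hif v) (-u)
  have hS : ∀ t : ℝ, ∫ x, (t⁻¹ • (f (x + t • u) - f x)) * fderiv ℝ g x v ∂μ =
      -∫ x, (t⁻¹ • (g (x + t • (-u)) - g x)) * fderiv ℝ f x v ∂μ := by
    intro t
    have hft : ContDiff ℝ 1 fun x => f (x + t • u) := hf.comp (contDiff_id.add contDiff_const)
    have hftd : ∀ x, fderiv ℝ (fun x => f (x + t • u)) x v = fderiv ℝ f (x + t • u) v := by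
      intro x; rw [fderiv_comp_add_right]
    have hkey : ∀ a : V → ℝ, ContDiff ℝ 1 a →
        ∫ x, a x * fderiv ℝ g x v ∂μ = -∫ x, fderiv ℝ a x v * g x ∂μ := by
      intro a ha
      have hca : Continuous fun y => fderiv ℝ a y v :=
        (ha.continuous_fderiv one_ne_zero).clm_apply continuous_const
      exact integral_mul_fderiv_eq_neg_fderiv_mul_of_integrable
        ((hca.mul hg.continuous).integrable_of_hasCompactSupport hgc.mul_left)
        ((ha.continuous.mul (hcg v)).integrable_of_hasCompactSupport
          (HasCompactSupport.mul_left (hgc.fderiv_apply ℝ v)))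
        ((ha.continuous.mul hg.continuous).integrable_of_hasCompactSupport hgc.mul_left)
        (fun x _ => ha.differentiable one_ne_zero x) (fun x _ => hg.differentiable one_ne_zero x)
    have h1 := hkey _ hft
    have h2 := hkey _ hf
    simp only [hftd] at h1
    have h3 : ∫ x, fderiv ℝ f (x + t • u) v * g x ∂μ =
        ∫ x, fderiv ℝ f x v * g (x + t • (-u)) ∂μ := by
      rw [← integral_add_right_eq_self (fun x => fderiv ℝ f x v * g (x + t • (-u))) (t • u)]
      simp
    have hi1 : Integrable (fun x => f (x + t • u) * fderiv ℝ g x v) μ :=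
      (hft.continuous.mul (hcg v)).integrable_of_hasCompactSupport
          (HasCompactSupport.mul_left (hgc.fderiv_apply ℝ v))
    have hi2 : Integrable (fun x => f x * fderiv ℝ g x v) μ :=
      (hf.continuous.mul (hcg v)).integrable_of_hasCompactSupport
          (HasCompactSupport.mul_left (hgc.fderiv_apply ℝ v))
    have hgt : Continuous fun x => g (x + t • (-u)) := hg.continuous.comp (by fun_prop)
    have hi3 : Integrable (fun x => fderiv ℝ f x v * g (x + t • (-u))) μ :=
      ((hcf v).mul hgt).integrable_of_hasCompactSupport
          (HasCompactSupport.mul_right (hfc.fderiv_apply ℝ v))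
    have hi4 : Integrable (fun x => fderiv ℝ f x v * g x) μ :=
      ((hcf v).mul hg.continuous).integrable_of_hasCompactSupport
          (HasCompactSupport.mul_right (hfc.fderiv_apply ℝ v))
    have e1 : ∫ x, (t⁻¹ • (f (x + t • u) - f x)) * fderiv ℝ g x v ∂μ =
        t⁻¹ * (∫ x, f (x + t • u) * fderiv ℝ g x v ∂μ - ∫ x, f x * fderiv ℝ g x v ∂μ) := by
      rw [← integral_sub hi1 hi2, ← integral_const_mul]
      congr 1; ext x; simp only [smul_eq_mul]; ring
    have e2 : ∫ x, (t⁻¹ • (g (x + t • (-u)) - g x)) * fderiv ℝ f x v ∂μ =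
        t⁻¹ * (∫ x, fderiv ℝ f x v * g (x + t • (-u)) ∂μ - ∫ x, fderiv ℝ f x v * g x ∂μ) := by
      rw [← integral_sub hi3 hi4, ← integral_const_mul]
      congr 1; ext x; simp only [smul_eq_mul]; ring
    rw [e1, e2, h1, h2, h3]
    ring
  simp only [hS] at A
  have h := tendsto_nhds_unique A B.neg
  have hlf : ∀ x, lineDeriv ℝ f x u = fderiv ℝ f x u := fun x =>
    (hf.differentiable one_ne_zero x).lineDeriv_eq_fderiv
  have hlg : ∀ x, lineDeriv ℝ g x (-u) = -fderiv ℝ g x u := fun x => by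
    rw [(hg.differentiable one_ne_zero x).lineDeriv_eq_fderiv, map_neg]
  simp only [hlf, hlg, neg_mul, integral_neg, neg_neg] at h
  rw [h]
  simp only [mul_comm]

/-- The second elementary symmetric function of the derivative of a vector field is a
divergence. -/
lemma integral_sq_ctrace_sub {U : V → V} (hU : ContDiff ℝ 1 U) (hc : HasCompactSupport U) :
    ∫ y, (ctrace (fderiv ℝ U y) ^ 2 - ctrace (fderiv ℝ U y * fderiv ℝ U y)) ∂μ = 0 := by
  set b := stdOrthonormalBasis ℝ V
  have hcont : Continuous (fderiv ℝ U) := hU.continuous_fderiv one_ne_zero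
  set f : Fin (finrank ℝ V) → V → ℝ := fun i y => ⟪b i, U y⟫_ℝ
  have hi : ∀ i, ContDiff ℝ 1 (f i) := fun i => contDiff_const.inner ℝ hU
  have hci : ∀ i, HasCompactSupport (f i) := fun i =>
    hc.comp_left (g := fun z => ⟪b i, z⟫_ℝ) (inner_zero_right _)
  have he : ∀ i y v, ⟪b i, fderiv ℝ U y v⟫_ℝ = fderiv ℝ (f i) y v := by
    intro i y v
    rw [fderiv_inner_apply ℝ (differentiableAt_const _) (hU.differentiable one_ne_zero y)]
    simp
  have hint : ∀ i j u v, Integrable (fun y => fderiv ℝ (f i) y u * fderiv ℝ (f j) y v) μ := by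
    intro i j u v
    refine Continuous.integrable_of_hasCompactSupport ?_
      (HasCompactSupport.mul_right ((hci i).fderiv_apply ℝ u))
    exact (((hi i).continuous_fderiv one_ne_zero).clm_apply continuous_const).mul
      (((hi j).continuous_fderiv one_ne_zero).clm_apply continuous_const)
  have h1 : ∀ y, ctrace (fderiv ℝ U y) ^ 2 - ctrace (fderiv ℝ U y * fderiv ℝ U y) =
      ∑ i, ∑ j, (fderiv ℝ (f i) y (b i) * fderiv ℝ (f j) y (b j) -
        fderiv ℝ (f i) y (b j) * fderiv ℝ (f j) y (b i)) := by
    intro y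
    simp only [Finset.sum_sub_distrib]
    congr 1
    · rw [ctrace_eq_sum b, sq, Finset.sum_mul_sum]
      simp only [he]
    · rw [ctrace_eq_sum b]
      refine Finset.sum_congr rfl fun i _ => ?_
      show ⟪b i, fderiv ℝ U y (fderiv ℝ U y (b i))⟫_ℝ = _
      rw [he]
      conv_lhs => rw [← b.sum_repr' (fderiv ℝ U y (b i))]
      rw [map_sum]
      refine Finset.sum_congr rfl fun j _ => ?_
      rw [map_smul, he, smul_eq_mul, mul_comm]
  simp only [h1]
  have hint2 : ∀ i j, Integrable (fun y => fderiv ℝ (f i) y (b i) * fderiv ℝ (f j) y (b j) -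
      fderiv ℝ (f i) y (b j) * fderiv ℝ (f j) y (b i)) μ := fun i j =>
    (hint i j _ _).sub (hint i j _ _)
  rw [integral_finsetSum _ fun i _ => integrable_finsetSum _ fun j _ => hint2 i j]
  refine Finset.sum_eq_zero fun i _ => ?_
  rw [integral_finsetSum _ fun j _ => hint2 i j]
  refine Finset.sum_eq_zero fun j _ => ?_
  rw [integral_sub (hint i j _ _) (hint i j _ _),
    integral_fderiv_mul_fderiv_comm (hi i) (hi j) (hci i) (hci j), sub_self]

/-- `(tr M)² - tr M²`, twice the second elementary symmetric function, is affine along a rank one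
perturbation. -/
lemma ctrace_rank_one (N : V →L[ℝ] V) (c a : ℝ) (ξ w : V) :
    ctrace (c • N + (a • innerSL ℝ ξ).smulRight w) ^ 2 -
      ctrace ((c • N + (a • innerSL ℝ ξ).smulRight w) * (c • N + (a • innerSL ℝ ξ).smulRight w)) =
    c ^ 2 * (ctrace N ^ 2 - ctrace (N * N)) +
      2 * c * a * (ctrace N * ⟪ξ, w⟫_ℝ - ⟪ξ, N w⟫_ℝ) := by
  set R : V →L[ℝ] V := (a • innerSL ℝ ξ).smulRight w with hR
  have h1 : ctrace (N * R) = a * ⟪ξ, N w⟫_ℝ := by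
    rw [ctrace_mul_comm]
    have : R * N = ((a • innerSL ℝ ξ) ∘L N).smulRight w := by
      ext v; simp [hR]
    rw [this, ctrace_smulRight]
    simp
  have h2 : ctrace R = a * ⟪ξ, w⟫_ℝ := by
    rw [hR, ctrace_smulRight]; simp
  have h3 : ctrace (R * R) = a ^ 2 * ⟪ξ, w⟫_ℝ ^ 2 := by
    have : R * R = (a * ⟪ξ, w⟫_ℝ) • R := by
      ext v; simp [hR, smul_smul]; congr 1; ring
    rw [this, map_smul, h2, smul_eq_mul]; ring
  have h4 : ctrace (R * N) = a * ⟪ξ, N w⟫_ℝ := by rw [ctrace_mul_comm, h1]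
  simp only [map_add, map_smul, add_mul, mul_add, smul_mul_assoc, mul_smul_comm, h1, h2, h3, h4,
    smul_eq_mul]
  ring

variable {H : V → ℝ} (hH : IsRegSupport H)
include hH

/-- With `N = hess F ∘ (dbd H)⁻¹`, whose eigenvalues are those of `(D² h)⁻¹ D² f` and `0`:
the identity `V(f, f, h, …, h) = V(f, h, …, h; f)` between mixed volumes. -/
theorem IsRegSupport.integral_sq_ctrace (hd : 3 ≤ finrank ℝ V) {F : V → ℝ}
    (hF : ContDiffOn ℝ 2 F {0}ᶜ) (hF1 : Hom1 F) :
    ∫ s : sphere (0 : V) 1, |(dbd H s).det| *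
        (ctrace (hess F s ∘L Ring.inverse (dbd H s)) ^ 2 -
          ctrace ((hess F s ∘L Ring.inverse (dbd H s)) * (hess F s ∘L Ring.inverse (dbd H s))))
        ∂μ.toSphere =
      ((finrank ℝ V : ℝ) - 2) * ∫ s : sphere (0 : V) 1, |(dbd H s).det| *
        (F s / H s * ctrace (hess F s ∘L Ring.inverse (dbd H s))) ∂μ.toSphere := by
  obtain ⟨χ, hχ, hs, hχ0, hχ2⟩ := exists_radial_cutoff
  obtain ⟨k, hk⟩ : ∃ k, finrank ℝ V = k + 3 := ⟨_, (Nat.sub_add_cancel hd).symm⟩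
  have hw := contDiffOn_gradient isOpen_compl_singleton hF
  have hw0 := hF1.gradient
  have h0 := integral_sq_ctrace_sub (μ := μ) (hH.contDiff_cutoff hχ hs hw)
    (hH.hasCompactSupport_cutoff hs (gradient F))
  set ψ : ℝ → ℝ := fun r => χ r ^ 2 with hψ
  have hψd : ContDiff ℝ 1 ψ := hχ.pow 2
  have hψs : ∀ r, r ∉ Icc (1 : ℝ) 3 → ψ r = 0 := fun r hr => by simp [hψ, hs r hr]
  have hψ' : ∀ r, deriv ψ r = 2 * χ r * deriv χ r := by
    intro r
    rw [hψ, deriv_fun_pow (hχ.differentiable one_ne_zero r)]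
    simp
  set M : V → V →L[ℝ] V := fun x => ‖x‖ • (hess F x ∘L Ring.inverse (dbd H x)) with hM
  have hM0 : Hom0 M := hH.hom0_div hw0
  have hMc : ContinuousOn M {0}ᶜ := continuousOn_id.norm.smul (hH.continuousOn_fderiv_comp hw)
  set g1 : V → ℝ := fun x => ctrace (M x) ^ 2 - ctrace (M x * M x) with hg1
  set g2 : V → ℝ := fun x => F x / H x * ctrace (M x) with hg2
  have hg10 : Hom0 g1 := fun t ht x => by simp only [hg1, hM0 ht]
  have hg20 : Hom0 g2 := by
    intro t ht x
    simp only [hg2, hM0 ht, hH.hom ht, hF1 ht, smul_eq_mul]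
    rw [mul_div_mul_left _ _ ht.ne']
  have hc1 : ContinuousOn g1 {0}ᶜ :=
    ((ctrace.continuous.comp_continuousOn hMc).pow 2).sub
      (ctrace.continuous.comp_continuousOn (hMc.mul hMc))
  have hc2 : ContinuousOn g2 {0}ᶜ :=
    (hF.continuousOn.div hH.smooth.continuousOn fun x hx => (hH.pos x hx).ne').mul
      (ctrace.continuous.comp_continuousOn hMc)
  have hψ1 : ∀ r, r ∉ Icc (1 : ℝ) 3 → r⁻¹ ^ 2 * ψ r = 0 := fun r hr => by rw [hψs r hr, mul_zero]
  have hψ2 : ∀ r, r ∉ Icc (1 : ℝ) 3 → r⁻¹ ^ 1 * deriv ψ r = 0 := fun r hr => by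
    rw [deriv_eq_zero_of_notMem hψs r hr, mul_zero]
  have hsplit : ∫ y, (ctrace (fderiv ℝ (fun y => χ ‖bdInv H y‖ • gradient F (bdInv H y)) y) ^ 2 -
        ctrace (fderiv ℝ (fun y => χ ‖bdInv H y‖ • gradient F (bdInv H y)) y *
          fderiv ℝ (fun y => χ ‖bdInv H y‖ • gradient F (bdInv H y)) y)) ∂μ =
      ∫ y, ((‖bdInv H y‖⁻¹ ^ 2 * ψ ‖bdInv H y‖) * g1 (bdInv H y) +
        (‖bdInv H y‖⁻¹ ^ 1 * deriv ψ ‖bdInv H y‖) * g2 (bdInv H y)) ∂μ := by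
    rw [← restrict_compl_singleton (μ := μ) 0]
    refine setIntegral_congr_fun (measurableSet_singleton (0 : V)).compl fun y hy => ?_
    have hx0 := hH.bdInv_ne_zero hy
    have hx := norm_ne_zero_iff.mpr hx0
    have hE : ⟪bdInv H y, gradient F (bdInv H y)⟫_ℝ = F (bdInv H y) := by
      rw [real_inner_comm, hF1.inner_gradient (differentiableAt_of_contDiffOn two_ne_zero hF hx0)]
    have hK : ∀ v, ⟪bdInv H y, hess F (bdInv H y) v⟫_ℝ = 0 := by
      intro v
      rw [← IsotropicLp.hess_symm (contDiffAt_of_ne hF hx0), IsotropicLp.hess_self hF hF1 hx0, inner_zero_left]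
    have hp := (hH.pos _ hx0).ne'
    simp only [hH.fderiv_cutoff hχ hw hy, ctrace_rank_one, hE, ContinuousLinearMap.comp_apply, hK,
      hg1, hg2, hM, map_smul, smul_mul_assoc, mul_smul_comm, smul_eq_mul, hψ']
    simp only [hψ]
    field_simp
    ring
  rw [h0, integral_add] at hsplit
  rotate_left
  · simpa only [smul_eq_mul] using (hH.continuous_cutoff
      (continuous_inv_pow_mul hψd.continuous hψs 2) hψ1 hc1).integrable_of_hasCompactSupport
      (hH.hasCompactSupport_cutoff hψ1 g1)
  · simpa only [smul_eq_mul] using (hH.continuous_cutoff (continuous_inv_pow_mul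
      (hψd.continuous_deriv le_rfl) (deriv_eq_zero_of_notMem hψs) 1)
      hψ2 hc2).integrable_of_hasCompactSupport (hH.hasCompactSupport_cutoff hψ2 g2)
  rw [hH.integral_comp_bdInv hg10 (fun r => r⁻¹ ^ 2 * ψ r),
    hH.integral_comp_bdInv hg20 (fun r => r⁻¹ ^ 1 * deriv ψ r)] at hsplit
  have e1 : ∫ r in Ioi (0 : ℝ), r ^ (finrank ℝ V - 1) * (r⁻¹ ^ 2 * ψ r) =
      ∫ r in Ioi (0 : ℝ), r ^ k * ψ r := by
    refine setIntegral_congr_fun measurableSet_Ioi fun r hr => ?_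
    have hr0 : r ≠ 0 := ne_of_gt hr
    simp only [hk, show k + 3 - 1 = k + 2 from rfl, pow_add]
    field_simp
  have e2 : ∫ r in Ioi (0 : ℝ), r ^ (finrank ℝ V - 1) * (r⁻¹ ^ 1 * deriv ψ r) =
      ∫ r in Ioi (0 : ℝ), r ^ (k + 1) * deriv ψ r := by
    refine setIntegral_congr_fun measurableSet_Ioi fun r hr => ?_
    have hr0 : r ≠ 0 := ne_of_gt hr
    simp only [hk, show k + 3 - 1 = k + 2 from rfl, pow_add]
    field_simp
  rw [e1, e2, integral_pow_mul_deriv hψd hψs k] at hsplit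
  have e3 : ((finrank ℝ V : ℝ) - 2) = k + 1 := by rw [hk]; push_cast; ring
  have e4 : ∀ s : sphere (0 : V) 1, M s = hess F s ∘L Ring.inverse (dbd H s) := by
    intro s
    simp [hM]
  rw [e3]
  simp only [e4, hg1, hg2] at hsplit
  refine mul_right_cancel₀ (integral_pow_mul_pos hψd.continuous hψs (fun r => sq_nonneg _)
    (pow_pos hχ2 2) k).ne' ?_
  linear_combination -hsplit

end Curl

/-! ### A Poincaré inequality on the sphere -/

section Poincare

variable {V W : Type*} [NormedAddCommGroup V] [InnerProductSpace ℝ V] [FiniteDimensional ℝ V]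
  [Nontrivial V] [MeasurableSpace V] [BorelSpace V] {μ : Measure V} [μ.IsAddHaarMeasure]
  [NormedAddCommGroup W] [NormedSpace ℝ W] [FiniteDimensional ℝ W] [MeasurableSpace W]
  [BorelSpace W]

lemma sq_intervalIntegral_le {f : ℝ → ℝ} (hf : ContinuousOn f (Icc 0 1)) :
    (∫ t in (0 : ℝ)..1, f t) ^ 2 ≤ ∫ t in (0 : ℝ)..1, f t ^ 2 := by
  set m := ∫ t in (0 : ℝ)..1, f t with hm
  have hi1 : IntervalIntegrable f volume 0 1 :=
    ContinuousOn.intervalIntegrable (by rwa [uIcc_of_le zero_le_one])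
  have hi2 : IntervalIntegrable (fun t => f t ^ 2) volume 0 1 :=
    ContinuousOn.intervalIntegrable (by rw [uIcc_of_le zero_le_one]; exact hf.pow 2)
  have h0 : 0 ≤ ∫ t in (0 : ℝ)..1, (f t - m) ^ 2 :=
    intervalIntegral.integral_nonneg zero_le_one fun t _ => sq_nonneg _
  have h1 : ∫ t in (0 : ℝ)..1, (f t - m) ^ 2 =
      ∫ t in (0 : ℝ)..1, (f t ^ 2 - (2 * m) * f t + m ^ 2) := by
    congr 1; ext t; ring
  rw [h1, intervalIntegral.integral_add (hi2.sub (hi1.const_mul _)) (by simp),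
    intervalIntegral.integral_sub hi2 (hi1.const_mul _), intervalIntegral.integral_const_mul,
    ← hm] at h0
  simp at h0
  nlinarith

/-- The increment along a segment that avoids the origin, by the fundamental theorem of calculus
and the Cauchy-Schwarz inequality. -/
lemma norm_sub_sq_le_of_segment {w : V → W} (hw : ContDiffOn ℝ 1 w {0}ᶜ) {x y : V}
    (hxy : ∀ t ∈ Icc (0 : ℝ) 1, (1 - t) • x + t • y ≠ 0) :
    ‖w x - w y‖ ^ 2 ≤
      ‖x - y‖ ^ 2 * ∫ t in (0 : ℝ)..1, ‖fderiv ℝ w ((1 - t) • x + t • y)‖ ^ 2 := by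
  have hγ : ∀ t : ℝ, HasDerivAt (fun t : ℝ => (1 - t) • x + t • y) (y - x) t := by
    intro t
    have h := (((hasDerivAt_id t).const_sub 1).smul_const x).add ((hasDerivAt_id t).smul_const y)
    convert! h using 1
    simp [sub_eq_neg_add]
  have hγc : Continuous fun t : ℝ => (1 - t) • x + t • y := by fun_prop
  have hDc : ContinuousOn (fun t : ℝ => fderiv ℝ w ((1 - t) • x + t • y)) (Icc 0 1) :=
    (continuousOn_fderiv hw).comp hγc.continuousOn fun t ht => hxy t ht
  have hd : ∀ t ∈ uIcc (0 : ℝ) 1, HasDerivAt (fun t : ℝ => w ((1 - t) • x + t • y))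
      (fderiv ℝ w ((1 - t) • x + t • y) (y - x)) t := by
    intro t ht
    rw [uIcc_of_le zero_le_one] at ht
    exact (differentiableAt_of_contDiffOn one_ne_zero hw (hxy t ht)).hasFDerivAt.comp_hasDerivAt t
      (hγ t)
  have hc : ContinuousOn (fun t : ℝ => fderiv ℝ w ((1 - t) • x + t • y) (y - x)) (Icc 0 1) :=
    hDc.clm_apply continuousOn_const
  have hFTC := intervalIntegral.integral_eq_sub_of_hasDerivAt hd
    (ContinuousOn.intervalIntegrable (by rwa [uIcc_of_le zero_le_one]))
  simp only [sub_self, zero_smul, one_smul, zero_add, sub_zero, add_zero] at hFTC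
  have h1 : ‖w x - w y‖ ≤ ∫ t in (0 : ℝ)..1,
      ‖fderiv ℝ w ((1 - t) • x + t • y) (y - x)‖ := by
    rw [norm_sub_rev, ← hFTC]
    exact intervalIntegral.norm_integral_le_integral_norm zero_le_one
  calc ‖w x - w y‖ ^ 2 ≤ (∫ t in (0 : ℝ)..1,
        ‖fderiv ℝ w ((1 - t) • x + t • y) (y - x)‖) ^ 2 := by gcongr
    _ ≤ ∫ t in (0 : ℝ)..1, ‖fderiv ℝ w ((1 - t) • x + t • y) (y - x)‖ ^ 2 :=
      sq_intervalIntegral_le hc.norm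
    _ ≤ ∫ t in (0 : ℝ)..1, ‖x - y‖ ^ 2 * ‖fderiv ℝ w ((1 - t) • x + t • y)‖ ^ 2 := by
      refine intervalIntegral.integral_mono_on zero_le_one
        (ContinuousOn.intervalIntegrable (by rw [uIcc_of_le zero_le_one]; exact hc.norm.pow 2))
        (ContinuousOn.intervalIntegrable (by
          rw [uIcc_of_le zero_le_one]; exact continuousOn_const.mul (hDc.norm.pow 2))) ?_
      intro t _
      rw [← mul_pow, mul_comm, norm_sub_rev]
      gcongr
      exact ContinuousLinearMap.le_opNorm _ _
    _ = _ := intervalIntegral.integral_const_mul _ _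

lemma setLIntegral_ball_comp_le {φ : V → ℝ≥0∞} (hφ : Measurable φ) {x : V}
    (hx : x ∈ ball (0 : V) 1) {t : ℝ} (ht : 1 / 2 ≤ t) (ht1 : t ≤ 1) :
    ∫⁻ y in ball (0 : V) 1, φ ((1 - t) • x + t • y) ∂μ ≤
      2 ^ finrank ℝ V * ∫⁻ y in ball (0 : V) 1, φ y ∂μ := by
  have ht0 : 0 < t := by linarith
  set ψ := (ball (0 : V) 1).indicator φ with hψdef
  have hψ : Measurable ψ := hφ.indicator measurableSet_ball
  calc ∫⁻ y in ball (0 : V) 1, φ ((1 - t) • x + t • y) ∂μ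
      ≤ ∫⁻ y in ball (0 : V) 1, ψ ((1 - t) • x + t • y) ∂μ := by
        refine setLIntegral_mono' measurableSet_ball fun y hy => ?_
        have : (1 - t) • x + t • y ∈ ball (0 : V) 1 :=
          convex_ball (0 : V) 1 hx hy (by linarith) ht0.le (by ring)
        rw [hψdef, indicator_of_mem this]
    _ ≤ ∫⁻ y, ψ ((1 - t) • x + t • y) ∂μ := setLIntegral_le_lintegral _ _
    _ = ∫⁻ z, ψ ((1 - t) • x + z) ∂(Measure.map (fun y => t • y) μ) := by
        rw [lintegral_map (f := fun z => ψ ((1 - t) • x + z)) (hψ.comp (measurable_const_add _))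
          (measurable_const_smul t)]
    _ = ENNReal.ofReal |(t ^ finrank ℝ V)⁻¹| * ∫⁻ z, ψ z ∂μ := by
        rw [Measure.map_addHaar_smul μ ht0.ne', lintegral_smul_measure,
          lintegral_add_left_eq_self ψ, smul_eq_mul]
    _ ≤ _ := by
        rw [hψdef, lintegral_indicator measurableSet_ball]
        gcongr
        rw [abs_of_pos (by positivity), ← inv_pow, ENNReal.ofReal_pow (by positivity)]
        gcongr
        rw [← ENNReal.ofReal_ofNat]
        refine ENNReal.ofReal_le_ofReal ?_
        rw [inv_le_comm₀ ht0 two_pos]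
        linarith

/-- The double integral over pairs of points of the ball of the mean of `φ` over the segment
between them: at the parameter `t`, change variables in the endpoint with the larger weight. -/
lemma lintegral_segment_le {φ : V → ℝ≥0∞} (hφ : Measurable φ) :
    ∫⁻ x in ball (0 : V) 1, ∫⁻ y in ball (0 : V) 1, ∫⁻ t in Ioc (0 : ℝ) 1,
      φ ((1 - t) • x + t • y) ∂volume ∂μ ∂μ ≤
      μ (ball 0 1) * (2 ^ finrank ℝ V * ∫⁻ y in ball (0 : V) 1, φ y ∂μ) := by
  set ν := μ.restrict (ball (0 : V) 1)
  set K := 2 ^ finrank ℝ V * ∫⁻ y, φ y ∂ν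
  have hm3 : Measurable fun p : (V × V) × ℝ => φ ((1 - p.2) • p.1.1 + p.2 • p.1.2) :=
    hφ.comp (by fun_prop)
  have hm1 : ∀ x : V, Measurable fun p : V × ℝ => φ ((1 - p.2) • x + p.2 • p.1) :=
    fun x => hφ.comp (by fun_prop)
  have hm2 : Measurable fun p : V × ℝ => ∫⁻ y, φ ((1 - p.2) • p.1 + p.2 • y) ∂ν := by
    refine Measurable.lintegral_prod_right' (f := fun q : (V × ℝ) × V =>
      φ ((1 - q.1.2) • q.1.1 + q.1.2 • q.2)) (hφ.comp (by fun_prop))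
  have hball : ∀ t ∈ Ioc (0 : ℝ) 1,
      ∫⁻ x, ∫⁻ y, φ ((1 - t) • x + t • y) ∂ν ∂ν ≤ μ (ball 0 1) * K := by
    intro t ht
    have hconst : ∀ f : V → ℝ≥0∞, (∀ x ∈ ball (0 : V) 1, f x ≤ K) →
        ∫⁻ x, f x ∂ν ≤ μ (ball 0 1) * K := by
      intro f hf
      calc ∫⁻ x, f x ∂ν ≤ ∫⁻ x in ball (0 : V) 1, K ∂μ := setLIntegral_mono' measurableSet_ball hf
        _ = _ := by rw [setLIntegral_const, mul_comm]
    rcases le_total (1 / 2) t with h | h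
    · exact hconst _ fun x hx => setLIntegral_ball_comp_le hφ hx h ht.2
    · have hm4 : Measurable (Function.uncurry fun x y : V => φ ((1 - t) • x + t • y)) :=
        hφ.comp (by fun_prop)
      rw [lintegral_lintegral_swap hm4.aemeasurable]
      refine hconst _ fun y hy => ?_
      have := setLIntegral_ball_comp_le (μ := μ) hφ hy (t := 1 - t) (by linarith) (by linarith [ht.1])
      simpa [add_comm] using this
  calc ∫⁻ x, ∫⁻ y, ∫⁻ t in Ioc (0 : ℝ) 1, φ ((1 - t) • x + t • y) ∂volume ∂ν ∂ν
      = ∫⁻ x, ∫⁻ t in Ioc (0 : ℝ) 1, ∫⁻ y, φ ((1 - t) • x + t • y) ∂ν ∂volume ∂ν := by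
        refine lintegral_congr fun x => ?_
        exact lintegral_lintegral_swap (hm1 x).aemeasurable
    _ = ∫⁻ t in Ioc (0 : ℝ) 1, ∫⁻ x, ∫⁻ y, φ ((1 - t) • x + t • y) ∂ν ∂ν ∂volume :=
        lintegral_lintegral_swap hm2.aemeasurable
    _ ≤ ∫⁻ t in Ioc (0 : ℝ) 1, μ (ball 0 1) * K ∂volume :=
        setLIntegral_mono' measurableSet_Ioc hball
    _ = _ := by rw [setLIntegral_const]; simp

/-- Almost all segments between two points of the ball avoid the origin, where `w` may be
discontinuous. -/
lemma lintegral_sub_sq_le (hd : 2 ≤ finrank ℝ V) {w : V → W} (hw : ContDiffOn ℝ 1 w {0}ᶜ) :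
    ∫⁻ x in ball (0 : V) 1, ∫⁻ y in ball (0 : V) 1, ENNReal.ofReal (‖w x - w y‖ ^ 2) ∂μ ∂μ ≤
      4 * (μ (ball 0 1) * (2 ^ finrank ℝ V *
        ∫⁻ y in ball (0 : V) 1, ENNReal.ofReal (‖fderiv ℝ w y‖ ^ 2) ∂μ)) := by
  have hφ : Measurable fun y => ENNReal.ofReal (‖fderiv ℝ w y‖ ^ 2) :=
    (measurable_of_continuousOn_compl_singleton (0 : V)
      ((continuousOn_fderiv hw).norm.pow 2)).ennreal_ofReal
  have hseg : ∀ x ∈ ball (0 : V) 1, ∀ y ∈ ball (0 : V) 1,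
      (∀ t ∈ Icc (0 : ℝ) 1, (1 - t) • x + t • y ≠ 0) →
      ENNReal.ofReal (‖w x - w y‖ ^ 2) ≤ 4 * ∫⁻ t in Ioc (0 : ℝ) 1,
        ENNReal.ofReal (‖fderiv ℝ w ((1 - t) • x + t • y)‖ ^ 2) ∂volume := by
    intro x hx y hy hxy
    have hDc : ContinuousOn (fun t : ℝ => ‖fderiv ℝ w ((1 - t) • x + t • y)‖ ^ 2) (Icc 0 1) :=
      ((continuousOn_fderiv hw).comp (by fun_prop : Continuous fun t : ℝ =>
        (1 - t) • x + t • y).continuousOn fun t ht => hxy t ht).norm.pow 2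
    rw [← ofReal_integral_eq_lintegral_ofReal
      ((hDc.integrableOn_Icc).mono_set Ioc_subset_Icc_self)
      (Filter.Eventually.of_forall fun t => sq_nonneg _),
      ← intervalIntegral.integral_of_le zero_le_one, ← ENNReal.ofReal_ofNat,
      ← ENNReal.ofReal_mul (by norm_num)]
    refine ENNReal.ofReal_le_ofReal ((norm_sub_sq_le_of_segment hw hxy).trans ?_)
    refine mul_le_mul_of_nonneg_right ?_
      (intervalIntegral.integral_nonneg zero_le_one fun t _ => sq_nonneg _)
    rw [mem_ball_zero_iff] at hx hy
    have := norm_sub_le x y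
    nlinarith [norm_nonneg (x - y)]
  have hx0 : ∀ᵐ x ∂μ.restrict (ball (0 : V) 1), x ∈ ball (0 : V) 1 ∧ x ≠ 0 := by
    filter_upwards [ae_restrict_mem measurableSet_ball,
      ae_restrict_of_ae (measure_eq_zero_iff_ae_notMem.mp (measure_singleton (μ := μ) (0 : V)))]
      with x h1 h2 using ⟨h1, h2⟩
  calc ∫⁻ x in ball (0 : V) 1, ∫⁻ y in ball (0 : V) 1, ENNReal.ofReal (‖w x - w y‖ ^ 2) ∂μ ∂μ
      ≤ ∫⁻ x in ball (0 : V) 1, ∫⁻ y in ball (0 : V) 1, 4 * ∫⁻ t in Ioc (0 : ℝ) 1,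
        ENNReal.ofReal (‖fderiv ℝ w ((1 - t) • x + t • y)‖ ^ 2) ∂volume ∂μ ∂μ := by
        refine lintegral_mono_ae ?_
        filter_upwards [hx0] with x hx
        refine lintegral_mono_ae ?_
        have hspan : μ (ℝ ∙ x : Submodule ℝ V) = 0 := by
          refine Measure.addHaar_submodule μ _ fun htop => ?_
          have h1 := finrank_span_singleton (K := ℝ) hx.2
          rw [htop, finrank_top] at h1
          omega
        filter_upwards [ae_restrict_mem measurableSet_ball,
          ae_restrict_of_ae (measure_eq_zero_iff_ae_notMem.mp hspan)] with y hy hys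
        refine hseg x hx.1 y hy fun t ht h0 => hys ?_
        have ht0 : t ≠ 0 := by
          rintro rfl
          simp at h0
          exact hx.2 h0
        have : y = (-(t⁻¹ * (1 - t))) • x := by
          have h2 := congrArg (fun z => t⁻¹ • z) h0
          simp only [smul_add, smul_smul, inv_mul_cancel₀ ht0, one_smul, smul_zero] at h2
          rw [neg_smul]
          exact eq_neg_of_add_eq_zero_right h2
        rw [this]
        exact Submodule.smul_mem _ _ (Submodule.mem_span_singleton_self x)
    _ = 4 * ∫⁻ x in ball (0 : V) 1, ∫⁻ y in ball (0 : V) 1, ∫⁻ t in Ioc (0 : ℝ) 1,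
        ENNReal.ofReal (‖fderiv ℝ w ((1 - t) • x + t • y)‖ ^ 2) ∂volume ∂μ ∂μ := by
        simp only [lintegral_const_mul' _ _ (ENNReal.ofNat_ne_top (n := 4))]
    _ ≤ _ := by gcongr; exact lintegral_segment_le hφ

lemma lintegral_polar {g : V → ℝ≥0∞} (hg : Hom0 g) (hgm : Measurable g) {χ : ℝ → ℝ≥0∞}
    (hχ : Measurable χ) :
    ∫⁻ x, χ ‖x‖ * g x ∂μ =
      (∫⁻ s : sphere (0 : V) 1, g s ∂μ.toSphere) *
        ∫⁻ r : Ioi (0 : ℝ), χ r ∂Measure.volumeIoiPow (finrank ℝ V - 1) := by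
  calc
    ∫⁻ x, χ ‖x‖ * g x ∂μ = ∫⁻ x : ({(0)}ᶜ : Set V), χ ‖x.1‖ * g x.1 ∂(μ.comap (↑)) := by
      rw [lintegral_subtype_comap (measurableSet_singleton _).compl fun x ↦ χ ‖x‖ * g x,
        restrict_compl_singleton]
    _ = ∫⁻ x : sphere (0 : V) 1 × Ioi (0 : ℝ), g x.1 * χ x.2
          ∂μ.toSphere.prod (.volumeIoiPow (finrank ℝ V - 1)) := by
      rw [← μ.measurePreserving_homeomorphUnitSphereProd.lintegral_comp (by fun_prop)]
      refine lintegral_congr fun x => ?_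
      have hx : x.1 ≠ 0 := x.2
      simp only [homeomorphUnitSphereProd_apply_snd_coe, homeomorphUnitSphereProd_apply_fst_coe]
      rw [hg (inv_pos.mpr (norm_pos_iff.mpr hx)), mul_comm]
    _ = _ := lintegral_prod_mul (f := fun s : sphere (0 : V) 1 => g s)
        (g := fun r : Ioi (0 : ℝ) => χ r) (by fun_prop) (by fun_prop)

lemma continuous_sphere_of_continuousOn {X : Type*} [TopologicalSpace X] {f : V → X}
    (hf : ContinuousOn f {0}ᶜ) : Continuous fun s : sphere (0 : V) 1 => f s :=
  hf.comp_continuous continuous_subtype_val fun s => ne_zero_of_mem_unit_sphere s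

lemma integrable_sphere {m : Measure (sphere (0 : V) 1)} [IsFiniteMeasure m] {X : Type*}
    [NormedAddCommGroup X] {f : sphere (0 : V) 1 → X} (hf : Continuous f) : Integrable f m :=
  hf.integrable_of_hasCompactSupport (HasCompactSupport.of_compactSpace f)

variable (μ W) in
/-- A Poincaré inequality for `0`-homogeneous functions. In dimension at least `3` the gradient of
such a function is square integrable near the origin, and the inequality is inherited from the
unit ball. -/
theorem exists_poincare (hd : 3 ≤ finrank ℝ V) : ∃ C : ℝ, 0 ≤ C ∧ ∀ w : V → W,
    ContDiffOn ℝ 1 w {0}ᶜ → Hom0 w → ∃ c : W,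
      ∫ s : sphere (0 : V) 1, ‖w s - c‖ ^ 2 ∂μ.toSphere ≤
        C * ∫ s : sphere (0 : V) 1, ‖fderiv ℝ w s‖ ^ 2 ∂μ.toSphere := by
  set d := finrank ℝ V with hdd
  set χ : ℝ → ℝ≥0∞ := (Iio 1).indicator 1 with hχd
  have hχ : Measurable χ := measurable_one.indicator measurableSet_Iio
  set χ2 : ℝ → ℝ≥0∞ := fun r => χ r * ENNReal.ofReal (r⁻¹ ^ 2) with hχ2d
  have hχ2 : Measurable χ2 := hχ.mul (by fun_prop)
  set a := ∫⁻ r : Ioi (0 : ℝ), χ r ∂Measure.volumeIoiPow (d - 1) with ha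
  set b := ∫⁻ r : Ioi (0 : ℝ), χ2 r ∂Measure.volumeIoiPow (d - 1) with hb
  have ha' : a = ENNReal.ofReal (1 / d) := by
    have h1 : ∀ r : Ioi (0 : ℝ), χ r = (Iio (⟨1, mem_Ioi.mpr one_pos⟩ : Ioi (0 : ℝ))).indicator 1 r := by
      intro r
      simp only [hχd, indicator, mem_Iio, ← Subtype.coe_lt_coe]
      rfl
    rw [ha]
    simp only [h1]
    rw [lintegral_indicator_one measurableSet_Iio, Measure.volumeIoiPow_apply_Iio]
    have : ((d - 1 : ℕ) : ℝ) + 1 = d := by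
      rw [Nat.cast_sub (by omega)]; simp
    rw [this]; simp
  have hb' : b ≤ 1 := by
    rw [hb, Measure.volumeIoiPow, lintegral_withDensity_eq_lintegral_mul _ (by fun_prop)
      (by fun_prop)]
    simp only [Pi.mul_apply]
    rw [lintegral_subtype_comap measurableSet_Ioi
      fun r => ENNReal.ofReal (r ^ (d - 1)) * χ2 r]
    calc ∫⁻ r in Ioi (0 : ℝ), ENNReal.ofReal (r ^ (d - 1)) * χ2 r
        ≤ ∫⁻ r in Ioi (0 : ℝ), (Ioo (0 : ℝ) 1).indicator 1 r := by
          refine setLIntegral_mono' measurableSet_Ioi fun r hr => ?_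
          have hr0 : 0 < r := hr
          by_cases h1 : r < 1
          · rw [indicator_of_mem (show r ∈ Ioo (0 : ℝ) 1 from ⟨hr0, h1⟩)]
            simp only [hχ2d, hχd]
            rw [indicator_of_mem (show r ∈ Iio (1 : ℝ) from h1), Pi.one_apply, one_mul,
              ← ENNReal.ofReal_mul (by positivity)]
            refine ENNReal.ofReal_le_one.mpr ?_
            obtain ⟨k, hk⟩ : ∃ k, d - 1 = k + 2 := ⟨d - 3, by omega⟩
            rw [hk, pow_add, mul_assoc, ← mul_pow, mul_inv_cancel₀ hr0.ne', one_pow, mul_one]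
            exact pow_le_one₀ hr0.le h1.le
          · simp only [hχ2d, hχd]
            rw [indicator_of_notMem (by simpa using h1)]
            simp
      _ ≤ ∫⁻ r, (Ioo (0 : ℝ) 1).indicator 1 r := setLIntegral_le_lintegral _ _
      _ = 1 := by rw [lintegral_indicator_one measurableSet_Ioo]; simp
  have hd0 : (0 : ℝ) < d := by
    have : 0 < d := by omega
    exact_mod_cast this
  refine ⟨d * (4 * 2 ^ d), by positivity, fun w hw hw0 => ?_⟩
  have hwm : Measurable w := measurable_of_continuousOn_compl_singleton (0 : V) hw.continuousOn
  have hball0 : μ (ball (0 : V) 1) ≠ 0 := (measure_ball_pos μ (0 : V) one_pos).ne'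
  have hballt : μ (ball (0 : V) 1) ≠ ∞ := measure_ball_lt_top.ne
  obtain ⟨x₀, -, hx₀⟩ := exists_le_setLAverage (μ := μ) (s := ball (0 : V) 1)
    (f := fun x => ∫⁻ y in ball (0 : V) 1, ENNReal.ofReal (‖w x - w y‖ ^ 2) ∂μ) hball0 hballt
    (by
      refine (Measurable.lintegral_prod_right' (f := fun p : V × V =>
        ENNReal.ofReal (‖w p.1 - w p.2‖ ^ 2)) ?_).aemeasurable
      exact ((((hwm.comp measurable_fst).sub (hwm.comp measurable_snd)).norm).pow_const
        2).ennreal_ofReal)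
  refine ⟨w x₀, ?_⟩
  set P := ∫⁻ y in ball (0 : V) 1, ENNReal.ofReal (‖fderiv ℝ w y‖ ^ 2) ∂μ with hP
  have hcut : ∀ g : V → ℝ≥0∞, ∫⁻ y in ball (0 : V) 1, g y ∂μ = ∫⁻ y, χ ‖y‖ * g y ∂μ := by
    intro g
    rw [← lintegral_indicator measurableSet_ball]
    refine lintegral_congr fun y => ?_
    by_cases hy : y ∈ ball (0 : V) 1
    · rw [indicator_of_mem hy, hχd, indicator_of_mem (by simpa using hy)]; simp
    · rw [indicator_of_notMem hy, hχd, indicator_of_notMem (by simpa using hy)]; simp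
  have h1 : ∫⁻ y in ball (0 : V) 1, ENNReal.ofReal (‖w x₀ - w y‖ ^ 2) ∂μ ≤ 4 * (2 ^ d * P) := by
    refine hx₀.trans ?_
    rw [setLAverage_eq]
    refine ENNReal.div_le_of_le_mul ?_
    refine (lintegral_sub_sq_le (by omega) hw).trans_eq ?_
    ring
  have hPb : P = (∫⁻ s : sphere (0 : V) 1, ENNReal.ofReal (‖fderiv ℝ w s‖ ^ 2) ∂μ.toSphere) * b := by
    rw [hP, hcut]
    have e : ∀ y : V, χ ‖y‖ * ENNReal.ofReal (‖fderiv ℝ w y‖ ^ 2) =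
        χ2 ‖y‖ * ENNReal.ofReal ((‖y‖ * ‖fderiv ℝ w y‖) ^ 2) ∨ y = 0 := by
      intro y
      rcases eq_or_ne y 0 with h | h
      · exact Or.inr h
      · left
        simp only [hχ2d]
        rw [mul_assoc, ← ENNReal.ofReal_mul (by positivity)]
        have := norm_ne_zero_iff.mpr h
        congr 2
        field_simp
    have e2 : ∫⁻ y, χ ‖y‖ * ENNReal.ofReal (‖fderiv ℝ w y‖ ^ 2) ∂μ =
        ∫⁻ y, χ2 ‖y‖ * ENNReal.ofReal ((‖y‖ * ‖fderiv ℝ w y‖) ^ 2) ∂μ := by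
      refine lintegral_congr_ae ?_
      filter_upwards [measure_eq_zero_iff_ae_notMem.mp (measure_singleton (μ := μ) (0 : V))]
        with y hy using (e y).resolve_right hy
    rw [e2, lintegral_polar (g := fun y => ENNReal.ofReal ((‖y‖ * ‖fderiv ℝ w y‖) ^ 2)) _ _ hχ2]
    · congr 1
      refine lintegral_congr fun s => ?_
      simp
    · intro t ht x
      simp only [hw0.fderiv_smul ht, norm_smul, norm_inv, Real.norm_of_nonneg ht.le]
      congr 2
      field_simp
    · exact (measurable_of_continuousOn_compl_singleton (0 : V)
        ((continuousOn_id.norm.mul (continuousOn_fderiv hw).norm).pow 2)).ennreal_ofReal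
  rw [hcut, lintegral_polar (g := fun y => ENNReal.ofReal (‖w x₀ - w y‖ ^ 2)) _ _ hχ, ← ha, ha',
    hPb] at h1
  rotate_left
  · intro t ht x
    simp only [hw0 ht]
  · exact (((measurable_const.sub hwm).norm).pow_const 2).ennreal_ofReal
  have hi1 : Continuous fun s : sphere (0 : V) 1 => ‖w x₀ - w s‖ ^ 2 :=
    continuous_sphere_of_continuousOn ((continuousOn_const.sub hw.continuousOn).norm.pow 2)
  have hi2 : Continuous fun s : sphere (0 : V) 1 => ‖fderiv ℝ w s‖ ^ 2 :=
    continuous_sphere_of_continuousOn ((continuousOn_fderiv hw).norm.pow 2)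
  rw [← ofReal_integral_eq_lintegral_ofReal (integrable_sphere hi1)
    (Filter.Eventually.of_forall fun s => sq_nonneg _),
    ← ofReal_integral_eq_lintegral_ofReal (integrable_sphere hi2)
    (Filter.Eventually.of_forall fun s => sq_nonneg _)] at h1
  set I := ∫ s : sphere (0 : V) 1, ‖fderiv ℝ w s‖ ^ 2 ∂μ.toSphere with hI
  have hI0 : 0 ≤ I := integral_nonneg fun s => sq_nonneg _
  set J := ∫ s : sphere (0 : V) 1, ‖w x₀ - w s‖ ^ 2 ∂μ.toSphere with hJ
  have hJ0 : 0 ≤ J := integral_nonneg fun s => sq_nonneg _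
  have h2 : ENNReal.ofReal (J * (1 / d)) ≤ ENNReal.ofReal (4 * (2 ^ d * I)) := by
    rw [ENNReal.ofReal_mul hJ0, ENNReal.ofReal_mul (by norm_num), ENNReal.ofReal_mul (by positivity),
      ENNReal.ofReal_pow (by norm_num), ENNReal.ofReal_ofNat, ENNReal.ofReal_ofNat]
    refine h1.trans ?_
    gcongr
    exact mul_le_of_le_one_right' hb'
  rw [ENNReal.ofReal_le_ofReal_iff (by positivity)] at h2
  have h3 : J ≤ d * (4 * 2 ^ d) * I := by
    rw [mul_one_div, div_le_iff₀ hd0] at h2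
    linarith
  simp only [norm_sub_rev _ (w x₀)]
  exact h3

end Poincare

/-! ### Spectral theory of closed symmetric relations in a real Hilbert space -/

section Spectral

open Polynomial

variable {𝓗 : Type*} [NormedAddCommGroup 𝓗] [InnerProductSpace ℝ 𝓗] [CompleteSpace 𝓗]

/-- Lower bound for a symmetric operator: if no negative number is in the spectrum, the quadratic
form is nonnegative. -/
lemma inner_nonneg_of_isUnit {A : 𝓗 →L[ℝ] 𝓗} (hA : ∀ u v, ⟪A u, v⟫_ℝ = ⟪u, A v⟫_ℝ)
    (hU : ∀ m : ℝ, m < 0 → IsUnit (A - algebraMap ℝ (𝓗 →L[ℝ] 𝓗) m)) (v : 𝓗) : 0 ≤ ⟪A v, v⟫_ℝ := by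
  by_contra hneg
  push Not at hneg
  have hv : v ≠ 0 := by rintro rfl; simp at hneg
  set S : Set ℝ := {a | ∀ u, a * ‖u‖ ^ 2 ≤ ⟪A u, u⟫_ℝ} with hS
  have hne : (-‖A‖) ∈ S := by
    intro u
    have h1 := abs_le.mp (abs_real_inner_le_norm (A u) u)
    have h2 := mul_le_mul_of_nonneg_right (A.le_opNorm u) (norm_nonneg u)
    nlinarith
  have hv2 : 0 < ‖v‖ ^ 2 := by positivity
  have hub : ∀ a ∈ S, a ≤ ⟪A v, v⟫_ℝ / ‖v‖ ^ 2 := fun a ha => by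
    rw [le_div_iff₀ hv2]; exact ha v
  set m := sSup S with hm
  have hbdd : BddAbove S := ⟨_, hub⟩
  have hm0 : m < 0 := (csSup_le ⟨_, hne⟩ hub).trans_lt (div_neg_of_neg_of_pos hneg hv2)
  have hmS : m ∈ S := by
    intro u
    rcases eq_or_ne u 0 with rfl | hu
    · simp
    · have hu2 : 0 < ‖u‖ ^ 2 := by positivity
      rw [← le_div_iff₀ hu2]
      exact csSup_le ⟨_, hne⟩ fun a ha => by rw [le_div_iff₀ hu2]; exact ha u
  obtain ⟨U, hUe⟩ := hU m hm0
  set B := A - algebraMap ℝ (𝓗 →L[ℝ] 𝓗) m with hB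
  have hBa : ∀ u, B u = A u - m • u := fun u => by simp [hB, Algebra.algebraMap_eq_smul_one]
  have hBsym : ∀ u w, ⟪B u, w⟫_ℝ = ⟪u, B w⟫_ℝ := by
    intro u w
    rw [hBa, hBa, inner_sub_left, inner_sub_right, hA, inner_smul_left, inner_smul_right]
    simp
  have hBpos : ∀ u, 0 ≤ ⟪B u, u⟫_ℝ := by
    intro u
    rw [hBa, inner_sub_left, inner_smul_left, real_inner_self_eq_norm_sq]
    have := hmS u
    simp only [RCLike.conj_to_real]
    linarith
  set b := ‖B‖ + 1 with hb
  have hb0 : 0 < b := by positivity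
  have hBB : ∀ u, ‖B u‖ ^ 2 ≤ b * ⟪B u, u⟫_ℝ := by
    intro u
    have h1 := hBpos (u - b⁻¹ • B u)
    rw [map_sub, map_smul, inner_sub_left, inner_sub_right, inner_sub_right, inner_smul_left,
      inner_smul_right, inner_smul_left, inner_smul_right, hBsym (B u) u,
      real_inner_self_eq_norm_sq] at h1
    simp only [RCLike.conj_to_real] at h1
    have h2 : ⟪B (B u), B u⟫_ℝ ≤ b * ‖B u‖ ^ 2 := by
      refine (real_inner_le_norm _ _).trans ?_
      have := mul_le_mul_of_nonneg_right (B.le_opNorm (B u)) (norm_nonneg (B u))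
      nlinarith [sq_nonneg ‖B u‖]
    have h3 : b⁻¹ * (b⁻¹ * ⟪B (B u), B u⟫_ℝ) ≤ b⁻¹ * ‖B u‖ ^ 2 := by
      gcongr
      rw [inv_mul_le_iff₀ hb0]
      exact h2
    have h4 : b⁻¹ * ‖B u‖ ^ 2 ≤ ⟪B u, u⟫_ℝ := by linarith
    rwa [inv_mul_le_iff₀ hb0] at h4
  -- `B` is bounded below, since it is invertible
  set c := ‖(↑U⁻¹ : 𝓗 →L[ℝ] 𝓗)‖ + 1 with hc
  have hc0 : 0 < c := by positivity
  have hlow : ∀ u, ‖u‖ ≤ c * ‖B u‖ := by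
    intro u
    have h1 : (↑U⁻¹ : 𝓗 →L[ℝ] 𝓗) (B u) = u := by
      rw [← hUe]
      exact congrArg (fun L : 𝓗 →L[ℝ] 𝓗 => L u) U.inv_mul
    calc ‖u‖ = ‖(↑U⁻¹ : 𝓗 →L[ℝ] 𝓗) (B u)‖ := by rw [h1]
      _ ≤ ‖(↑U⁻¹ : 𝓗 →L[ℝ] 𝓗)‖ * ‖B u‖ := ContinuousLinearMap.le_opNorm _ _
      _ ≤ c * ‖B u‖ := by gcongr; linarith
  have hmem : m + (b * c ^ 2)⁻¹ ∈ S := by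
    intro u
    have h1 : ‖u‖ ^ 2 ≤ (b * c ^ 2) * ⟪B u, u⟫_ℝ := by
      calc ‖u‖ ^ 2 ≤ (c * ‖B u‖) ^ 2 := by gcongr; exact hlow u
        _ = c ^ 2 * ‖B u‖ ^ 2 := by ring
        _ ≤ c ^ 2 * (b * ⟪B u, u⟫_ℝ) := by gcongr; exact hBB u
        _ = _ := by ring
    rw [← inv_mul_le_iff₀ (by positivity)] at h1
    have h2 : ⟪B u, u⟫_ℝ = ⟪A u, u⟫_ℝ - m * ‖u‖ ^ 2 := by
      rw [hBa, inner_sub_left, inner_smul_left, real_inner_self_eq_norm_sq]; simp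
    rw [add_mul]
    linarith
  have := le_csSup hbdd hmem
  have h0 : 0 < (b * c ^ 2)⁻¹ := by positivity
  linarith

lemma aeval_symm {A : 𝓗 →L[ℝ] 𝓗} (hA : ∀ u v, ⟪A u, v⟫_ℝ = ⟪u, A v⟫_ℝ) (q : ℝ[X]) (u v : 𝓗) :
    ⟪aeval A q u, v⟫_ℝ = ⟪u, aeval A q v⟫_ℝ := by
  induction q using Polynomial.induction_on' generalizing u v with
  | add p q hp hq => simp only [map_add, FunLike.coe_add, Pi.add_apply, inner_add_left, inner_add_right, hp, hq]
  | monomial n a =>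
    rw [aeval_monomial, Algebra.algebraMap_eq_smul_one, smul_mul_assoc, one_mul]
    simp only [FunLike.coe_smul, Pi.smul_apply, inner_smul_left, inner_smul_right,
      RCLike.conj_to_real]
    congr 1
    induction n generalizing u v with
    | zero => simp
    | succ n ih =>
      have e : ∀ w, (A ^ (n + 1)) w = (A ^ n) (A w) := fun w => by rw [pow_succ]; rfl
      have e' : ∀ w, (A ^ (n + 1)) w = A ((A ^ n) w) := fun w => by rw [pow_succ']; rfl
      rw [e, ih, hA, e']

/-- A polynomial without real zeros in the spectrum of a symmetric operator takes it to an
invertible operator. -/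
lemma isUnit_aeval {A : 𝓗 →L[ℝ] 𝓗} (hA : ∀ u v, ⟪A u, v⟫_ℝ = ⟪u, A v⟫_ℝ) (q : ℝ[X]) (hq0 : q ≠ 0)
    (hq : ∀ r : ℝ, q.IsRoot r → IsUnit (A - algebraMap ℝ (𝓗 →L[ℝ] 𝓗) r)) : IsUnit (aeval A q) := by
  induction q using WfDvdMonoid.induction_on_irreducible with
  | zero => exact absurd rfl hq0
  | unit u hu => exact hu.map (aeval A)
  | mul a i ha hi ih =>
    rw [map_mul]
    refine IsUnit.mul ?_ (ih ha fun r hr => hq r (by rw [IsRoot, eval_mul, hr.eq_zero, mul_zero]))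
    by_cases hroot : ∃ r, i.IsRoot r
    · obtain ⟨r, hr⟩ := hroot
      obtain ⟨k, hk⟩ := dvd_iff_isRoot.mpr hr
      have hku : IsUnit k := (hi.isUnit_or_isUnit hk).resolve_left (not_isUnit_X_sub_C r)
      rw [hk, map_mul]
      refine IsUnit.mul ?_ (hku.map (aeval A))
      rw [map_sub, aeval_X, aeval_C]
      exact hq r (by rw [IsRoot, eval_mul, hr.eq_zero, zero_mul])
    · push Not at hroot
      have hquad := eq_quadratic_of_degree_le_two hi.degree_le_two
      set α := i.coeff 2
      set β := i.coeff 1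
      set γ := i.coeff 0
      have heval : ∀ x, i.eval x = α * (x * x) + β * x + γ := by
        intro x
        rw [hquad]
        simp only [eval_add, eval_mul, eval_C, eval_pow, eval_X]
        ring
      have hα : α ≠ 0 := by
        intro h0
        by_cases hβ : β = 0
        · refine hi.not_isUnit ?_
          rw [hquad, h0, hβ]
          simp only [map_zero, zero_mul, zero_add]
          refine isUnit_C.mpr (isUnit_iff_ne_zero.mpr fun h => hi.ne_zero ?_)
          rw [hquad, h0, hβ, h]; simp
        · refine hroot (-γ / β) ?_
          rw [IsRoot, heval, h0]
          field_simp
          ring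
      have hdisc : discrim α β γ < 0 := by
        by_contra hd
        push Not at hd
        obtain ⟨x, hx⟩ := exists_quadratic_eq_zero hα
          ⟨Real.sqrt (discrim α β γ), (Real.mul_self_sqrt hd).symm⟩
        exact hroot x (by rw [IsRoot, heval]; exact hx)
      set δ := -discrim α β γ / (4 * α ^ 2) with hδd
      have hδ : 0 < δ := div_pos (neg_pos.mpr hdisc) (by positivity)
      set κ := β / (2 * α) with hκ
      set B := A + algebraMap ℝ (𝓗 →L[ℝ] 𝓗) κ with hB
      have hBa : ∀ u, B u = A u + κ • u := fun u => by simp [hB, Algebra.algebraMap_eq_smul_one]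
      have hBsym : ∀ u w, ⟪B u, w⟫_ℝ = ⟪u, B w⟫_ℝ := by
        intro u w
        rw [hBa, hBa, inner_add_left, inner_add_right, hA, inner_smul_left, inner_smul_right]
        simp
      have hfac : i = C α * ((X + C κ) ^ 2 + C δ) := by
        refine Polynomial.funext fun x => ?_
        rw [heval]
        simp only [eval_mul, eval_C, eval_add, eval_pow, eval_X, hδd, hκ, discrim]
        field_simp
        ring
      have hu2 : IsUnit (B ^ 2 + algebraMap ℝ (𝓗 →L[ℝ] 𝓗) δ) := by
        refine ContinuousLinearMap.isUnit_of_forall_le_norm_inner_map (𝕜 := ℝ) _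
          (c := ⟨δ, hδ.le⟩) hδ fun x => ?_
        have e : ⟪(B ^ 2 + algebraMap ℝ (𝓗 →L[ℝ] 𝓗) δ) x, x⟫_ℝ = ‖B x‖ ^ 2 + δ * ‖x‖ ^ 2 := by
          have : (B ^ 2 + algebraMap ℝ (𝓗 →L[ℝ] 𝓗) δ) x = B (B x) + δ • x := by
            simp [sq, Algebra.algebraMap_eq_smul_one]
          rw [this, inner_add_left, hBsym, inner_smul_left, real_inner_self_eq_norm_sq,
            real_inner_self_eq_norm_sq]
          simp
        rw [e, Real.norm_of_nonneg (by positivity)]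
        change ‖x‖ ^ 2 * δ ≤ _
        nlinarith [sq_nonneg ‖B x‖]
      rw [hfac, map_mul, map_add, map_pow, map_add, aeval_X, aeval_C, aeval_C, aeval_C]
      exact ((isUnit_iff_ne_zero.mpr hα).map (algebraMap ℝ (𝓗 →L[ℝ] 𝓗))).mul hu2

/-- A nonconstant polynomial that is nonnegative on the spectrum of a symmetric operator takes it to a
nonnegative operator. -/
lemma inner_aeval_nonneg {A : 𝓗 →L[ℝ] 𝓗} (hA : ∀ u v, ⟪A u, v⟫_ℝ = ⟪u, A v⟫_ℝ) (f : ℝ[X])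
    (hconst : ∀ a, f ≠ C a) (hf : ∀ r : ℝ, ¬ IsUnit (A - algebraMap ℝ (𝓗 →L[ℝ] 𝓗) r) → 0 ≤ f.eval r) (v : 𝓗) :
    0 ≤ ⟪aeval A f v, v⟫_ℝ := by
  refine inner_nonneg_of_isUnit (aeval_symm hA f) (fun m hm => ?_) v
  have e : aeval A f - algebraMap ℝ (𝓗 →L[ℝ] 𝓗) m = aeval A (f - C m) := by
    rw [map_sub, aeval_C]
  rw [e]
  refine isUnit_aeval hA _ (fun h => hconst m (sub_eq_zero.mp h)) fun r hr => ?_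
  by_contra hcon
  have h1 := hf r hcon
  rw [IsRoot, eval_sub, eval_C, sub_eq_zero] at hr
  linarith

/-- The spectrum of the (graph of the) operator `Γ`: the complement of the set of `t` for which
`T - t` is a bijection from the domain onto the whole space, `T` being the operator with graph
`Γ`. -/
def relSpectrum (Γ : Set (𝓗 × 𝓗)) : Set ℝ :=
  {t | ¬ ∀ w : 𝓗, ∃! q : 𝓗 × 𝓗, q ∈ Γ ∧ q.2 - t • q.1 = w}

/-- `Γ` is the graph of a closed symmetric nonnegative operator. -/
structure IsClosedSymm (Γ : Submodule ℝ (𝓗 × 𝓗)) : Prop where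
  closed : IsClosed (Γ : Set (𝓗 × 𝓗))
  symm : ∀ q ∈ Γ, ∀ r ∈ Γ, ⟪q.2, r.1⟫_ℝ = ⟪q.1, r.2⟫_ℝ
  nonneg : ∀ q ∈ Γ, 0 ≤ ⟪q.2, q.1⟫_ℝ

namespace IsClosedSymm

variable {Γ : Submodule ℝ (𝓗 × 𝓗)} (hΓ : IsClosedSymm Γ)
include hΓ

/-- A symmetric operator with a real resolvent point is self-adjoint. -/
lemma mem_of_weak {t : ℝ} (ht : t ∉ relSpectrum (Γ : Set (𝓗 × 𝓗))) {u v : 𝓗}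
    (h : ∀ q ∈ Γ, ⟪u, q.2⟫_ℝ = ⟪v, q.1⟫_ℝ) : (u, v) ∈ Γ := by
  simp only [relSpectrum, Set.mem_ofPred_eq, not_not] at ht
  obtain ⟨q, ⟨hq, hqe⟩, -⟩ := ht (v - t • u)
  obtain ⟨r, ⟨hr, hre⟩, -⟩ := ht (u - q.1)
  have h1 := h r hr
  have h2 := hΓ.symm q hq r hr
  have h3 : ⟪u - q.1, u - q.1⟫_ℝ = 0 := by
    have h4 : ⟪q.2 - t • q.1, r.1⟫_ℝ = ⟪v - t • u, r.1⟫_ℝ := by rw [hqe]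
    have h5 : ⟪u - q.1, r.2 - t • r.1⟫_ℝ = ⟪u - q.1, u - q.1⟫_ℝ := by rw [hre]
    rw [← h5]
    simp only [inner_sub_left, inner_sub_right, inner_smul_left, inner_smul_right,
      RCLike.conj_to_real] at h4 ⊢
    linear_combination h1 + h2 - h4
  have h5 : u = q.1 := sub_eq_zero.mp (inner_self_eq_zero.mp h3)
  have h6 : v = q.2 := by
    rw [← h5] at hqe
    exact (sub_left_injective hqe).symm
  rw [h5, h6]
  exact hq

/-- Negative numbers are resolvent points of a nonnegative self-adjoint operator. -/
lemma notMem_of_neg {t₀ : ℝ} (ht₀ : t₀ ∉ relSpectrum (Γ : Set (𝓗 × 𝓗))) {t : ℝ} (ht : t < 0) :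
    t ∉ relSpectrum (Γ : Set (𝓗 × 𝓗)) := by
  have : CompleteSpace Γ := hΓ.closed.completeSpace_coe
  set L : Γ →L[ℝ] 𝓗 :=
    (ContinuousLinearMap.snd ℝ 𝓗 𝓗 - t • ContinuousLinearMap.fst ℝ 𝓗 𝓗) ∘L Γ.subtypeL with hL
  have hLa : ∀ q : Γ, L q = q.1.2 - t • q.1.1 := fun q => by simp [hL]
  have hb1 : ∀ q : Γ, ‖q.1.1‖ ≤ (-t)⁻¹ * ‖L q‖ := by
    intro q
    rw [inv_mul_eq_div, le_div_iff₀ (neg_pos.mpr ht)]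
    rcases eq_or_ne q.1.1 0 with h | h
    · rw [h]; simp
    · have h1 := hΓ.nonneg q.1 q.2
      have h2 : ⟪L q, q.1.1⟫_ℝ ≤ ‖L q‖ * ‖q.1.1‖ := real_inner_le_norm _ _
      rw [hLa q, inner_sub_left, inner_smul_left, real_inner_self_eq_norm_sq, ← hLa q] at h2
      simp only [RCLike.conj_to_real] at h2
      have h3 := norm_pos_iff.mpr h
      refine le_of_mul_le_mul_right ?_ h3
      nlinarith
  have hanti : ∀ q : Γ, ‖q‖ ≤ (2 + (-t)⁻¹) * ‖L q‖ := by
    intro q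
    have h0 := norm_nonneg (L q)
    have hinv : 0 < (-t)⁻¹ := inv_pos.mpr (neg_pos.mpr ht)
    have h1 := hb1 q
    have h2 : ‖q.1.2‖ ≤ 2 * ‖L q‖ := by
      have e : q.1.2 = L q + t • q.1.1 := by rw [hLa]; abel
      rw [e]
      refine (norm_add_le _ _).trans ?_
      rw [norm_smul, Real.norm_of_nonpos ht.le]
      have := mul_le_mul_of_nonneg_left h1 (neg_pos.mpr ht).le
      rw [← mul_assoc, mul_inv_cancel₀ (neg_pos.mpr ht).ne', one_mul] at this
      linarith
    change ‖q.1‖ ≤ _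
    rw [Prod.norm_def]
    refine max_le ?_ ?_ <;> nlinarith
  have hinj : Function.Injective L := by
    rw [injective_iff_map_eq_zero]
    intro q hq
    have := hanti q
    rw [hq, norm_zero, mul_zero] at this
    exact norm_le_zero_iff.mp this
  have hclosed : IsClosed (L.range : Set 𝓗) := by
    have hlip : AntilipschitzWith ⟨2 + (-t)⁻¹, by
        have := inv_pos.mpr (neg_pos.mpr ht); positivity⟩ L :=
      L.antilipschitz_of_bound hanti
    exact hlip.isClosed_range L.uniformContinuous
  have htop : L.range = ⊤ := by
    have : CompleteSpace L.range := hclosed.completeSpace_coe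
    rw [← Submodule.orthogonal_eq_bot_iff, Submodule.eq_bot_iff]
    intro w hw
    have hmem : (w, t • w) ∈ Γ := by
      refine hΓ.mem_of_weak ht₀ fun q hq => ?_
      have h1 := (Submodule.mem_orthogonal' _ _).mp hw (L ⟨q, hq⟩) ⟨_, rfl⟩
      rw [hLa, inner_sub_right, inner_smul_right] at h1
      rw [inner_smul_left]
      simp only [RCLike.conj_to_real]
      linarith
    have h2 := hΓ.nonneg _ hmem
    simp only [inner_smul_left, RCLike.conj_to_real, real_inner_self_eq_norm_sq] at h2
    rw [← norm_eq_zero]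
    by_contra hne
    have : 0 < ‖w‖ ^ 2 := by positivity
    nlinarith
  simp only [relSpectrum, Set.mem_ofPred_eq, not_not]
  intro w
  obtain ⟨q, hq⟩ := (htop ▸ Submodule.mem_top : w ∈ L.range)
  refine ⟨q.1, ⟨q.2, ?_⟩, ?_⟩
  · rw [← hLa]; exact hq
  · rintro r ⟨hr, hre⟩
    have : L ⟨r, hr⟩ = L q := by
      rw [hLa]; exact hre.trans hq.symm
    exact congrArg Subtype.val (hinj this)

/-- The spectral gap inequality. With `R = (T - 1/2)⁻¹`, the polynomial
`(r² - 4)² (r - (Λ - 1/2) r²)` is nonnegative on the spectrum of `R`; its double zeros `r = -2` and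
`r = 2` correspond to the points `0` and `1` of the spectrum of `T`. -/
theorem le_inner_of_orthogonal {Λ : ℝ} (hΛ : 1 < Λ)
    (hgap : ∀ t ∈ relSpectrum (Γ : Set (𝓗 × 𝓗)), t < Λ → t = 0 ∨ t = 1) {u v : 𝓗}
    (huv : (u, v) ∈ Γ) (h0 : ∀ e, (e, (0 : 𝓗)) ∈ Γ → ⟪u, e⟫_ℝ = 0)
    (h1 : ∀ e, (e, e) ∈ Γ → ⟪u, e⟫_ℝ = 0) : Λ * ‖u‖ ^ 2 ≤ ⟪v, u⟫_ℝ := by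
  have hhalf : (1 / 2 : ℝ) ∉ relSpectrum (Γ : Set (𝓗 × 𝓗)) := by
    intro h
    rcases hgap _ h (by linarith) with h | h <;> norm_num at h
  have hres : ∀ t ∉ relSpectrum (Γ : Set (𝓗 × 𝓗)), ∀ w : 𝓗, ∃! q : 𝓗 × 𝓗,
      q ∈ (Γ : Set (𝓗 × 𝓗)) ∧ q.2 - t • q.1 = w := by
    intro t ht
    simpa only [relSpectrum, Set.mem_ofPred_eq, not_not] using ht
  choose Q hQ hQu using hres _ hhalf
  have hQm : ∀ w, Q w ∈ Γ := fun w => (hQ w).1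
  have hQe : ∀ w, (Q w).2 - (1 / 2 : ℝ) • (Q w).1 = w := fun w => (hQ w).2
  have huniq : ∀ w q, q ∈ Γ → q.2 - (1 / 2 : ℝ) • q.1 = w → q = Q w := fun w q hq hqe =>
    hQu w q ⟨hq, hqe⟩
  let R₀ : 𝓗 →ₗ[ℝ] 𝓗 :=
    { toFun := fun w => (Q w).1
      map_add' := fun a b => by
        rw [← huniq (a + b) (Q a + Q b) (Γ.add_mem (hQm a) (hQm b))]
        · rfl
        · conv_rhs => rw [← hQe a, ← hQe b]
          simp only [Prod.fst_add, Prod.snd_add, smul_add]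
          abel
      map_smul' := fun c a => by
        rw [← huniq (c • a) (c • Q a) (Γ.smul_mem c (hQm a))]
        · rfl
        · conv_rhs => rw [← hQe a]
          simp only [Prod.smul_fst, Prod.smul_snd, smul_sub, smul_comm c] }
  have hR₀sym : R₀.IsSymmetric := by
    intro a b
    have h := hΓ.symm _ (hQm a) _ (hQm b)
    change ⟪(Q a).1, b⟫_ℝ = ⟪a, (Q b).1⟫_ℝ
    conv_lhs => rw [← hQe b]
    conv_rhs => rw [← hQe a]
    simp only [inner_sub_left, inner_sub_right, inner_smul_left, inner_smul_right,
      RCLike.conj_to_real]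
    linarith
  let R : 𝓗 →L[ℝ] 𝓗 := ⟨R₀, hR₀sym.continuous⟩
  have hR : ∀ a b, ⟪R a, b⟫_ℝ = ⟪a, R b⟫_ℝ := hR₀sym
  have hRQ : ∀ w, R w = (Q w).1 := fun _ => rfl
  have hRmem : ∀ w, (R w, w + (1 / 2 : ℝ) • R w) ∈ Γ := by
    intro w
    have : (R w, w + (1 / 2 : ℝ) • R w) = Q w := by
      refine Prod.ext rfl ?_
      simp only [hRQ]
      conv_lhs => enter [1]; rw [← hQe w]
      abel
    rw [this]; exact hQm w
  have hRof : ∀ q ∈ Γ, R (q.2 - (1 / 2 : ℝ) • q.1) = q.1 := by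
    intro q hq
    rw [hRQ, ← huniq _ q hq rfl]
  -- the spectral mapping for the resolvent
  have hspec : ∀ r : ℝ, r ≠ 0 → (1 / 2 + r⁻¹) ∉ relSpectrum (Γ : Set (𝓗 × 𝓗)) →
      IsUnit (R - algebraMap ℝ (𝓗 →L[ℝ] 𝓗) r) := by
    intro r hr ht
    have hRr : ∀ w, (R - algebraMap ℝ (𝓗 →L[ℝ] 𝓗) r) w = R w - r • w := fun w => by
      simp [Algebra.algebraMap_eq_smul_one]
    rw [ContinuousLinearMap.isUnit_iff_bijective]
    constructor
    · rw [injective_iff_map_eq_zero]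
      intro w hw
      rw [hRr, sub_eq_zero] at hw
      obtain ⟨q, -, hqu⟩ := hres _ ht 0
      have e1 := hqu (R w, w + (1 / 2 : ℝ) • R w) ⟨hRmem w, by
        simp only [hw, smul_smul, add_mul, inv_mul_cancel₀ hr, add_smul, one_smul]
        abel⟩
      have e2 := hqu 0 ⟨Γ.zero_mem, by simp⟩
      have e3 : R w = 0 := congrArg Prod.fst (e1.trans e2.symm)
      rw [e3] at hw
      exact (smul_eq_zero.mp hw.symm).resolve_left hr
    · intro w
      obtain ⟨q, ⟨hq, hqe⟩, -⟩ := hres _ ht ((-r⁻¹) • w)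
      refine ⟨q.2 - (1 / 2 : ℝ) • q.1, ?_⟩
      rw [hRr, hRof q hq]
      have : w = (-r) • (q.2 - (1 / 2 + r⁻¹) • q.1) := by
        rw [hqe, smul_smul, neg_mul_neg, mul_inv_cancel₀ hr, one_smul]
      rw [this]
      match_scalars <;> field_simp <;> ring
  set s := Λ - 1 / 2 with hs
  have hs0 : 0 < s := by linarith
  set f : ℝ[X] := (X ^ 2 - C 4) ^ 2 * (X - C s * X ^ 2) with hf
  have hfe : ∀ r, f.eval r = (r ^ 2 - 4) ^ 2 * (r - s * r ^ 2) := fun r => by simp [hf]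
  have hfpos : ∀ r : ℝ, ¬ IsUnit (R - algebraMap ℝ (𝓗 →L[ℝ] 𝓗) r) → 0 ≤ f.eval r := by
    intro r hr
    rw [hfe]
    rcases eq_or_ne r 0 with rfl | hr0
    · simp
    have hmem : (1 / 2 + r⁻¹) ∈ relSpectrum (Γ : Set (𝓗 × 𝓗)) := by
      by_contra h
      exact hr (hspec r hr0 h)
    rcases lt_or_ge (1 / 2 + r⁻¹) Λ with hlt | hge
    · rcases hgap _ hmem hlt with h | h
      · have h2 : r = -2 := by
          field_simp at h; linarith
        rw [h2]; norm_num
      · have h2 : r = 2 := by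
          field_simp at h; linarith
        rw [h2]; norm_num
    · have h2 : s ≤ r⁻¹ := by linarith
      have hrpos : 0 < r := inv_pos.mp (hs0.trans_le h2)
      have h3 : s * r ≤ 1 := by
        have := mul_le_mul_of_nonneg_right h2 hrpos.le
        rwa [inv_mul_cancel₀ hr0] at this
      refine mul_nonneg (sq_nonneg _) ?_
      nlinarith
  have hconst : ∀ a, f ≠ C a := by
    intro a ha
    have e0 := hfe 0
    have e1 := hfe 1
    have e3 := hfe 3
    rw [ha, eval_C] at e0 e1 e3
    norm_num at e0
    rw [e0] at e1 e3
    linarith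
  set y := v - (1 / 2 : ℝ) • u with hy
  have hRy : R y = u := hRof (u, v) huv
  set D : 𝓗 →L[ℝ] 𝓗 := R * R - algebraMap ℝ (𝓗 →L[ℝ] 𝓗) 4 with hD
  have hDa : ∀ w, D w = R (R w) - (4 : ℝ) • w := fun w => by
    simp [hD, Algebra.algebraMap_eq_smul_one]
  have hDsym : ∀ a b, ⟪D a, b⟫_ℝ = ⟪a, D b⟫_ℝ := by
    intro a b
    rw [hDa, hDa, inner_sub_left, inner_sub_right, hR, hR, inner_smul_left, inner_smul_right]
    simp
  have hDadj : ContinuousLinearMap.adjoint D = D := by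
    symm
    rw [ContinuousLinearMap.eq_adjoint_iff]
    exact hDsym
  have hyker : y ∈ D.kerᗮ := by
    rw [Submodule.mem_orthogonal]
    intro z hz
    have hz0 : R (R z) = (4 : ℝ) • z := by
      have : D z = 0 := hz
      rwa [hDa, sub_eq_zero] at this
    set a := R z + (2 : ℝ) • z with ha
    set b := R z - (2 : ℝ) • z with hb
    have hRa : R a = (2 : ℝ) • a := by
      rw [ha, map_add, map_smul, hz0, smul_add, smul_smul]; norm_num; abel
    have hRb : R b = (-2 : ℝ) • b := by
      rw [hb, map_sub, map_smul, hz0, smul_sub, smul_smul]; norm_num; abel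
    have ham : (a, a) ∈ Γ := by
      have h := Γ.smul_mem (1 / 2 : ℝ) (hRmem a)
      rw [hRa] at h
      convert h using 1
      ext <;> simp [smul_smul, smul_add]
      rw [← add_smul]; norm_num
    have hbm : (b, (0 : 𝓗)) ∈ Γ := by
      have h := Γ.smul_mem (-1 / 2 : ℝ) (hRmem b)
      rw [hRb] at h
      convert h using 1
      ext <;> simp [smul_smul]
    have ya : ⟪y, a⟫_ℝ = 0 := by
      have h := h1 a ham
      rw [← hRy, hR, hRa, inner_smul_right] at h
      linarith
    have yb : ⟪y, b⟫_ℝ = 0 := by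
      have h := h0 b hbm
      rw [← hRy, hR, hRb, inner_smul_right] at h
      linarith
    have e : z = (1 / 4 : ℝ) • (a - b) := by
      rw [ha, hb, add_sub_sub_cancel, ← add_smul, smul_smul]; norm_num
    rw [real_inner_comm, e, inner_smul_right, inner_sub_right, ya, yb]
    simp
  rw [ContinuousLinearMap.orthogonal_ker, hDadj] at hyker
  have hclosed : IsClosed {w : 𝓗 | 0 ≤ ⟪w, R w - s • R (R w)⟫_ℝ} :=
    isClosed_le continuous_const (by fun_prop)
  have hsub : (D.range : Set 𝓗) ⊆ {w : 𝓗 | 0 ≤ ⟪w, R w - s • R (R w)⟫_ℝ} := by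
    rintro w ⟨x, rfl⟩
    have h := inner_aeval_nonneg hR f hconst hfpos x
    have e : aeval R f = D * (D * (R - s • (R * R))) := by
      simp only [hf, hD, map_mul, map_sub, aeval_X, aeval_C, sq, mul_assoc,
        Algebra.algebraMap_eq_smul_one, smul_mul_assoc, one_mul]
    have hcomm : D * (R - s • (R * R)) = (R - s • (R * R)) * D := by
      simp only [hD, mul_sub, sub_mul, Algebra.algebraMap_eq_smul_one, smul_mul_assoc,
        mul_smul_comm, one_mul, mul_one, mul_assoc, smul_sub, smul_comm s (4 : ℝ)]
      abel
    rw [e, hcomm] at h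
    change 0 ≤ ⟪D ((R - s • (R * R)) (D x)), x⟫_ℝ at h
    rw [hDsym, real_inner_comm] at h
    exact h
  have hmem := closure_minimal hsub hclosed hyker
  change 0 ≤ ⟪y, R y - s • R (R y)⟫_ℝ at hmem
  rw [inner_sub_right, inner_smul_right, ← hR y (R y), hRy, real_inner_self_eq_norm_sq, hy,
    inner_sub_left, inner_smul_left, real_inner_self_eq_norm_sq] at hmem
  simp only [RCLike.conj_to_real, hs] at hmem
  linarith

end IsClosedSymm

/-- If the third point of a set of reals containing `0` and `1`, in increasing order, is at least
`Λ > 1`, then the set meets `[0, Λ)` only in `0` and `1`. -/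
lemma eq_zero_or_one_of_lt {σ : Set ℝ} (h0 : (0 : ℝ) ∈ σ) (h1 : (1 : ℝ) ∈ σ) {Λ : ℝ} (hΛ : 1 < Λ)
    (h : Λ ≤ sInf {t ∈ σ | sInf {s ∈ σ | sInf σ < s} < t}) {t : ℝ} (ht : t ∈ σ) (ht0 : 0 ≤ t)
    (htΛ : t < Λ) : t = 0 ∨ t = 1 := by
  -- if `σ` is not bounded below, `sInf σ` is `0` by convention
  have hl0 : sInf σ ≤ 0 := by
    by_cases hb : BddBelow σ
    · exact csInf_le hb h0
    · exact (Real.sInf_of_not_bddBelow hb).le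
  set l0 := sInf σ
  set l1 := sInf {s ∈ σ | l0 < s} with hl1
  have hb1 : BddBelow {s ∈ σ | l0 < s} := ⟨l0, fun s hs => hs.2.le⟩
  have hb2 : BddBelow {s ∈ σ | l1 < s} := ⟨l1, fun s hs => hs.2.le⟩
  have h1le : l1 ≤ 1 := csInf_le hb1 ⟨h1, by linarith⟩
  have h1ge : 1 ≤ l1 := by
    by_contra hlt
    push Not at hlt
    have := csInf_le hb2 (show (1 : ℝ) ∈ {s ∈ σ | l1 < s} from ⟨h1, hlt⟩)
    linarith
  rcases ht0.eq_or_lt with h2 | h2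
  · exact Or.inl h2.symm
  right
  have h3 : l1 ≤ t := csInf_le hb1 ⟨ht, by linarith⟩
  by_contra hne
  have h4 : 1 < t := lt_of_le_of_ne (by linarith) (Ne.symm hne)
  have h5 := csInf_le hb2 (show t ∈ {s ∈ σ | l1 < s} from ⟨ht, by linarith⟩)
  linarith

end Spectral

/-! ### The support function of a body of class `𝒦₊²` -/

section SupportFunction

variable {n : ℕ}

lemma radial_smul {t : ℝ} (ht : 0 < t) {x : E n} (hx : x ≠ 0) (htx : t • x ≠ 0) :
    radial (t • x) htx = radial x hx := by
  apply Subtype.ext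
  simp only [radial, norm_smul, Real.norm_of_nonneg ht.le, smul_smul]
  congr 1
  have := norm_ne_zero_iff.mpr hx
  field_simp

lemma homExt_hom1 (f : S n → ℝ) : Hom1 (homExt f) := by
  intro t ht x
  rcases eq_or_ne x 0 with rfl | hx
  · simp [homExt]
  · have htx : t • x ≠ 0 := smul_ne_zero ht.ne' hx
    rw [homExt, dif_neg htx, homExt, dif_neg hx, radial_smul ht hx htx, norm_smul,
      Real.norm_of_nonneg ht.le, smul_eq_mul, mul_assoc]

lemma sphere_ne_zero (x : S n) : (x : E n) ≠ 0 := ne_zero_of_mem_unit_sphere x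

lemma homExt_coe (f : S n → ℝ) (x : S n) : homExt f x = f x := by
  rw [homExt, dif_neg (sphere_ne_zero x)]
  have : radial (x : E n) (sphere_ne_zero x) = x := by
    apply Subtype.ext
    simp [radial]
  simp [this]

lemma coe_D2 {f : S n → ℝ} (hf : IsC2 f) (x : S n) (v : Tan x) :
    (D2 f x v : E n) = hess (homExt f) x v := by
  have hx := sphere_ne_zero x
  have hmem : hess (homExt f) x v ∈ Tan x := by
    rw [Submodule.mem_orthogonal_singleton_iff_inner_right,
      ← hess_symm (contDiffAt_of_ne hf hx), hess_self hf (homExt_hom1 f) hx, inner_zero_left]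
  change (((Tan x).orthogonalProjectionOnto (hess (homExt f) x v) : Tan x) : E n) = _
  exact congrArg Subtype.val (Submodule.orthogonalProjectionOnto_mem_subspace_eq_self (K := Tan x) ⟨_, hmem⟩)

section Body

variable {K : ConvexBody (E n)}

lemma homExt_supp_eq {x a : E n} (ha : a ∈ (K : Set (E n)))
    (hmax : ∀ y ∈ (K : Set (E n)), ⟪x, y⟫_ℝ ≤ ⟪x, a⟫_ℝ) : homExt (supp K) x = ⟪x, a⟫_ℝ := by
  rcases eq_or_ne x 0 with rfl | hx
  · simp [homExt]
  · have hn := norm_pos_iff.mpr hx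
    have hg : IsGreatest ((fun y : E n => ⟪(radial x hx : E n), y⟫_ℝ) '' (K : Set (E n)))
        ⟪(radial x hx : E n), a⟫_ℝ := by
      refine ⟨⟨a, ha, rfl⟩, ?_⟩
      rintro _ ⟨y, hy, rfl⟩
      simp only [radial, inner_smul_left, RCLike.conj_to_real]
      exact mul_le_mul_of_nonneg_left (hmax y hy) (inv_nonneg.mpr hn.le)
    rw [homExt, dif_neg hx, supp, hg.csSup_eq]
    simp only [radial, inner_smul_left, RCLike.conj_to_real]
    rw [← mul_assoc, mul_inv_cancel₀ hn.ne', one_mul]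

lemma exists_max_inner (K : ConvexBody (E n)) (x : E n) :
    ∃ a ∈ (K : Set (E n)), ∀ y ∈ (K : Set (E n)), ⟪x, y⟫_ℝ ≤ ⟪x, a⟫_ℝ := by
  obtain ⟨a, ha, hmax⟩ := K.isCompact.exists_isMaxOn K.nonempty
    (f := fun y => ⟪x, y⟫_ℝ) (by fun_prop)
  exact ⟨a, ha, fun y hy => hmax hy⟩

lemma inner_le_homExt_supp {y : E n} (hy : y ∈ (K : Set (E n))) (x : E n) :
    ⟪x, y⟫_ℝ ≤ homExt (supp K) x := by
  obtain ⟨a, ha, hmax⟩ := exists_max_inner K x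
  rw [homExt_supp_eq ha hmax]
  exact hmax y hy

lemma homExt_supp_pos (h0 : (0 : E n) ∈ interior (K : Set (E n))) {x : E n} (hx : x ≠ 0) :
    0 < homExt (supp K) x := by
  obtain ⟨ε, hε, hball⟩ := Metric.isOpen_iff.mp isOpen_interior 0 h0
  have hn := norm_pos_iff.mpr hx
  have hmem : (ε / 2 * ‖x‖⁻¹) • x ∈ (K : Set (E n)) := by
    refine interior_subset (hball ?_)
    rw [mem_ball_zero_iff, norm_smul, Real.norm_of_nonneg (by positivity), mul_assoc,
      inv_mul_cancel₀ hn.ne']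
    linarith
  refine lt_of_lt_of_le ?_ (inner_le_homExt_supp hmem x)
  rw [inner_smul_right, real_inner_self_eq_norm_sq]
  positivity

/-- The Lagrange multiplier rule at a maximizer of a linear functional on `{φ ≤ 0}`. -/
lemma exists_pos_smul_gradient {φ : E n → ℝ} {U : Set (E n)} (hU : IsOpen U) {a x : E n}
    (haU : a ∈ U) (hφ : DifferentiableAt ℝ φ a) (hKU : (K : Set (E n)) ∩ U = {y ∈ U | φ y ≤ 0})
    (hφa : φ a = 0) (hg : gradient φ a ≠ 0) (hx : x ≠ 0)
    (hmax : ∀ y ∈ (K : Set (E n)), ⟪x, y⟫_ℝ ≤ ⟪x, a⟫_ℝ) :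
    ∃ c : ℝ, 0 < c ∧ c • gradient φ a = x := by
  set g := gradient φ a with hgd
  have hdir : ∀ v : E n, ⟪g, v⟫_ℝ < 0 → ⟪x, v⟫_ℝ ≤ 0 := by
    intro v hv
    have hline : HasDerivAt (fun t : ℝ => a + t • v) v 0 := by
      simpa using ((hasDerivAt_id (0 : ℝ)).smul_const v).const_add a
    have hd : HasDerivAt (fun t : ℝ => φ (a + t • v)) ⟪g, v⟫_ℝ 0 := by
      rw [hgd, inner_gradient_left]
      exact HasFDerivAt.comp_hasDerivAt (x := (0 : ℝ)) (f := fun t : ℝ => a + t • v)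
        (by simpa using hφ.hasFDerivAt) hline
    have h1 := hd.tendsto_slope_zero_right.eventually (gt_mem_nhds hv)
    have h2 : ∀ᶠ t : ℝ in nhdsWithin 0 (Ioi 0), a + t • v ∈ U := by
      refine (hline.continuousAt.tendsto.eventually ?_).filter_mono nhdsWithin_le_nhds
      simpa using hU.mem_nhds haU
    obtain ⟨t, ht1, ht2, ht3⟩ := (h1.and (h2.and self_mem_nhdsWithin)).exists
    have ht : 0 < t := ht3
    simp only [zero_add, zero_smul, add_zero, hφa, sub_zero, smul_eq_mul] at ht1
    have hneg : φ (a + t • v) ≤ 0 := by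
      by_contra hcon
      push Not at hcon
      have := mul_pos (inv_pos.mpr ht) hcon
      linarith
    have hmem : a + t • v ∈ (K : Set (E n)) ∩ U := by
      rw [hKU]; exact ⟨ht2, hneg⟩
    have := hmax _ hmem.1
    rw [inner_add_right, inner_smul_right] at this
    by_contra hcon
    push Not at hcon
    have := mul_pos ht hcon
    linarith
  have hgg : 0 < ⟪g, g⟫_ℝ := real_inner_self_pos.mpr hg
  set c := ⟪x, g⟫_ℝ / ⟪g, g⟫_ℝ with hc
  have hc0 : 0 ≤ ⟪x, g⟫_ℝ := by
    have := hdir (-g) (by rw [inner_neg_right]; linarith)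
    rw [inner_neg_right] at this
    linarith
  set v := x - c • g with hv
  have hgv : ⟪g, v⟫_ℝ = 0 := by
    rw [hv, inner_sub_right, inner_smul_right, hc, div_mul_cancel₀ _ hgg.ne', real_inner_comm,
      sub_self]
  have hxv : ⟪x, v⟫_ℝ = ⟪v, v⟫_ℝ := by
    have : x = v + c • g := by rw [hv]; abel
    conv_lhs => rw [this]
    rw [inner_add_left, inner_smul_left, hgv]
    simp
  have hle : ∀ ε : ℝ, 0 < ε → ⟪v, v⟫_ℝ ≤ 0 + ε := by
    intro ε hε
    have hδ : 0 < ε / (⟪x, g⟫_ℝ + 1) := by positivity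
    have := hdir (v - (ε / (⟪x, g⟫_ℝ + 1)) • g) (by
      rw [inner_sub_right, inner_smul_right, hgv]
      have := mul_pos hδ hgg
      linarith)
    rw [inner_sub_right, inner_smul_right, hxv] at this
    have h2 : ε / (⟪x, g⟫_ℝ + 1) * ⟪x, g⟫_ℝ ≤ ε := by
      rw [div_mul_eq_mul_div, div_le_iff₀ (by positivity)]
      nlinarith
    linarith
  have hv0 : v = 0 := by
    have h1 : ⟪v, v⟫_ℝ ≤ 0 := le_of_forall_pos_le_add hle
    exact inner_self_eq_zero.mp (le_antisymm h1 real_inner_self_nonneg)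
  have hxe : x = c • g := sub_eq_zero.mp hv0
  refine ⟨c, lt_of_le_of_ne (div_nonneg hc0 hgg.le) ?_, hxe.symm⟩
  intro h0
  rw [← h0, zero_smul] at hxe
  exact hx hxe

/-- Near a given normal `x₀`, the maximizer of `⟪x, ·⟫` over the body is a `C¹` function of `x`: the
inverse function theorem applied to `(y, s) ↦ (s ∇φ(y), φ(y))`. -/
lemma exists_contDiffAt_max (hK : IsKPlusTwo K) {x₀ : E n} (hx₀ : x₀ ≠ 0) :
    ∃ Y : E n → E n, ContDiffAt ℝ 1 Y x₀ ∧ ∀ᶠ x in nhds x₀, Y x ∈ (K : Set (E n)) ∧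
      ∀ z ∈ (K : Set (E n)), ⟪x, z⟫_ℝ ≤ ⟪x, Y x⟫_ℝ := by
  obtain ⟨a, haK, hmax⟩ := exists_max_inner K x₀
  have hfr : a ∈ frontier (K : Set (E n)) := by
    rw [K.isClosed.frontier_eq]
    refine ⟨haK, fun hint => ?_⟩
    have hline : ContinuousAt (fun t : ℝ => a + t • x₀) 0 := by fun_prop
    have h1 : ∀ᶠ t : ℝ in nhdsWithin 0 (Ioi 0), a + t • x₀ ∈ interior (K : Set (E n)) := by
      refine (hline.tendsto.eventually ?_).filter_mono nhdsWithin_le_nhds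
      simpa using isOpen_interior.mem_nhds hint
    obtain ⟨t, ht1, ht2⟩ := (h1.and self_mem_nhdsWithin).exists
    have ht : 0 < t := ht2
    have := hmax _ (interior_subset ht1)
    rw [inner_add_right, inner_smul_right] at this
    have := mul_pos ht (real_inner_self_pos.mpr hx₀)
    linarith
  obtain ⟨U, φ, hU, haU, hφ, hKU, hg, hpd⟩ := hK.2 a hfr
  have hφd : ∀ y ∈ U, DifferentiableAt ℝ φ y := fun y hy =>
    (hφ.contDiffAt (hU.mem_nhds hy)).differentiableAt two_ne_zero
  have hφa : φ a = 0 := by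
    have h1 : a ∈ {y ∈ U | φ y ≤ 0} := by rw [← hKU]; exact ⟨haK, haU⟩
    refine le_antisymm h1.2 ?_
    by_contra hneg
    push Not at hneg
    rw [K.isClosed.frontier_eq] at hfr
    refine hfr.2 (mem_interior_iff_mem_nhds.mpr ?_)
    filter_upwards [hU.mem_nhds haU, (hφd a haU).continuousAt.eventually (gt_mem_nhds hneg)]
      with y hy1 hy2
    have : y ∈ (K : Set (E n)) ∩ U := by rw [hKU]; exact ⟨hy1, hy2.le⟩
    exact this.1
  obtain ⟨c, hc, hcx⟩ := exists_pos_smul_gradient hU haU (hφd a haU) hKU hφa hg hx₀ hmax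
  set G : E n × ℝ → E n × ℝ := fun q => (q.2 • gradient φ q.1, φ q.1) with hG
  have hgc : ContDiffAt ℝ 1 (gradient φ) a :=
    (contDiffOn_gradient hU hφ).contDiffAt (hU.mem_nhds haU)
  have hφc : ContDiffAt ℝ 1 φ a := (hφ.contDiffAt (hU.mem_nhds haU)).of_le (by norm_num)
  have hfst : ContDiffAt ℝ 1 (fun q : E n × ℝ => q.1) (a, c) := contDiffAt_fst
  have hGc : ContDiffAt ℝ 1 G (a, c) :=
    (contDiffAt_snd.smul (ContDiffAt.comp (a, c) (g := gradient φ) hgc hfst)).prodMk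
      (ContDiffAt.comp (a, c) (g := φ) hφc hfst)
  set G' : E n × ℝ →L[ℝ] E n × ℝ :=
    (c • (hess φ a ∘L ContinuousLinearMap.fst ℝ (E n) ℝ) +
      (ContinuousLinearMap.snd ℝ (E n) ℝ).smulRight (gradient φ a)).prod
      (fderiv ℝ φ a ∘L ContinuousLinearMap.fst ℝ (E n) ℝ) with hG'
  have hGd : HasFDerivAt G G' (a, c) := by
    have hfd : HasFDerivAt (fun q : E n × ℝ => q.1) (ContinuousLinearMap.fst ℝ (E n) ℝ) (a, c) :=
      hasFDerivAt_fst
    have h1 := HasFDerivAt.comp (a, c) (g := gradient φ)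
      (hgc.differentiableAt one_ne_zero).hasFDerivAt hfd
    have h2 := HasFDerivAt.comp (a, c) (g := φ) (hφd a haU).hasFDerivAt hfd
    exact ((hasFDerivAt_snd (p := (a, c))).smul h1).prodMk h2
  have hinj : Function.Injective G' := by
    rw [injective_iff_map_eq_zero]
    rintro ⟨v, σ⟩ hv
    have h1 : c • hess φ a v + σ • gradient φ a = 0 := congrArg Prod.fst hv
    have h2 : ⟪gradient φ a, v⟫_ℝ = 0 := by
      rw [inner_gradient_left]; exact congrArg Prod.snd hv
    have hv0 : v = 0 := by
      by_contra hne
      have h3 := congrArg (fun u => ⟪u, v⟫_ℝ) h1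
      simp only [inner_add_left, inner_smul_left, h2, inner_zero_left, RCLike.conj_to_real,
        mul_zero, add_zero] at h3
      have := mul_pos hc (hpd v hne h2)
      linarith
    rw [hv0, map_zero, smul_zero, zero_add] at h1
    rw [hv0, (smul_eq_zero.mp h1).resolve_right hg]
    rfl
  set e : (E n × ℝ) ≃L[ℝ] (E n × ℝ) :=
    (LinearEquiv.ofInjectiveEndo G'.toLinearMap hinj).toContinuousLinearEquiv with he
  have hee : (e : E n × ℝ →L[ℝ] E n × ℝ) = G' := ContinuousLinearMap.ext fun q => rfl
  have hGd' : HasFDerivAt G (e : E n × ℝ →L[ℝ] E n × ℝ) (a, c) := by rw [hee]; exact hGd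
  have hGa : G (a, c) = (x₀, 0) := by simp only [hG, hcx, hφa]
  set Z := hGc.localInverse hGd' one_ne_zero with hZ
  have hZc : ContDiffAt ℝ 1 Z (x₀, 0) := by
    rw [← hGa]; exact hGc.to_localInverse hGd' one_ne_zero
  have hZa : Z (x₀, 0) = (a, c) := by
    rw [← hGa]; exact hGc.localInverse_apply_image hGd' one_ne_zero
  have hZr : ∀ᶠ q in nhds (x₀, (0 : ℝ)), G (Z q) = q := by
    rw [← hGa]
    exact (hGc.hasStrictFDerivAt' hGd' one_ne_zero).eventually_right_inverse
  have hι : ContDiffAt ℝ 1 (fun x : E n => (x, (0 : ℝ))) x₀ := contDiffAt_id.prodMk contDiffAt_const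
  have hZι : ContDiffAt ℝ 1 (fun x : E n => Z (x, 0)) x₀ := ContDiffAt.comp x₀ hZc hι
  refine ⟨fun x => (Z (x, 0)).1, hZι.fst, ?_⟩
  have hcont := hZι.continuousAt
  have e1 : ∀ᶠ x in nhds x₀, (Z (x, 0)).1 ∈ U := by
    refine hcont.fst.eventually (p := fun y => y ∈ U) (hU.mem_nhds ?_)
    simpa only [hZa] using haU
  have e2 : ∀ᶠ x in nhds x₀, 0 < (Z (x, 0)).2 := by
    refine hcont.snd.eventually (p := fun t => 0 < t) (lt_mem_nhds ?_)
    simpa only [hZa] using hc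
  have e3 : ∀ᶠ x in nhds x₀, G (Z (x, 0)) = (x, 0) := hι.continuousAt.eventually hZr
  filter_upwards [e1, e2, e3] with x h1 h2 h3
  set y := (Z (x, 0)).1
  set s := (Z (x, 0)).2
  have h4 : s • gradient φ y = x := congrArg Prod.fst h3
  have h5 : φ y = 0 := congrArg Prod.snd h3
  have hyK : y ∈ (K : Set (E n)) := by
    have : y ∈ (K : Set (E n)) ∩ U := by rw [hKU]; exact ⟨h1, h5.le⟩
    exact this.1
  refine ⟨hyK, fun z hz => ?_⟩
  have hline : HasDerivAt (fun t : ℝ => y + t • (z - y)) (z - y) 0 := by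
    simpa using ((hasDerivAt_id (0 : ℝ)).smul_const (z - y)).const_add y
  have hd : HasDerivAt (fun t : ℝ => φ (y + t • (z - y))) ⟪gradient φ y, z - y⟫_ℝ 0 := by
    rw [inner_gradient_left]
    exact HasFDerivAt.comp_hasDerivAt (x := (0 : ℝ)) (f := fun t : ℝ => y + t • (z - y))
      (by simpa using (hφd y h1).hasFDerivAt) hline
  have h6 : ∀ᶠ t : ℝ in nhdsWithin 0 (Ioi 0), y + t • (z - y) ∈ U := by
    refine (hline.continuousAt.tendsto.eventually ?_).filter_mono nhdsWithin_le_nhds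
    simpa using hU.mem_nhds h1
  have h7 : ⟪gradient φ y, z - y⟫_ℝ ≤ 0 := by
    refine le_of_tendsto hd.tendsto_slope_zero_right ?_
    filter_upwards [h6, self_mem_nhdsWithin, Ioo_mem_nhdsGT (zero_lt_one' ℝ)] with t ht1 ht2 ht3
    have hmem : y + t • (z - y) ∈ (K : Set (E n)) ∩ U :=
      ⟨K.convex.add_smul_sub_mem hyK hz ⟨ht3.1.le, ht3.2.le⟩, ht1⟩
    rw [hKU] at hmem
    simp only [zero_add, zero_smul, add_zero, h5, sub_zero, smul_eq_mul]
    exact mul_nonpos_of_nonneg_of_nonpos (inv_nonneg.mpr ht3.1.le) hmem.2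
  rw [inner_sub_right] at h7
  rw [← h4, inner_smul_left, inner_smul_left]
  exact mul_le_mul_of_nonneg_left (by linarith) h2.le

/-- The support function is `C²` off the origin, and its gradient lies in the body. -/
lemma contDiffAt_homExt_supp (hK : IsKPlusTwo K) {x₀ : E n} (hx₀ : x₀ ≠ 0) :
    ContDiffAt ℝ 2 (homExt (supp K)) x₀ ∧ gradient (homExt (supp K)) x₀ ∈ (K : Set (E n)) := by
  obtain ⟨Y, hY, hev⟩ := exists_contDiffAt_max hK hx₀
  have hYd : ∀ᶠ x in nhds x₀, DifferentiableAt ℝ Y x :=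
    (hY.eventually (by simp)).mono fun x hx => hx.differentiableAt one_ne_zero
  have hgrad : ∀ᶠ x in nhds x₀, HasGradientAt (homExt (supp K)) (Y x) x := by
    filter_upwards [hev.eventually_nhds, hYd] with x hx hd
    have hmin : IsLocalMin (fun z => homExt (supp K) z - ⟪z, Y x⟫_ℝ) x := by
      refine Filter.Eventually.of_forall fun z => ?_
      have h1 := inner_le_homExt_supp hx.self_of_nhds.1 z
      have h2 := homExt_supp_eq hx.self_of_nhds.1 hx.self_of_nhds.2
      show homExt (supp K) x - ⟪x, Y x⟫_ℝ ≤ homExt (supp K) z - ⟪z, Y x⟫_ℝ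
      linarith
    have heq : homExt (supp K) =ᶠ[nhds x] fun z => ⟪z, Y z⟫_ℝ := by
      filter_upwards [hx] with z hz using homExt_supp_eq hz.1 hz.2
    have hHd : DifferentiableAt ℝ (homExt (supp K)) x :=
      (differentiableAt_id.inner ℝ hd).congr_of_eventuallyEq heq
    have hd2 : DifferentiableAt ℝ (fun z : E n => ⟪z, Y x⟫_ℝ) x :=
      differentiableAt_id.inner ℝ (differentiableAt_const _)
    have hz := hmin.fderiv_eq_zero
    rw [fderiv_fun_sub hHd hd2, sub_eq_zero] at hz
    have : gradient (homExt (supp K)) x = Y x := by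
      have h3 := gradient_inner_const (Y x) x
      simpa only [gradient, ← hz] using h3
    rw [← this]
    exact hHd.hasGradientAt
  refine ⟨?_, by rw [hgrad.self_of_nhds.gradient]; exact hev.self_of_nhds.1⟩
  have h2 : (2 : WithTop ℕ∞) = 1 + 1 := by norm_num
  rw [h2]
  refine (contDiffAt_succ_iff_hasFDerivAt (n := 1)).mpr
    ⟨fun x => InnerProductSpace.toDual ℝ (E n) (Y x), ⟨_, hgrad, fun x hx => hx.hasFDerivAt⟩, ?_⟩
  exact (InnerProductSpace.toDual ℝ (E n)).toContinuousLinearEquiv.contDiff.contDiffAt.comp x₀ hY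

lemma isC2_supp (hK : IsKPlusTwo K) : IsC2 (supp K) := fun _ hx =>
  (contDiffAt_homExt_supp hK hx).1.contDiffWithinAt

/-- The Hessian of the support function is positive semidefinite by convexity, hence positive
definite on the tangent space when its determinant there does not vanish. -/
theorem isRegSupport_of_isKPlusTwo (hK : IsKPlusTwo K)
    (hdet : ∀ x : S n, LinearMap.det (D2 (supp K) x) ≠ 0) : IsRegSupport (homExt (supp K)) := by
  set H := homExt (supp K) with hH
  have hsm : ContDiffOn ℝ 2 H {0}ᶜ := isC2_supp hK
  have hom : Hom1 H := homExt_hom1 _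
  have hmem : ∀ x : E n, x ≠ 0 → gradient H x ∈ (K : Set (E n)) := fun x hx =>
    (contDiffAt_homExt_supp hK hx).2
  have hsub : ∀ x : E n, x ≠ 0 → ∀ z, ⟪gradient H x, z⟫_ℝ ≤ H z := fun x hx z => by
    rw [real_inner_comm]; exact inner_le_homExt_supp (hmem x hx) z
  have hE : ∀ x : E n, x ≠ 0 → ⟪gradient H x, x⟫_ℝ = H x := fun x hx =>
    hom.inner_gradient (differentiableAt_of_contDiffOn two_ne_zero hsm hx)
  have hpsd : ∀ x : E n, x ≠ 0 → ∀ v, 0 ≤ ⟪hess H x v, v⟫_ℝ := by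
    intro x hx v
    have hline : HasDerivAt (fun t : ℝ => x + t • v) v 0 := by
      simpa using ((hasDerivAt_id (0 : ℝ)).smul_const v).const_add x
    have hd1 : HasDerivAt (fun t : ℝ => gradient H (x + t • v)) (hess H x v) 0 := by
      have h0 : HasFDerivAt (gradient H) (hess H x) (x + (0 : ℝ) • v) := by
        simpa using (differentiableAt_gradient hsm hx).hasFDerivAt
      exact h0.comp_hasDerivAt (0 : ℝ) hline
    have hd : HasDerivAt (fun t : ℝ => ⟪gradient H (x + t • v), v⟫_ℝ) ⟪hess H x v, v⟫_ℝ 0 := by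
      simpa using hd1.inner ℝ (hasDerivAt_const (0 : ℝ) v)
    refine ge_of_tendsto hd.tendsto_slope_zero_right ?_
    have hne : ∀ᶠ t : ℝ in nhdsWithin 0 (Ioi 0), x + t • v ≠ 0 :=
      (hline.continuousAt.eventually_ne (by simpa using hx)).filter_mono nhdsWithin_le_nhds
    filter_upwards [hne, self_mem_nhdsWithin] with t ht1 ht2
    have ht : 0 < t := ht2
    simp only [zero_add, zero_smul, add_zero, smul_eq_mul]
    refine mul_nonneg (inv_nonneg.mpr ht.le) ?_
    have a1 := hsub x hx (x + t • v)
    have a2 := hsub (x + t • v) ht1 x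
    rw [← hE x hx] at a2
    rw [← hE (x + t • v) ht1] at a1
    simp only [inner_add_right, inner_smul_right] at a1 a2
    have : 0 ≤ t * (⟪gradient H (x + t • v), v⟫_ℝ - ⟪gradient H x, v⟫_ℝ) := by linarith
    exact nonneg_of_mul_nonneg_right this ht
  have hker : ∀ x : E n, x ≠ 0 → ∀ v, ⟪hess H x v, v⟫_ℝ = 0 → hess H x v = 0 := by
    intro x hx v hv
    set N := ‖hess H x v‖ ^ 2 with hN
    set c := ⟪hess H x (hess H x v), hess H x v⟫_ℝ with hc
    have hc0 : 0 ≤ c := hpsd x hx _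
    have h1 := hpsd x hx (v - (N / (c + 1)) • hess H x v)
    rw [map_sub, map_smul, inner_sub_left, inner_sub_right, inner_sub_right, hv, inner_smul_left,
      inner_smul_left, inner_smul_right, inner_smul_right,
      hess_symm (contDiffAt_of_ne hsm hx) (hess H x v) v, real_inner_self_eq_norm_sq, ← hN,
      ← hc] at h1
    simp only [RCLike.conj_to_real] at h1
    have h2 : N / (c + 1) * c ≤ N := by
      rw [div_mul_eq_mul_div, div_le_iff₀ (by positivity)]
      have : 0 ≤ N := sq_nonneg _
      nlinarith
    have h3 : 0 ≤ N / (c + 1) := div_nonneg (sq_nonneg _) (by positivity)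
    have h4 := mul_le_mul_of_nonneg_left h2 h3
    have h5 : N / (c + 1) * N ≤ 0 := by linarith
    have h6 : N = 0 := by
      by_contra hne
      have : 0 < N := lt_of_le_of_ne (sq_nonneg _) (Ne.symm hne)
      have : 0 < N / (c + 1) * N := by positivity
      linarith
    exact norm_eq_zero.mp (pow_eq_zero_iff two_ne_zero |>.mp h6)
  have hunit : ∀ x : S n, ∀ v : E n, v ≠ 0 → ⟪(x : E n), v⟫_ℝ = 0 → hess H x v ≠ 0 := by
    intro x v hv hxv h0
    have hvT : v ∈ Tan x := (Submodule.mem_orthogonal_singleton_iff_inner_right).mpr hxv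
    have hD : D2 (supp K) x ⟨v, hvT⟩ = 0 := Subtype.ext (by
      rw [coe_D2 (isC2_supp hK)]; exact h0)
    have hinj := (LinearMap.isUnit_iff_isUnit_det (D2 (supp K) x)).mpr
      (isUnit_iff_ne_zero.mpr (hdet x))
    have h2 := ((Module.End.isUnit_iff _).mp hinj).1 (hD.trans (map_zero _).symm)
    exact hv (congrArg Subtype.val h2)
  refine ⟨hsm, hom, fun x hx => homExt_supp_pos hK.1 hx, hsub, fun x hx v hv hxv => ?_⟩
  refine lt_of_le_of_ne (hpsd x hx v) fun h => ?_
  have hn := norm_pos_iff.mpr hx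
  have h1 := hker x hx v h.symm
  have h2 : hess H (radial x hx : E n) v = 0 := by
    change hess H (‖x‖⁻¹ • x) v = 0
    rw [hess, hom.gradient.fderiv_smul (inv_pos.mpr hn)]
    simp only [FunLike.coe_smul, Pi.smul_apply]
    rw [show fderiv ℝ (gradient H) x v = 0 from h1, smul_zero]
  refine hunit (radial x hx) v hv ?_ h2
  change ⟪‖x‖⁻¹ • x, v⟫_ℝ = 0
  rw [inner_smul_left, hxv, mul_zero]

end Body

end SupportFunction

/-! ### Linear algebra on the tangent spaces -/

section Pointwise

variable {V : Type*} [NormedAddCommGroup V] [InnerProductSpace ℝ V] [FiniteDimensional ℝ V]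
  [Nontrivial V] [MeasurableSpace V] [BorelSpace V]

lemma norm_sq_le_sum {ι : Type*} [Fintype ι] (b : OrthonormalBasis ι ℝ V) (B : V →L[ℝ] V) :
    ‖B‖ ^ 2 ≤ Fintype.card ι * ∑ i, ‖B (b i)‖ ^ 2 := by
  have h1 : ‖B‖ ≤ ∑ i, ‖B (b i)‖ := by
    refine B.opNorm_le_bound (Finset.sum_nonneg fun i _ => norm_nonneg _) fun v => ?_
    conv_lhs => rw [← b.sum_repr v, map_sum]
    refine (norm_sum_le _ _).trans ?_
    rw [Finset.sum_mul]
    refine Finset.sum_le_sum fun i _ => ?_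
    rw [map_smul, norm_smul, mul_comm]
    refine mul_le_mul_of_nonneg_left ?_ (norm_nonneg _)
    rw [b.repr_apply_apply]
    simpa using norm_inner_le_norm (𝕜 := ℝ) (b i) v
  calc ‖B‖ ^ 2 ≤ (∑ i, ‖B (b i)‖) ^ 2 := by gcongr
    _ ≤ _ := by simpa using sq_sum_le_card_mul_sum_sq (s := Finset.univ) (f := fun i => ‖B (b i)‖)

/-- Diagonalizing `T` gives `tr (T B T B) ≥ c tr (T B²) = c tr (B T B) ≥ c² |B|²`. -/
lemma le_ctrace_of_coercive {T B : V →L[ℝ] V} (hT : ∀ u v, ⟪T u, v⟫_ℝ = ⟪u, T v⟫_ℝ)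
    (hB : ∀ u v, ⟪B u, v⟫_ℝ = ⟪u, B v⟫_ℝ) (hT0 : ∀ v, 0 ≤ ⟪T v, v⟫_ℝ) {c : ℝ} (hc : 0 ≤ c)
    (hTB : ∀ v, c * ‖B v‖ ^ 2 ≤ ⟪T (B v), B v⟫_ℝ) :
    c ^ 2 * ‖B‖ ^ 2 ≤ finrank ℝ V * ctrace (T * B * (T * B)) := by
  have hTs : (T : V →ₗ[ℝ] V).IsSymmetric := hT
  set b := hTs.eigenvectorBasis rfl
  set t := hTs.eigenvalues rfl
  have hbt : ∀ i, T (b i) = t i • b i := fun i => hTs.apply_eigenvectorBasis rfl i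
  have ht0 : ∀ i, 0 ≤ t i := fun i => by
    have := hT0 (b i)
    rw [hbt, inner_smul_left, real_inner_self_eq_norm_sq, b.norm_eq_one] at this
    simpa using this
  have h1 : c * ctrace (T * B * B) ≤ ctrace (T * B * (T * B)) := by
    rw [ctrace_eq_sum b, ctrace_eq_sum b, Finset.mul_sum]
    refine Finset.sum_le_sum fun i _ => ?_
    simp only [mul_apply_eq_comp]
    rw [← hT, ← hT, hbt, inner_smul_left, inner_smul_left, ← hB, ← hB (b i),
      real_inner_self_eq_norm_sq, real_inner_comm]
    have := mul_le_mul_of_nonneg_left (hTB (b i)) (ht0 i)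
    simp only [RCLike.conj_to_real]
    linarith
  have h2 : c * ∑ i, ‖B (b i)‖ ^ 2 ≤ ctrace (T * B * B) := by
    rw [ctrace_mul_comm, ctrace_eq_sum b, Finset.mul_sum]
    refine Finset.sum_le_sum fun i _ => ?_
    simp only [mul_apply_eq_comp]
    rw [← hB, ← hT]
    exact hTB (b i)
  have h3 := norm_sq_le_sum b B
  rw [Fintype.card_fin] at h3
  calc c ^ 2 * ‖B‖ ^ 2 ≤ c ^ 2 * (finrank ℝ V * ∑ i, ‖B (b i)‖ ^ 2) := by gcongr
    _ = finrank ℝ V * (c * (c * ∑ i, ‖B (b i)‖ ^ 2)) := by ring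
    _ ≤ finrank ℝ V * (c * ctrace (T * B * B)) := by gcongr
    _ ≤ _ := by gcongr

namespace IsRegSupport

variable {H : V → ℝ} (hH : IsRegSupport H)
include hH

lemma inner_inverse_dbd_eq_zero {x u : V} (hx : x ≠ 0) (hu : ⟪x, u⟫_ℝ = 0) :
    ⟪x, Ring.inverse (dbd H x) u⟫_ℝ = 0 := by
  rw [hH.inner_inverse_dbd hx, hu, mul_zero, zero_div]

lemma hess_inverse_dbd {x u : V} (hx : ‖x‖ = 1) (hu : ⟪x, u⟫_ℝ = 0) :
    hess H x (Ring.inverse (dbd H x) u) = u := by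
  have hx0 : x ≠ 0 := norm_ne_zero_iff.mp (by rw [hx]; exact one_ne_zero)
  have h := hH.dbd_inverse hx0 u
  rw [dbd_apply, hH.inner_inverse_dbd_eq_zero hx0 hu, hx, mul_zero, zero_smul, one_smul,
    zero_add] at h
  exact h

lemma inverse_dbd_symm {x u v : V} (hx : ‖x‖ = 1) (hu : ⟪x, u⟫_ℝ = 0) (hv : ⟪x, v⟫_ℝ = 0) :
    ⟪Ring.inverse (dbd H x) u, v⟫_ℝ = ⟪u, Ring.inverse (dbd H x) v⟫_ℝ := by
  have hx0 : x ≠ 0 := norm_ne_zero_iff.mp (by rw [hx]; exact one_ne_zero)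
  conv_lhs => rw [← hH.hess_inverse_dbd hx hv]
  rw [← hH.hess_symm hx0, hH.hess_inverse_dbd hx hu]

lemma inner_inverse_dbd_pos {x u : V} (hx : ‖x‖ = 1) (hu : ⟪x, u⟫_ℝ = 0) (hu0 : u ≠ 0) :
    0 < ⟪Ring.inverse (dbd H x) u, u⟫_ℝ := by
  have hx0 : x ≠ 0 := norm_ne_zero_iff.mp (by rw [hx]; exact one_ne_zero)
  have h := hH.pd x hx0 (Ring.inverse (dbd H x) u) (fun h0 => hu0 (by
    rw [← hH.hess_inverse_dbd hx hu, h0, map_zero])) (hH.inner_inverse_dbd_eq_zero hx0 hu)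
  rwa [hH.hess_inverse_dbd hx hu, real_inner_comm] at h

lemma exists_inverse_dbd_coercive : ∃ c : ℝ, 0 < c ∧ ∀ x u : V, ‖x‖ = 1 → ⟪x, u⟫_ℝ = 0 →
    c * ‖u‖ ^ 2 ≤ ⟪Ring.inverse (dbd H x) u, u⟫_ℝ := by
  set S := (sphere (0 : V) 1 ×ˢ sphere (0 : V) 1) ∩ {q : V × V | ⟪q.1, q.2⟫_ℝ = 0} with hS
  have hcomp : IsCompact S := ((isCompact_sphere 0 1).prod (isCompact_sphere 0 1)).inter_right
    (isClosed_eq (by fun_prop) continuous_const)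
  have hcont : ContinuousOn (fun q : V × V => ⟪Ring.inverse (dbd H q.1) q.2, q.2⟫_ℝ) S := by
    have h1 : ContinuousOn (fun q : V × V => Ring.inverse (dbd H q.1)) S :=
      hH.continuousOn_inverse_dbd.comp continuousOn_fst fun q hq =>
        ne_zero_of_mem_unit_sphere ⟨q.1, hq.1.1⟩
    exact (h1.clm_apply continuousOn_snd).inner continuousOn_snd
  have hpos : ∀ q ∈ S, 0 < ⟪Ring.inverse (dbd H q.1) q.2, q.2⟫_ℝ := fun q hq =>
    hH.inner_inverse_dbd_pos (mem_sphere_zero_iff_norm.mp hq.1.1) hq.2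
      (ne_zero_of_mem_unit_sphere ⟨q.2, hq.1.2⟩)
  obtain ⟨c, hc, hcS⟩ : ∃ c : ℝ, 0 < c ∧ ∀ q ∈ S, c ≤ ⟪Ring.inverse (dbd H q.1) q.2, q.2⟫_ℝ := by
    rcases S.eq_empty_or_nonempty with he | hne
    · exact ⟨1, one_pos, by simp [he]⟩
    · obtain ⟨q, hq, hmin⟩ := hcomp.exists_isMinOn hne hcont
      exact ⟨_, hpos q hq, fun r hr => hmin hr⟩
  refine ⟨c, hc, fun x u hx hu => ?_⟩
  rcases eq_or_ne u 0 with rfl | hu0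
  · simp
  have hn := norm_pos_iff.mpr hu0
  have h := hcS (x, ‖u‖⁻¹ • u) ⟨⟨by simpa using hx, by simp [norm_smul, hn.ne']⟩, by
    simp [inner_smul_right, hu]⟩
  simp only [map_smul, inner_smul_left, inner_smul_right, RCLike.conj_to_real] at h
  have h2 := mul_le_mul_of_nonneg_left h (sq_nonneg ‖u‖)
  calc c * ‖u‖ ^ 2 = ‖u‖ ^ 2 * c := mul_comm _ _
    _ ≤ _ := h2
    _ = _ := by field_simp

/-- On symmetric forms on the tangent space, `tr ((B A⁻¹)²)` controls `|B|²`, where `A` is the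
Hessian of `H`. -/
lemma exists_le_ctrace_sq : ∃ c : ℝ, 0 < c ∧ ∀ (x : V) (B : V →L[ℝ] V), ‖x‖ = 1 →
    (∀ u v, ⟪B u, v⟫_ℝ = ⟪u, B v⟫_ℝ) → B x = 0 →
    c * ‖B‖ ^ 2 ≤ finrank ℝ V *
      ctrace ((B ∘L Ring.inverse (dbd H x)) * (B ∘L Ring.inverse (dbd H x))) := by
  obtain ⟨c, hc, hcD⟩ := hH.exists_inverse_dbd_coercive
  refine ⟨c ^ 2, by positivity, fun x B hx hB hBx => ?_⟩
  have hx0 : x ≠ 0 := norm_ne_zero_iff.mp (by rw [hx]; exact one_ne_zero)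
  set D := Ring.inverse (dbd H x)
  set P : V →L[ℝ] V := 1 - (innerSL ℝ x).smulRight x with hP
  have hPv : ∀ v, P v = v - ⟪x, v⟫_ℝ • x := fun v => rfl
  have hPx : ∀ v, ⟪x, P v⟫_ℝ = 0 := fun v => by
    rw [hPv, inner_sub_right, inner_smul_right, real_inner_self_eq_norm_sq, hx]; ring
  have hBr : ∀ v, ⟪x, B v⟫_ℝ = 0 := fun v => by rw [← hB, hBx, inner_zero_left]
  have hPB : ∀ v, P (B v) = B v := fun v => by rw [hPv, hBr, zero_smul, sub_zero]
  have hinn : ∀ u v, ⟪D (P u), v⟫_ℝ = ⟪D (P u), P v⟫_ℝ := fun u v => by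
    rw [hPv v, inner_sub_right, inner_smul_right, real_inner_comm x,
      hH.inner_inverse_dbd_eq_zero hx0 (hPx u), mul_zero, sub_zero]
  have hinn' : ∀ u v, ⟪u, D (P v)⟫_ℝ = ⟪P u, D (P v)⟫_ℝ := fun u v => by
    rw [real_inner_comm, hinn, real_inner_comm]
  have hT : ∀ u v, ⟪(D * P) u, v⟫_ℝ = ⟪u, (D * P) v⟫_ℝ := fun u v => by
    simp only [mul_apply_eq_comp]
    rw [hinn, hinn', hH.inverse_dbd_symm hx (hPx u) (hPx v)]
  have hT0 : ∀ v, 0 ≤ ⟪(D * P) v, v⟫_ℝ := fun v => by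
    simp only [mul_apply_eq_comp]
    rw [hinn]
    exact le_trans (by positivity) (hcD x (P v) hx (hPx v))
  have hTB : ∀ v, c * ‖B v‖ ^ 2 ≤ ⟪(D * P) (B v), B v⟫_ℝ := fun v => by
    simp only [mul_apply_eq_comp]
    rw [hPB]
    exact hcD x (B v) hx (hBr v)
  have h := le_ctrace_of_coercive hT hB hT0 hc.le hTB
  have hDPB : D * P * B = D * B := by
    ext v
    simp only [mul_apply_eq_comp]
    rw [hPB]
  rw [hDPB] at h
  have hcyc : ctrace ((B ∘L D) * (B ∘L D)) = ctrace (D * B * (D * B)) := by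
    change ctrace (B * D * (B * D)) = _
    rw [mul_assoc, ctrace_mul_comm, mul_assoc, mul_assoc, mul_assoc]
  rwa [hcyc]

end IsRegSupport

end Pointwise

/-! ### The Dirichlet form and coercivity estimates -/

section Forms

variable {V : Type*} [NormedAddCommGroup V] [InnerProductSpace ℝ V] [FiniteDimensional ℝ V]
  [Nontrivial V] [MeasurableSpace V] [BorelSpace V] {μ : Measure V} [μ.IsAddHaarMeasure]

lemma norm_coe_sphere (s : sphere (0 : V) 1) : ‖(s : V)‖ = 1 := mem_sphere_zero_iff_norm.mp s.2

lemma coe_sphere_ne_zero (s : sphere (0 : V) 1) : (s : V) ≠ 0 := ne_zero_of_mem_unit_sphere s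

lemma norm_gradient {f : V → ℝ} {x : V} : ‖gradient f x‖ = ‖fderiv ℝ f x‖ :=
  LinearIsometryEquiv.norm_map _ _

lemma exists_pos_le {g : sphere (0 : V) 1 → ℝ} (hg : Continuous g) (h0 : ∀ s, 0 < g s) :
    ∃ c : ℝ, 0 < c ∧ ∀ s, c ≤ g s := by
  have : Nonempty (sphere (0 : V) 1) := (NormedSpace.sphere_nonempty.mpr zero_le_one).to_subtype
  obtain ⟨s, -, hs⟩ := isCompact_univ.exists_isMinOn univ_nonempty hg.continuousOn
  exact ⟨g s, h0 s, fun r => hs (mem_univ r)⟩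

lemma exists_le_pos {g : sphere (0 : V) 1 → ℝ} (hg : Continuous g) :
    ∃ C : ℝ, 0 < C ∧ ∀ s, g s ≤ C := by
  have : Nonempty (sphere (0 : V) 1) := (NormedSpace.sphere_nonempty.mpr zero_le_one).to_subtype
  obtain ⟨s, -, hs⟩ := isCompact_univ.exists_isMaxOn univ_nonempty hg.continuousOn
  exact ⟨max (g s) 1, by positivity, fun r => (hs (mem_univ r)).trans (le_max_left _ _)⟩

namespace IsRegSupport

variable {H : V → ℝ} (hH : IsRegSupport H)
include hH

lemma hom0_div_self {F : V → ℝ} (hF1 : Hom1 F) : Hom0 fun x => F x / H x := by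
  intro t ht x
  simp only [hF1 ht, hH.hom ht, smul_eq_mul]
  exact mul_div_mul_left _ _ ht.ne'

lemma contDiffOn_div_self {F : V → ℝ} {k : WithTop ℕ∞} (hk : k ≤ 2) (hF : ContDiffOn ℝ 2 F {0}ᶜ) :
    ContDiffOn ℝ k (fun x => F x / H x) {0}ᶜ :=
  (hF.div hH.smooth fun x hx => (hH.pos x hx).ne').of_le hk

lemma continuous_abs_det : Continuous fun s : sphere (0 : V) 1 => |(dbd H s).det| :=
  (ContinuousLinearMap.continuous_det.comp
    (continuous_sphere_of_continuousOn hH.continuousOn_dbd)).abs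

lemma continuous_coe : Continuous fun s : sphere (0 : V) 1 => H s :=
  continuous_sphere_of_continuousOn hH.smooth.continuousOn

lemma abs_det_pos {x : V} (hx : x ≠ 0) : 0 < |(dbd H x).det| := by
  have h := (hH.isUnit_dbd hx).map (ContinuousLinearMap.toLinearMapRingHom (R₁ := ℝ) (M₁ := V))
  exact abs_pos.mpr ((LinearMap.isUnit_iff_isUnit_det _).mp h).ne_zero

lemma continuous_ctrace {F : V → ℝ} (hF : ContDiffOn ℝ 2 F {0}ᶜ) :
    Continuous fun s : sphere (0 : V) 1 => ctrace (hess F s ∘L Ring.inverse (dbd H s)) :=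
  ctrace.continuous.comp (continuous_sphere_of_continuousOn
    ((continuousOn_hess hF).clm_comp hH.continuousOn_inverse_dbd))

lemma continuous_div {F : V → ℝ} (hF : ContDiffOn ℝ 2 F {0}ᶜ) :
    Continuous fun s : sphere (0 : V) 1 => F s / H s :=
  continuous_sphere_of_continuousOn (hH.contDiffOn_div_self (k := 0) (by norm_num) hF).continuousOn

/-- The weak form of the operator: `integral_ctrace` for the field `Z ∇F`. -/
lemma integral_mul_eq (hd : 2 ≤ finrank ℝ V) {Z F : V → ℝ} (hZ : ContDiffOn ℝ 1 Z {0}ᶜ)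
    (hZ0 : Hom0 Z) (hF : ContDiffOn ℝ 2 F {0}ᶜ) (hF1 : Hom1 F) :
    ∫ s : sphere (0 : V) 1, |(dbd H s).det| * (Z s * (((finrank ℝ V : ℝ) - 1) * (F s / H s) -
        ctrace (hess F s ∘L Ring.inverse (dbd H s)))) ∂μ.toSphere =
      ∫ s : sphere (0 : V) 1, |(dbd H s).det| *
        fderiv ℝ Z s (Ring.inverse (dbd H s) (gradient F s)) ∂μ.toSphere := by
  have hgr : ContDiffOn ℝ 1 (gradient F) {0}ᶜ := contDiffOn_gradient isOpen_compl_singleton hF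
  have h := hH.integral_ctrace (μ := μ) hd (w := fun x => Z x • gradient F x) (hZ.smul hgr)
    (fun t ht x => by simp only [hZ0 ht, hF1.gradient ht])
  have hD := continuous_sphere_of_continuousOn hH.continuousOn_inverse_dbd
  have hc1 : Continuous fun s : sphere (0 : V) 1 => |(dbd H s).det| *
      (Z s * ctrace (hess F s ∘L Ring.inverse (dbd H s))) :=
    hH.continuous_abs_det.mul ((continuous_sphere_of_continuousOn hZ.continuousOn).mul
      (hH.continuous_ctrace hF))
  have hc2 : Continuous fun s : sphere (0 : V) 1 => |(dbd H s).det| *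
      fderiv ℝ Z s (Ring.inverse (dbd H s) (gradient F s)) :=
    hH.continuous_abs_det.mul ((continuous_sphere_of_continuousOn (continuousOn_fderiv hZ)).clm_apply
      (hD.clm_apply (continuous_sphere_of_continuousOn hgr.continuousOn)))
  have hc3 : Continuous fun s : sphere (0 : V) 1 => |(dbd H s).det| *
      (⟪(s : V), Z s • gradient F s⟫_ℝ / H s) :=
    hH.continuous_abs_det.mul (Continuous.div (Continuous.inner continuous_subtype_val
      ((continuous_sphere_of_continuousOn hZ.continuousOn).smul
        (continuous_sphere_of_continuousOn hgr.continuousOn))) hH.continuous_coe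
        fun s => (hH.pos _ (coe_sphere_ne_zero s)).ne')
  have e1 : ∀ s : sphere (0 : V) 1, |(dbd H s).det| *
      ctrace (fderiv ℝ (fun x => Z x • gradient F x) s ∘L Ring.inverse (dbd H s)) =
      |(dbd H s).det| * (Z s * ctrace (hess F s ∘L Ring.inverse (dbd H s))) +
      |(dbd H s).det| * fderiv ℝ Z s (Ring.inverse (dbd H s) (gradient F s)) := by
    intro s
    have hs := coe_sphere_ne_zero s
    have h1 := (differentiableAt_of_contDiffOn one_ne_zero hZ hs).hasFDerivAt.smul
      (differentiableAt_gradient hF hs).hasFDerivAt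
    have h2 : fderiv ℝ (fun x => Z x • gradient F x) s ∘L Ring.inverse (dbd H s) =
        Z s • (hess F s ∘L Ring.inverse (dbd H s)) +
        (fderiv ℝ Z s ∘L Ring.inverse (dbd H s)).smulRight (gradient F s) := by
      rw [show fderiv ℝ (fun x => Z x • gradient F x) s = _ from h1.fderiv]
      ext v
      rfl
    rw [h2, map_add, map_smul, ctrace_smulRight, mul_add, smul_eq_mul]
    rfl
  have e2 : ∀ s : sphere (0 : V) 1, |(dbd H s).det| * (Z s * (((finrank ℝ V : ℝ) - 1) *
      (F s / H s) - ctrace (hess F s ∘L Ring.inverse (dbd H s)))) =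
      ((finrank ℝ V : ℝ) - 1) * (|(dbd H s).det| * (⟪(s : V), Z s • gradient F s⟫_ℝ / H s)) -
      |(dbd H s).det| * (Z s * ctrace (hess F s ∘L Ring.inverse (dbd H s))) := by
    intro s
    rw [inner_smul_right, real_inner_comm,
      hF1.inner_gradient (differentiableAt_of_contDiffOn two_ne_zero hF (coe_sphere_ne_zero s))]
    ring
  simp only [e1] at h
  rw [integral_add (integrable_sphere hc1) (integrable_sphere hc2)] at h
  simp only [e2]
  rw [integral_sub ((integrable_sphere hc3).const_mul _) (integrable_sphere hc1),
    integral_const_mul]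
  linarith

lemma hess_inverse_dbd_eq {x : V} (hx : ‖x‖ = 1) (y : V) :
    hess H x (Ring.inverse (dbd H x) y) = y - (⟪x, y⟫_ℝ / H x) • gradient H x := by
  have hx0 : x ≠ 0 := norm_ne_zero_iff.mp (by rw [hx]; exact one_ne_zero)
  have h := hH.dbd_inverse hx0 y
  rw [dbd_apply, hH.inner_inverse_dbd hx0, hx, inv_one, one_mul, one_mul, one_smul] at h
  exact eq_sub_of_add_eq' h

lemma gradient_div_eq {F : V → ℝ} (hF : ContDiffOn ℝ 2 F {0}ᶜ) {x : V} (hx : x ≠ 0) :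
    gradient F x =
      H x • gradient (fun y => F y / H y) x + (F x / H x) • gradient H x := by
  have hdZ : DifferentiableAt ℝ (fun y => F y / H y) x :=
    differentiableAt_of_contDiffOn one_ne_zero (hH.contDiffOn_div_self (by norm_num) hF) hx
  rw [← gradient_mul' (hH.diff hx) hdZ]
  have : F =ᶠ[nhds x] fun y => H y * (F y / H y) := by
    filter_upwards [compl_zero_mem_nhds hx] with y hy
    rw [mul_div_cancel₀ _ (hH.pos y hy).ne']
  rw [gradient, gradient, this.fderiv_eq]

lemma inner_gradient_div_self {F : V → ℝ} (hF : ContDiffOn ℝ 2 F {0}ᶜ) (hF1 : Hom1 F) {x : V}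
    (hx : x ≠ 0) : ⟪x, gradient (fun y => F y / H y) x⟫_ℝ = 0 := by
  rw [inner_gradient_right]
  exact (hH.hom0_div_self hF1).fderiv_self
    (differentiableAt_of_contDiffOn one_ne_zero (hH.contDiffOn_div_self (by norm_num) hF) hx)

/-- The energy density of the Dirichlet form. -/
lemma fderiv_div_inverse_dbd {F G : V → ℝ} (hF : ContDiffOn ℝ 2 F {0}ᶜ) (hF1 : Hom1 F)
    (hG : ContDiffOn ℝ 2 G {0}ᶜ) {x : V} (hx : ‖x‖ = 1) :
    fderiv ℝ (fun y => F y / H y) x (Ring.inverse (dbd H x) (gradient G x)) =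
      H x * ⟪gradient (fun y => F y / H y) x,
        Ring.inverse (dbd H x) (gradient (fun y => G y / H y) x)⟫_ℝ := by
  have hx0 : x ≠ 0 := norm_ne_zero_iff.mp (by rw [hx]; exact one_ne_zero)
  have h1 : Ring.inverse (dbd H x) (gradient H x) = x := by
    have : gradient H x = dbd H x x := by rw [hH.dbd_self hx0, bdMap, hx, one_smul]
    rw [this, hH.inverse_dbd hx0]
  rw [← inner_gradient_left, hH.gradient_div_eq hG hx0, map_add, map_smul, map_smul, h1,
    inner_add_right, inner_smul_right, inner_smul_right, real_inner_comm x,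
    hH.inner_gradient_div_self hF hF1 hx0, mul_zero, add_zero]

lemma fderiv_div_symm {F G : V → ℝ} (hF : ContDiffOn ℝ 2 F {0}ᶜ) (hF1 : Hom1 F)
    (hG : ContDiffOn ℝ 2 G {0}ᶜ) (hG1 : Hom1 G) {x : V} (hx : ‖x‖ = 1) :
    fderiv ℝ (fun y => F y / H y) x (Ring.inverse (dbd H x) (gradient G x)) =
      fderiv ℝ (fun y => G y / H y) x (Ring.inverse (dbd H x) (gradient F x)) := by
  have hx0 : x ≠ 0 := norm_ne_zero_iff.mp (by rw [hx]; exact one_ne_zero)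
  rw [hH.fderiv_div_inverse_dbd hF hF1 hG hx, hH.fderiv_div_inverse_dbd hG hG1 hF hx,
    ← hH.inverse_dbd_symm hx (hH.inner_gradient_div_self hF hF1 hx0)
      (hH.inner_gradient_div_self hG hG1 hx0), real_inner_comm]

lemma fderiv_div_nonneg {F : V → ℝ} (hF : ContDiffOn ℝ 2 F {0}ᶜ) (hF1 : Hom1 F) {x : V}
    (hx : ‖x‖ = 1) :
    0 ≤ fderiv ℝ (fun y => F y / H y) x (Ring.inverse (dbd H x) (gradient F x)) := by
  have hx0 : x ≠ 0 := norm_ne_zero_iff.mp (by rw [hx]; exact one_ne_zero)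
  obtain ⟨c, hc, hcD⟩ := hH.exists_inverse_dbd_coercive
  rw [hH.fderiv_div_inverse_dbd hF hF1 hF hx, real_inner_comm]
  exact mul_nonneg (hH.nonneg x)
    (le_trans (by positivity) (hcD x _ hx (hH.inner_gradient_div_self hF hF1 hx0)))

variable (μ) in
/-- Poincaré inequality for the Dirichlet form: only constants have small energy. -/
lemma exists_integral_sub_const_le (hd : 3 ≤ finrank ℝ V) : ∃ C : ℝ, 0 ≤ C ∧ ∀ F : V → ℝ,
    ContDiffOn ℝ 2 F {0}ᶜ → Hom1 F → ∃ a : ℝ,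
      ∫ s : sphere (0 : V) 1, |(dbd H s).det| * (F s / H s - a) ^ 2 ∂μ.toSphere ≤
        C * ∫ s : sphere (0 : V) 1, |(dbd H s).det| *
          (F s / H s * (((finrank ℝ V : ℝ) - 1) * (F s / H s) -
            ctrace (hess F s ∘L Ring.inverse (dbd H s)))) ∂μ.toSphere := by
  obtain ⟨C, hC, hP⟩ := exists_poincare (μ := μ) (W := ℝ) hd
  obtain ⟨c, hc, hcD⟩ := hH.exists_inverse_dbd_coercive
  obtain ⟨M, hM, hMs⟩ := exists_le_pos hH.continuous_abs_det
  obtain ⟨m, hm, hms⟩ := exists_pos_le (hH.continuous_abs_det.mul hH.continuous_coe)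
    fun s => mul_pos (hH.abs_det_pos (coe_sphere_ne_zero s)) (hH.pos _ (coe_sphere_ne_zero s))
  refine ⟨M * C * (m * c)⁻¹, by positivity, fun F hF hF1 => ?_⟩
  have hZ := hH.contDiffOn_div_self (k := 1) (by norm_num) hF
  have hZ0 := hH.hom0_div_self hF1
  obtain ⟨a, ha⟩ := hP _ hZ hZ0
  refine ⟨a, ?_⟩
  rw [hH.integral_mul_eq (by omega) hZ hZ0 hF hF1]
  have hcZ := hH.continuous_div hF
  have hc' := continuous_sphere_of_continuousOn (continuousOn_fderiv hZ)
  have hc2 : Continuous fun s : sphere (0 : V) 1 => |(dbd H s).det| *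
      fderiv ℝ (fun x => F x / H x) s (Ring.inverse (dbd H s) (gradient F s)) :=
    hH.continuous_abs_det.mul (hc'.clm_apply
      ((continuous_sphere_of_continuousOn hH.continuousOn_inverse_dbd).clm_apply
      (continuous_sphere_of_continuousOn
        (contDiffOn_gradient isOpen_compl_singleton hF).continuousOn)))
  have h1 : ∫ s : sphere (0 : V) 1, |(dbd H s).det| * (F s / H s - a) ^ 2 ∂μ.toSphere ≤
      M * ∫ s : sphere (0 : V) 1, ‖F s / H s - a‖ ^ 2 ∂μ.toSphere := by
    rw [← integral_const_mul]
    refine integral_mono (integrable_sphere (hH.continuous_abs_det.mul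
      ((hcZ.sub continuous_const).pow 2)))
      ((integrable_sphere ((hcZ.sub continuous_const).norm.pow 2)).const_mul _) fun s => ?_
    simp only [Real.norm_eq_abs, sq_abs]
    exact mul_le_mul_of_nonneg_right (hMs s) (sq_nonneg _)
  have h2 : (m * c) * ∫ s : sphere (0 : V) 1, ‖fderiv ℝ (fun x => F x / H x) s‖ ^ 2 ∂μ.toSphere ≤
      ∫ s : sphere (0 : V) 1, |(dbd H s).det| *
        fderiv ℝ (fun x => F x / H x) s (Ring.inverse (dbd H s) (gradient F s)) ∂μ.toSphere := by
    rw [← integral_const_mul]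
    refine integral_mono ((integrable_sphere (hc'.norm.pow 2)).const_mul _)
      (integrable_sphere hc2) fun s => ?_
    simp only
    rw [hH.fderiv_div_inverse_dbd hF hF1 hF (norm_coe_sphere s), real_inner_comm, ← norm_gradient,
      ← mul_assoc, mul_assoc]
    exact mul_le_mul (hms s) (hcD s _ (norm_coe_sphere s)
      (hH.inner_gradient_div_self hF hF1 (coe_sphere_ne_zero s))) (by positivity)
      (mul_nonneg (abs_nonneg _) (hH.nonneg _))
  calc _ ≤ M * ∫ s : sphere (0 : V) 1, ‖F s / H s - a‖ ^ 2 ∂μ.toSphere := h1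
    _ ≤ M * (C * ∫ s : sphere (0 : V) 1, ‖fderiv ℝ (fun x => F x / H x) s‖ ^ 2 ∂μ.toSphere) := by
      gcongr
    _ = M * C * (m * c)⁻¹ * ((m * c) *
        ∫ s : sphere (0 : V) 1, ‖fderiv ℝ (fun x => F x / H x) s‖ ^ 2 ∂μ.toSphere) := by
      field_simp
    _ ≤ _ := by gcongr

/-- The trace identity `integral_sq_ctrace` as an expression for `∫ tr N²`. -/
lemma integral_ctrace_sq_eq (hd : 3 ≤ finrank ℝ V) {F : V → ℝ} (hF : ContDiffOn ℝ 2 F {0}ᶜ)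
    (hF1 : Hom1 F) :
    ∫ s : sphere (0 : V) 1, |(dbd H s).det| * ctrace
        ((hess F s ∘L Ring.inverse (dbd H s)) * (hess F s ∘L Ring.inverse (dbd H s)))
        ∂μ.toSphere = ∫ s : sphere (0 : V) 1, |(dbd H s).det| *
          (ctrace (hess F s ∘L Ring.inverse (dbd H s)) ^ 2 - ((finrank ℝ V : ℝ) - 2) *
            (F s / H s * ctrace (hess F s ∘L Ring.inverse (dbd H s)))) ∂μ.toSphere := by
  have hcN := continuous_sphere_of_continuousOn
    ((continuousOn_hess hF).clm_comp hH.continuousOn_inverse_dbd)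
  have hct := hH.continuous_ctrace hF
  have hcZ := hH.continuous_div hF
  have h7 := hH.integral_sq_ctrace (μ := μ) hd hF hF1
  have i1 : Integrable (fun s : sphere (0 : V) 1 => |(dbd H s).det| *
      ctrace (hess F s ∘L Ring.inverse (dbd H s)) ^ 2) μ.toSphere :=
    integrable_sphere (hH.continuous_abs_det.mul (hct.pow 2))
  have i2 : Integrable (fun s : sphere (0 : V) 1 => |(dbd H s).det| * ctrace
      ((hess F s ∘L Ring.inverse (dbd H s)) * (hess F s ∘L Ring.inverse (dbd H s))))
      μ.toSphere :=
    integrable_sphere (hH.continuous_abs_det.mul (ctrace.continuous.comp (hcN.mul hcN)))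
  have i3 : Integrable (fun s : sphere (0 : V) 1 => |(dbd H s).det| *
      (F s / H s * ctrace (hess F s ∘L Ring.inverse (dbd H s)))) μ.toSphere :=
    integrable_sphere (hH.continuous_abs_det.mul (hcZ.mul hct))
  simp only [mul_sub] at h7 ⊢
  rw [integral_sub i1 i2] at h7
  simp only [mul_left_comm |_| ((finrank ℝ V : ℝ) - 2)]
  rw [integral_sub i1 (i3.const_mul _), integral_const_mul]
  linarith

variable (μ) in
/-- Equality in the Alexandrov-Fenchel inequality forces `F` to be linear, quantitatively. -/
lemma exists_integral_sub_linear_le (hd : 3 ≤ finrank ℝ V) : ∃ C : ℝ, 0 ≤ C ∧ ∀ F : V → ℝ,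
    ContDiffOn ℝ 2 F {0}ᶜ → Hom1 F → ∃ a : V,
      ∫ s : sphere (0 : V) 1, |(dbd H s).det| * (F s / H s - ⟪(s : V), a⟫_ℝ / H s) ^ 2
          ∂μ.toSphere ≤
        C * ∫ s : sphere (0 : V) 1, |(dbd H s).det| *
          (ctrace (hess F s ∘L Ring.inverse (dbd H s)) ^ 2 - ((finrank ℝ V : ℝ) - 2) *
            (F s / H s * ctrace (hess F s ∘L Ring.inverse (dbd H s)))) ∂μ.toSphere := by
  obtain ⟨C, hC, hP⟩ := exists_poincare (μ := μ) (W := V) hd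
  obtain ⟨c, hc, hcD⟩ := hH.exists_le_ctrace_sq
  have hHs : ∀ s : sphere (0 : V) 1, 0 < H s := fun s => hH.pos _ (coe_sphere_ne_zero s)
  have hcg2 : Continuous fun s : sphere (0 : V) 1 => |(dbd H s).det| * (H s ^ 2)⁻¹ := by
    refine hH.continuous_abs_det.mul (Continuous.inv₀ ?_ fun s => pow_ne_zero 2 (hHs s).ne')
    exact hH.continuous_coe.pow 2
  obtain ⟨M, hM, hMs⟩ := exists_le_pos hcg2
  obtain ⟨m, hm, hms⟩ := exists_pos_le hH.continuous_abs_det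
    fun s => hH.abs_det_pos (coe_sphere_ne_zero s)
  have hd0 : (0 : ℝ) < finrank ℝ V := by
    have : 0 < finrank ℝ V := by omega
    exact_mod_cast this
  refine ⟨M * C * (m * c)⁻¹ * finrank ℝ V, by positivity, fun F hF hF1 => ?_⟩
  have hgr : ContDiffOn ℝ 1 (gradient F) {0}ᶜ := contDiffOn_gradient isOpen_compl_singleton hF
  obtain ⟨a, ha⟩ := hP _ hgr hF1.gradient
  refine ⟨a, ?_⟩
  have hcg := continuous_sphere_of_continuousOn hgr.continuousOn
  have hcH := continuous_sphere_of_continuousOn (continuousOn_hess hF)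
  have hcN := continuous_sphere_of_continuousOn
    ((continuousOn_hess hF).clm_comp hH.continuousOn_inverse_dbd)
  have hct := hH.continuous_ctrace hF
  have hcZ := hH.continuous_div hF
  have h1 : ∫ s : sphere (0 : V) 1, |(dbd H s).det| * (F s / H s - ⟪(s : V), a⟫_ℝ / H s) ^ 2
      ∂μ.toSphere ≤ M * ∫ s : sphere (0 : V) 1, ‖gradient F s - a‖ ^ 2 ∂μ.toSphere := by
    rw [← integral_const_mul]
    refine integral_mono (integrable_sphere (hH.continuous_abs_det.mul
      ((hcZ.sub (Continuous.div (Continuous.inner continuous_subtype_val continuous_const)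
        hH.continuous_coe fun s => (hHs s).ne')).pow 2)))
      ((integrable_sphere ((hcg.sub continuous_const).norm.pow 2)).const_mul _) fun s => ?_
    have h3 : F s / H s - ⟪(s : V), a⟫_ℝ / H s = ⟪gradient F s - a, s⟫_ℝ / H s := by
      rw [inner_sub_left, hF1.inner_gradient
        (differentiableAt_of_contDiffOn two_ne_zero hF (coe_sphere_ne_zero s)),
        real_inner_comm a, sub_div]
    have h4 : ⟪gradient F s - a, s⟫_ℝ ^ 2 ≤ ‖gradient F s - a‖ ^ 2 := by
      have := abs_real_inner_le_norm (gradient F s - a) s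
      rw [norm_coe_sphere, mul_one] at this
      rw [← sq_abs]
      gcongr
    simp only
    rw [h3, div_pow, div_eq_mul_inv, mul_comm (⟪gradient F s - a, s⟫_ℝ ^ 2), ← mul_assoc]
    exact mul_le_mul (hMs s) h4 (sq_nonneg _) hM.le
  have h2 : (m * c) * ∫ s : sphere (0 : V) 1, ‖hess F s‖ ^ 2 ∂μ.toSphere ≤
      finrank ℝ V * ∫ s : sphere (0 : V) 1, |(dbd H s).det| * ctrace
        ((hess F s ∘L Ring.inverse (dbd H s)) * (hess F s ∘L Ring.inverse (dbd H s)))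
        ∂μ.toSphere := by
    rw [← integral_const_mul, ← integral_const_mul]
    refine integral_mono ((integrable_sphere (hcH.norm.pow 2)).const_mul _)
      ((integrable_sphere (hH.continuous_abs_det.mul (ctrace.continuous.comp
        (hcN.mul hcN)))).const_mul _) fun s => ?_
    have hs := coe_sphere_ne_zero s
    have h5 := hcD s (hess F s) (norm_coe_sphere s) (IsotropicLp.hess_symm (contDiffAt_of_ne hF hs))
      (IsotropicLp.hess_self hF hF1 hs)
    have h6 := mul_le_mul (hms s) h5 (by positivity) (abs_nonneg _)
    simp only
    linarith
  have h8 := hH.integral_ctrace_sq_eq (μ := μ) hd hF hF1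
  rw [← h8]
  calc _ ≤ M * ∫ s : sphere (0 : V) 1, ‖gradient F s - a‖ ^ 2 ∂μ.toSphere := h1
    _ ≤ M * (C * ∫ s : sphere (0 : V) 1, ‖hess F s‖ ^ 2 ∂μ.toSphere) := by
      gcongr
    _ = M * C * (m * c)⁻¹ * ((m * c) *
        ∫ s : sphere (0 : V) 1, ‖hess F s‖ ^ 2 ∂μ.toSphere) := by
      field_simp
    _ ≤ M * C * (m * c)⁻¹ * (finrank ℝ V * ∫ s : sphere (0 : V) 1, |(dbd H s).det| * ctrace
        ((hess F s ∘L Ring.inverse (dbd H s)) * (hess F s ∘L Ring.inverse (dbd H s)))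
        ∂μ.toSphere) := by gcongr
    _ = _ := by ring

end IsRegSupport

end Forms

/-! ### The operator `L_K` and the cone-volume measure in Euclidean terms -/

section Link

variable {n : ℕ} [Nontrivial (E n)] {K : ConvexBody (E n)}

lemma mem_tan {x : S n} {v : E n} : v ∈ Tan x ↔ ⟪(x : E n), v⟫_ℝ = 0 :=
  Submodule.mem_orthogonal_singleton_iff_inner_right

lemma homExt_restrict {F : E n → ℝ} (hF : Hom1 F) : homExt (fun x : S n => F x) = F := by
  funext x
  rcases eq_or_ne x 0 with rfl | hx
  · rw [homExt, dif_pos rfl, hF.map_zero]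
  · have hn := norm_pos_iff.mpr hx
    rw [homExt, dif_neg hx]
    change ‖x‖ * F (‖x‖⁻¹ • x) = F x
    rw [hF (inv_pos.mpr hn), smul_eq_mul, mul_inv_cancel_left₀ hn.ne']

lemma homExt_mul (f g : S n → ℝ) {x : E n} (hx : x ≠ 0) :
    homExt (f * g) x = homExt f x * ‖x‖⁻¹ * homExt g x := by
  have hn := norm_pos_iff.mpr hx
  simp only [homExt, dif_neg hx, Pi.mul_apply]
  field_simp

lemma contDiffOn_norm_inv {k : WithTop ℕ∞} : ContDiffOn ℝ k (fun x : E n => ‖x‖⁻¹) {0}ᶜ :=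
  ContDiffOn.inv (fun _ hx => (contDiffAt_norm ℝ hx).contDiffWithinAt)
    fun _ hx => norm_ne_zero_iff.mpr hx

lemma IsC2.mul {f g : S n → ℝ} (hf : IsC2 f) (hg : IsC2 g) : IsC2 (f * g) :=
  ((ContDiffOn.mul hf contDiffOn_norm_inv).mul hg).congr fun _ hx => homExt_mul f g hx

variable (hH : IsRegSupport (homExt (supp K)))
include hH

lemma supp_pos (x : S n) : 0 < supp K x := by
  rw [← homExt_coe (supp K) x]; exact hH.pos _ (sphere_ne_zero x)

/-- The determinant of `D Ψ`, where `Ψ = bdMap (homExt h)`, splits into the radial factor `h` and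
the tangential one. -/
lemma det_dbd (x : S n) :
    (dbd (homExt (supp K)) x).det = supp K x * LinearMap.det (D2 (supp K) x) := by
  set H := homExt (supp K)
  have hx := sphere_ne_zero x
  have hx1 : ‖(x : E n)‖ = 1 := norm_coe_sphere x
  have hinn : ∀ v, ⟪(x : E n), dbd H x v⟫_ℝ = ⟪(x : E n), v⟫_ℝ * H x := fun v => by
    rw [hH.inner_dbd hx, hx1, inv_one, one_mul]
  have he : Tan x ≤ (Tan x).comap (dbd H x : E n →ₗ[ℝ] E n) := fun v hv => by
    rw [Submodule.mem_comap, mem_tan]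
    exact (hinn v).trans (by rw [mem_tan.mp hv, zero_mul])
  have h1 : ((dbd H x : E n →ₗ[ℝ] E n).restrict he) = D2 (supp K) x := by
    refine LinearMap.ext fun v => Subtype.ext ?_
    have hv := mem_tan.mp v.2
    rw [LinearMap.coe_restrict_apply, coe_D2 hH.smooth]
    change dbd H x v = _
    rw [dbd_apply, hv, hx1, mul_zero, zero_smul, zero_add, one_smul]
  have h2 : (Tan x).mapQ (Tan x) (dbd H x : E n →ₗ[ℝ] E n) he = H x • LinearMap.id := by
    ext v
    simp only [LinearMap.comp_apply, Submodule.mkQ_apply, Submodule.mapQ_apply,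
      LinearMap.smul_apply, LinearMap.id_apply]
    rw [← Submodule.Quotient.mk_smul, Submodule.Quotient.eq, mem_tan, inner_sub_right,
      inner_smul_right]
    change ⟪(x : E n), dbd H x v⟫_ℝ - _ = 0
    rw [hinn]; ring
  have h3 : finrank ℝ (E n ⧸ Tan x) = 1 := by
    have h4 := (Tan x).finrank_quotient_add_finrank
    have h5 := Submodule.finrank_add_finrank_orthogonal (ℝ ∙ (x : E n))
    rw [finrank_span_singleton hx] at h5
    have h6 : finrank ℝ (Tan x) = finrank ℝ (ℝ ∙ (x : E n))ᗮ := rfl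
    omega
  have h4 := LinearMap.det_eq_det_mul_det (Tan x) (dbd H x : E n →ₗ[ℝ] E n) he
  rw [h1, h2, LinearMap.det_smul, h3, LinearMap.det_id, show H x = supp K x from homExt_coe _ x] at h4
  rw [ContinuousLinearMap.det, h4]
  ring

/-- Both traces can be taken on the tangent space, where `D Ψ` is `D² h`. -/
lemma trace_D2 {f : S n → ℝ} (hf : IsC2 f) (x : S n) :
    LinearMap.trace ℝ (Tan x) (Ring.inverse (D2 (supp K) x) * D2 f x) =
      ctrace (hess (homExt f) x ∘L Ring.inverse (dbd (homExt (supp K)) x)) := by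
  set H := homExt (supp K)
  have hx := sphere_ne_zero x
  have hx1 : ‖(x : E n)‖ = 1 := norm_coe_sphere x
  set D := Ring.inverse (dbd H x)
  have hmem : ∀ v, (hess (homExt f) x ∘L D : E n →ₗ[ℝ] E n) v ∈ Tan x := fun v => by
    rw [mem_tan]
    change ⟪(x : E n), hess (homExt f) x (D v)⟫_ℝ = 0
    rw [← hess_symm (contDiffAt_of_ne hf hx), hess_self hf (homExt_hom1 f) hx, inner_zero_left]
  have hu : IsUnit (D2 (supp K) x) := by
    rw [LinearMap.isUnit_iff_isUnit_det, isUnit_iff_ne_zero]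
    intro h0
    have h1 := hH.abs_det_pos hx
    rw [det_dbd hH, h0, mul_zero, abs_zero] at h1
    exact lt_irrefl _ h1
  have hinv : ∀ v : Tan x, ((Ring.inverse (D2 (supp K) x) v : Tan x) : E n) = D v := fun v => by
    set w := Ring.inverse (D2 (supp K) x) v with hw
    have h1 : D2 (supp K) x w = v :=
      LinearMap.congr_fun (Ring.mul_inverse_cancel _ hu) v
    have h2 : dbd H x w = v := by
      rw [← h1, coe_D2 hH.smooth, dbd_apply, mem_tan.mp w.2, hx1, mul_zero, zero_smul, zero_add,
        one_smul]
    rw [← h2, hH.inverse_dbd hx]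
  rw [ctrace_apply, ← LinearMap.trace_restrict_eq_of_forall_mem (Tan x) _ hmem,
    LinearMap.trace_mul_comm]
  congr 1
  refine LinearMap.ext fun v => Subtype.ext ?_
  rw [LinearMap.coe_restrict_apply, Module.End.mul_apply, coe_D2 hf, hinv]
  rfl

lemma hbm_eq {z : S n → ℝ} (hz : IsC2 z) (x : S n) :
    hbm K z x = 1 / ((n : ℝ) - 1) *
      ctrace (hess (homExt (z * supp K)) x ∘L Ring.inverse (dbd (homExt (supp K)) x)) - z x := by
  rw [hbm, trace_D2 hH (hz.mul hH.smooth)]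

variable (hdet : ∀ x : S n, 0 < LinearMap.det (D2 (supp K) x))
include hdet

lemma coneVolume_eq : coneVolume K = (n : ℝ≥0∞)⁻¹ • (volume : Measure (E n)).toSphere.withDensity
    fun x => ENNReal.ofReal |(dbd (homExt (supp K)) x).det| := by
  rw [coneVolume, lpSurfaceArea]
  congr 2
  funext x
  rw [det_dbd hH, abs_of_pos (mul_pos (supp_pos hH x) (hdet x)), sub_zero, Real.rpow_one]

lemma integral_coneVolume (g : S n → ℝ) : ∫ x, g x ∂coneVolume K = (n : ℝ)⁻¹ *
    ∫ x : S n, |(dbd (homExt (supp K)) x).det| * g x ∂(volume : Measure (E n)).toSphere := by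
  rw [coneVolume_eq hH hdet, integral_smul_measure, integral_withDensity_eq_integral_toReal_smul
    (hH.continuous_abs_det.measurable.ennreal_ofReal)
    (Filter.Eventually.of_forall fun x => ENNReal.ofReal_lt_top)]
  simp [ENNReal.toReal_ofReal (abs_nonneg _)]

lemma isFiniteMeasure_coneVolume (hn : n ≠ 0) :
    IsFiniteMeasure (coneVolume K) := by
  rw [coneVolume_eq hH hdet]
  have := isFiniteMeasure_withDensity_ofReal (μ := (volume : Measure (E n)).toSphere)
    (f := fun x : S n => |(dbd (homExt (supp K)) x).det|)
    (integrable_sphere hH.continuous_abs_det).2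
  exact Measure.smul_finite _ (ENNReal.inv_ne_top.mpr (by exact_mod_cast hn))

end Link

/-! ### The closure of `-L_K` -/

section Graph

variable {V : Type*} [NormedAddCommGroup V] [InnerProductSpace ℝ V] [FiniteDimensional ℝ V]
  [Nontrivial V] [MeasurableSpace V] [BorelSpace V]

variable (V) in
/-- The `1`-homogeneous functions that are `C²` away from the origin. Through `F = z H` they
correspond to the functions `z ∈ C²` on the sphere. -/
def c2Hom : Submodule ℝ (V → ℝ) where
  carrier := {F | ContDiffOn ℝ 2 F {0}ᶜ ∧ Hom1 F}
  add_mem' := fun hF hG => ⟨hF.1.add hG.1, fun t ht x => by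
    simp only [Pi.add_apply, hF.2 ht, hG.2 ht, smul_add]⟩
  zero_mem' := ⟨contDiffOn_const, fun t _ x => by simp⟩
  smul_mem' := fun c F hF => ⟨contDiffOn_const.mul hF.1, fun t ht x => by
    simp only [Pi.smul_apply, hF.2 ht, smul_eq_mul]; ring⟩

variable {H : V → ℝ} (hH : IsRegSupport H)

/-- The function `F / H` on the sphere. -/
def quotMap : c2Hom V →ₗ[ℝ] C(sphere (0 : V) 1, ℝ) where
  toFun F := ⟨fun s => F.1 s / H s, hH.continuous_div F.2.1⟩
  map_add' F G := by ext s; exact add_div _ _ _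
  map_smul' c F := by ext s; exact mul_div_assoc _ _ _

/-- The function `-L_K (F / H)` on the sphere. -/
def opMap : c2Hom V →ₗ[ℝ] C(sphere (0 : V) 1, ℝ) where
  toFun F := ⟨fun s => F.1 s / H s - 1 / ((finrank ℝ V : ℝ) - 1) *
      ctrace (hess F.1 s ∘L Ring.inverse (dbd H s)),
    (hH.continuous_div F.2.1).sub (continuous_const.mul (hH.continuous_ctrace F.2.1))⟩
  map_add' F G := by
    ext s
    have h : hess (F + G).1 (s : V) = hess F.1 s + hess G.1 s :=
      hess_add F.2.1 G.2.1 (coe_sphere_ne_zero s)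
    simp only [ContinuousMap.coe_mk, ContinuousMap.add_apply, h, ContinuousLinearMap.add_comp,
      map_add]
    change (F.1 s + G.1 s) / H s - _ = _
    ring
  map_smul' c F := by
    ext s
    have h : hess (c • F).1 (s : V) = c • hess F.1 s :=
      hess_const_mul c F.2.1 (coe_sphere_ne_zero s)
    simp only [ContinuousMap.coe_mk, ContinuousMap.smul_apply, h, ContinuousLinearMap.smul_comp,
      map_smul, smul_eq_mul, RingHom.id_apply]
    change c * F.1 s / H s - _ = _
    ring

lemma quotMap_apply (F : c2Hom V) (s : sphere (0 : V) 1) : quotMap hH F s = F.1 s / H s := rfl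

lemma opMap_apply (hd : 2 ≤ finrank ℝ V) (F : c2Hom V) (s : sphere (0 : V) 1) :
    ((finrank ℝ V : ℝ) - 1) * opMap hH F s = ((finrank ℝ V : ℝ) - 1) * (F.1 s / H s) -
      ctrace (hess F.1 s ∘L Ring.inverse (dbd H s)) := by
  have : (2 : ℝ) ≤ finrank ℝ V := by exact_mod_cast hd
  have h : (finrank ℝ V : ℝ) - 1 ≠ 0 := by linarith
  change _ * (F.1 s / H s - _) = _
  field_simp

/-- The linear functional `⟪·, w⟫` as an element of `c2Hom`; it is the support function of a point,
whose quotient by `H` spans the eigenspace of the eigenvalue `1`. -/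
def linHom : V →ₗ[ℝ] c2Hom V where
  toFun w := ⟨fun x => ⟪x, w⟫_ℝ, (contDiff_id.inner ℝ contDiff_const).contDiffOn, fun t _ x => by
    simp [inner_smul_left]⟩
  map_add' v w := by ext x; exact inner_add_right _ _ _
  map_smul' c w := by ext x; exact inner_smul_right _ _ _

lemma opMap_linHom (w : V) : opMap hH (linHom w) = quotMap hH (linHom w) := by
  ext s
  have h : hess (linHom w : c2Hom V).1 (s : V) = 0 := by
    have : gradient (linHom w : c2Hom V).1 = fun _ => w := funext fun x => gradient_inner_const w x
    rw [hess, this, fderiv_fun_const]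
    rfl
  change _ - 1 / ((finrank ℝ V : ℝ) - 1) *
    ctrace (hess (linHom w : c2Hom V).1 s ∘L Ring.inverse (dbd H s)) = _
  rw [h, ContinuousLinearMap.zero_comp, map_zero, mul_zero, sub_zero]
  rfl

/-- The function `H` itself as an element of `c2Hom`. -/
def selfHom : c2Hom V := ⟨H, hH.smooth, hH.hom⟩

lemma quotMap_selfHom : quotMap hH (selfHom hH) = 1 := by
  ext s
  exact div_self (hH.pos _ (coe_sphere_ne_zero s)).ne'

lemma opMap_selfHom (hd : 2 ≤ finrank ℝ V) : opMap hH (selfHom hH) = 0 := by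
  ext s
  have hs := coe_sphere_ne_zero s
  have h2 : (2 : ℝ) ≤ finrank ℝ V := by exact_mod_cast hd
  have h1 := opMap_apply hH hd (selfHom hH) s
  have h3 : hess H s ∘L Ring.inverse (dbd H s) =
      1 - ((H s)⁻¹ • innerSL ℝ (s : V)).smulRight (gradient H s) := by
    ext v
    change hess H s (Ring.inverse (dbd H s) v) = v - ((H s)⁻¹ * ⟪(s : V), v⟫_ℝ) • gradient H s
    rw [hH.hess_inverse_dbd_eq (norm_coe_sphere s), div_eq_inv_mul]
  change _ = _ * (H s / H s) - ctrace (hess H s ∘L Ring.inverse (dbd H s)) at h1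
  rw [h3, map_sub, ctrace_smulRight, div_self (hH.pos _ hs).ne', ctrace_apply] at h1
  have h4 : LinearMap.trace ℝ V ((1 : V →L[ℝ] V) : V →ₗ[ℝ] V) = finrank ℝ V :=
    LinearMap.trace_one ℝ V
  have h5 : ((H s)⁻¹ • innerSL ℝ (s : V)) (gradient H s) = 1 := by
    change (H s)⁻¹ * ⟪(s : V), gradient H s⟫_ℝ = 1
    rw [real_inner_comm, hH.inner_gradient hs, inv_mul_cancel₀ (hH.pos _ hs).ne']
  rw [h4, h5] at h1
  have h6 : ((finrank ℝ V : ℝ) - 1) * opMap hH (selfHom hH) s = 0 := by linarith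
  exact (mul_eq_zero.mp h6).resolve_left (by linarith)

end Graph

section Closure

variable {n : ℕ} [Nontrivial (E n)] {K : ConvexBody (E n)}
  (hH : IsRegSupport (homExt (supp K)))
  (hdet : ∀ x : S n, 0 < LinearMap.det (D2 (supp K) x)) [IsFiniteMeasure (coneVolume K)]

/-- The inclusion of `C(S^{n-1})` into `L²(V_K)`. -/
abbrev toL2 (K : ConvexBody (E n)) [IsFiniteMeasure (coneVolume K)] :
    C(S n, ℝ) →L[ℝ] Lp ℝ 2 (coneVolume K) := ContinuousMap.toLp 2 (coneVolume K) ℝ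

/-- The graph of `-L_K` on `C²(S^{n-1})`. -/
def graphC2 : Submodule ℝ (Lp ℝ 2 (coneVolume K) × Lp ℝ 2 (coneVolume K)) :=
  LinearMap.range (((toL2 K : C(S n, ℝ) →ₗ[ℝ] _) ∘ₗ quotMap hH).prod
    ((toL2 K : C(S n, ℝ) →ₗ[ℝ] _) ∘ₗ opMap hH))

lemma mem_graphC2 {q : Lp ℝ 2 (coneVolume K) × Lp ℝ 2 (coneVolume K)} :
    q ∈ graphC2 hH ↔ ∃ F, q = (toL2 K (quotMap hH F), toL2 K (opMap hH F)) :=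
  ⟨fun ⟨F, hF⟩ => ⟨F, hF.symm⟩, fun ⟨F, hF⟩ => ⟨F, hF.symm⟩⟩

lemma graphC2_eq : (graphC2 hH : Set _) = negHbmGraph K := by
  have hsupp : ∀ x : S n, homExt (supp K) x ≠ 0 := fun x => (hH.pos _ (sphere_ne_zero x)).ne'
  ext q
  rw [SetLike.mem_coe, mem_graphC2]
  constructor
  · rintro ⟨F, rfl⟩
    set z : S n → ℝ := fun x => F.1 x / homExt (supp K) x with hz
    have hmul : homExt (z * supp K) = F.1 := by
      rw [← homExt_restrict F.2.2]
      congr 1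
      funext x
      rw [Pi.mul_apply, ← homExt_coe (supp K) x, hz]
      exact div_mul_cancel₀ _ (hsupp x)
    have hzC : IsC2 z := by
      refine (F.2.1.mul ((contDiff_norm_sq ℝ).contDiffOn.mul (contDiffOn_norm_inv.mul
        (hH.smooth.inv fun x hx => (hH.pos x hx).ne')))).congr fun x hx => ?_
      have h1 : homExt (z * supp K) x = _ := homExt_mul z (supp K) hx
      have hn : ‖x‖ ≠ 0 := norm_ne_zero_iff.mpr hx
      have hp := (hH.pos x hx).ne'
      rw [hmul] at h1
      rw [h1, Pi.inv_apply]
      field_simp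
    refine ⟨z, hzC, ContinuousMap.coeFn_toLp _ _, ?_⟩
    filter_upwards [ContinuousMap.coeFn_toLp (p := 2) (𝕜 := ℝ) (coneVolume K) (opMap hH F)]
      with x hx
    rw [hx, hbm_eq hH hzC, hmul]
    change F.1 x / homExt (supp K) x - 1 / ((finrank ℝ (E n) : ℝ) - 1) * _ = _
    rw [finrank_euclideanSpace_fin, hz]
    ring
  · rintro ⟨z, hz, h1, h2⟩
    have hC : IsC2 (z * supp K) := hz.mul hH.smooth
    refine ⟨⟨homExt (z * supp K), hC, homExt_hom1 _⟩, ?_⟩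
    have hq : ∀ x : S n, homExt (z * supp K) x / homExt (supp K) x = z x := fun x => by
      rw [homExt_coe, Pi.mul_apply, homExt_coe (supp K) x]
      exact mul_div_cancel_right₀ _ (by rw [← homExt_coe (supp K) x]; exact hsupp x)
    refine Prod.ext (Lp.ext ?_) (Lp.ext ?_)
    · refine h1.trans (Filter.EventuallyEq.symm
        ((ContinuousMap.coeFn_toLp _ _).trans (Filter.Eventually.of_forall fun x => hq x)))
    · refine h2.trans (Filter.EventuallyEq.symm
        ((ContinuousMap.coeFn_toLp _ _).trans (Filter.Eventually.of_forall fun x => ?_)))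
      change homExt (z * supp K) x / homExt (supp K) x - 1 / ((finrank ℝ (E n) : ℝ) - 1) * _ =
        -hbm K z x
      rw [hbm_eq hH hz, hq, finrank_euclideanSpace_fin]
      ring

/-- The graph of the closure of `-L_K`. -/
def graphClosure : Submodule ℝ (Lp ℝ 2 (coneVolume K) × Lp ℝ 2 (coneVolume K)) :=
  (graphC2 hH).topologicalClosure

lemma relSpectrum_graphClosure :
    relSpectrum (graphClosure hH : Set (Lp ℝ 2 (coneVolume K) × Lp ℝ 2 (coneVolume K))) =
      negHbmSpectrum K := by
  rw [relSpectrum, graphClosure, Submodule.topologicalClosure_coe, graphC2_eq]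
  rfl

lemma mem_graphClosure (F : c2Hom (E n)) :
    (toL2 K (quotMap hH F), toL2 K (opMap hH F)) ∈ graphClosure hH :=
  Submodule.le_topologicalClosure _ ((mem_graphC2 hH).mpr ⟨F, rfl⟩)

include hH hdet in
lemma inner_toL2 (f g : C(S n, ℝ)) : ⟪toL2 K f, toL2 K g⟫_ℝ = (n : ℝ)⁻¹ *
    ∫ x : S n, |(dbd (homExt (supp K)) x).det| * (f x * g x)
      ∂(volume : Measure (E n)).toSphere := by
  rw [ContinuousMap.inner_toLp, integral_coneVolume hH hdet]
  simp only [RCLike.conj_to_real, mul_comm (f _)]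

include hH hdet in
lemma inner_quotMap_opMap (hn : 2 ≤ n) (F G : c2Hom (E n)) :
    ⟪toL2 K (quotMap hH F), toL2 K (opMap hH G)⟫_ℝ = ((n : ℝ) * (n - 1))⁻¹ *
      ∫ x : S n, |(dbd (homExt (supp K)) x).det| *
        fderiv ℝ (fun y => F.1 y / homExt (supp K) y) x
          (Ring.inverse (dbd (homExt (supp K)) x) (gradient G.1 x))
      ∂(volume : Measure (E n)).toSphere := by
  have h2 : (2 : ℝ) ≤ n := by exact_mod_cast hn
  have hd : 2 ≤ finrank ℝ (E n) := by rwa [finrank_euclideanSpace_fin]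
  rw [inner_toL2 hH hdet, ← hH.integral_mul_eq hd
    (hH.contDiffOn_div_self (by norm_num) F.2.1) (hH.hom0_div_self F.2.2) G.2.1 G.2.2, mul_inv,
    mul_assoc, ← integral_const_mul ((n : ℝ) - 1)⁻¹]
  congr 2
  funext x
  rw [← opMap_apply hH hd, quotMap_apply, finrank_euclideanSpace_fin]
  have : (n : ℝ) - 1 ≠ 0 := by linarith
  field_simp

lemma graphClosure_induction {p : Lp ℝ 2 (coneVolume K) × Lp ℝ 2 (coneVolume K) → Prop}
    (hp : IsClosed {q | p q}) (h : ∀ F, p (toL2 K (quotMap hH F), toL2 K (opMap hH F)))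
    {q : Lp ℝ 2 (coneVolume K) × Lp ℝ 2 (coneVolume K)} (hq : q ∈ graphClosure hH) : p q := by
  have h1 : q ∈ closure (graphC2 hH : Set (Lp ℝ 2 (coneVolume K) × Lp ℝ 2 (coneVolume K))) := by
    rw [← Submodule.topologicalClosure_coe]; exact hq
  refine closure_minimal (fun r hr => ?_) hp h1
  obtain ⟨F, rfl⟩ := (mem_graphC2 hH).mp hr
  exact h F

include hH hdet in
/-- The closure of `-L_K` is symmetric and nonnegative. -/
theorem isClosedSymm_graphClosure (hn : 2 ≤ n) : IsClosedSymm (graphClosure hH) := by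
  have h2 : (2 : ℝ) ≤ n := by exact_mod_cast hn
  refine ⟨Submodule.isClosed_topologicalClosure _, fun q hq r hr => ?_, fun q hq => ?_⟩
  · refine graphClosure_induction hH (p := fun q => ⟪q.2, r.1⟫_ℝ = ⟪q.1, r.2⟫_ℝ)
      (isClosed_eq (by fun_prop) (by fun_prop)) (fun F => ?_) hq
    refine graphClosure_induction hH (p := fun r => ⟪toL2 K (opMap hH F), r.1⟫_ℝ =
      ⟪toL2 K (quotMap hH F), r.2⟫_ℝ) (isClosed_eq (by fun_prop) (by fun_prop)) (fun G => ?_) hr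
    rw [real_inner_comm]
    simp only [inner_quotMap_opMap hH hdet hn]
    congr 2
    funext x
    rw [hH.fderiv_div_symm F.2.1 F.2.2 G.2.1 G.2.2 (norm_coe_sphere x)]
  · refine graphClosure_induction hH (p := fun q => 0 ≤ ⟪q.2, q.1⟫_ℝ)
      (isClosed_le (by fun_prop) (by fun_prop)) (fun F => ?_) hq
    rw [real_inner_comm]
    simp only [inner_quotMap_opMap hH hdet hn]
    have : 0 ≤ (n : ℝ) - 1 := by linarith
    exact mul_nonneg (by positivity) (integral_nonneg fun x => mul_nonneg (abs_nonneg _)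
      (hH.fderiv_div_nonneg F.2.1 F.2.2 (norm_coe_sphere x)))

/-- If a continuous function of the pairs `(z, -L_K z)` with `z` of class `C²` bounds the squared
distance of `z` to a finite-dimensional space `Y`, then the pairs of the closure at which it
vanishes have their first component in `Y`. -/
lemma mem_of_norm_sub_sq_le {Y : Submodule ℝ (Lp ℝ 2 (coneVolume K))} [FiniteDimensional ℝ Y]
    {g : Lp ℝ 2 (coneVolume K) × Lp ℝ 2 (coneVolume K) → ℝ} (hg : Continuous g)
    (h : ∀ F, ∃ y ∈ Y, ‖toL2 K (quotMap hH F) - y‖ ^ 2 ≤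
      g (toL2 K (quotMap hH F), toL2 K (opMap hH F)))
    {q : Lp ℝ 2 (coneVolume K) × Lp ℝ 2 (coneVolume K)} (hq : q ∈ graphClosure hH)
    (hq0 : g q = 0) : q.1 ∈ Y := by
  have h1 : infDist q.1 (Y : Set (Lp ℝ 2 (coneVolume K))) ^ 2 ≤ g q := by
    refine graphClosure_induction hH (p := fun q => infDist q.1 (Y : Set _) ^ 2 ≤ g q)
      (isClosed_le (((continuous_infDist_pt _).comp continuous_fst).pow 2) hg) (fun F => ?_) hq
    obtain ⟨y, hy, hle⟩ := h F
    refine le_trans ?_ hle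
    rw [← dist_eq_norm]
    exact pow_le_pow_left₀ infDist_nonneg (infDist_le_dist_of_mem hy) 2
  rw [hq0] at h1
  have h2 : infDist q.1 (Y : Set (Lp ℝ 2 (coneVolume K))) = 0 :=
    pow_eq_zero_iff two_ne_zero |>.mp (le_antisymm h1 (sq_nonneg _))
  have h3 := (Y.closed_of_finiteDimensional.mem_iff_infDist_zero ⟨0, Y.zero_mem⟩).mpr h2
  exact h3

include hH hdet in
/-- The kernel of the closure of `-L_K` consists of the constants. -/
theorem exists_smul_of_mem_zero (hn : 3 ≤ n) {e : Lp ℝ 2 (coneVolume K)}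
    (he : (e, (0 : Lp ℝ 2 (coneVolume K))) ∈ graphClosure hH) : ∃ a : ℝ, e = a • toL2 K 1 := by
  have hd : 3 ≤ finrank ℝ (E n) := by rwa [finrank_euclideanSpace_fin]
  obtain ⟨C, hC, hP⟩ := hH.exists_integral_sub_const_le (volume : Measure (E n)) hd
  have hmem := mem_of_norm_sub_sq_le hH (Y := ℝ ∙ toL2 K 1)
    (g := fun q => C * (n - 1) * ⟪q.1, q.2⟫_ℝ) (by fun_prop) (fun F => ?_) he (by simp)
  · obtain ⟨a, ha⟩ := Submodule.mem_span_singleton.mp hmem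
    exact ⟨a, ha.symm⟩
  · obtain ⟨a, ha⟩ := hP F.1 F.2.1 F.2.2
    refine ⟨a • toL2 K 1, Submodule.smul_mem _ _ (Submodule.mem_span_singleton_self _), ?_⟩
    rw [← map_smul, ← map_sub, ← real_inner_self_eq_norm_sq, inner_toL2 hH hdet,
      inner_toL2 hH hdet]
    have h1 : ∀ x : S n, (quotMap hH F - a • 1) x * (quotMap hH F - a • 1) x =
        (F.1 x / homExt (supp K) x - a) ^ 2 := fun x => by
      rw [ContinuousMap.sub_apply, ContinuousMap.smul_apply, ContinuousMap.one_apply,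
        quotMap_apply, smul_eq_mul]
      ring
    simp only [h1]
    have h2 : ∀ x : S n, F.1 x / homExt (supp K) x * (((finrank ℝ (E n) : ℝ) - 1) *
        (F.1 x / homExt (supp K) x) - ctrace (hess F.1 x ∘L
          Ring.inverse (dbd (homExt (supp K)) x))) =
        (n - 1) * (quotMap hH F x * opMap hH F x) := fun x => by
      rw [← opMap_apply hH (by omega), quotMap_apply, finrank_euclideanSpace_fin]
      ring
    simp only [h2, mul_left_comm |_| ((n : ℝ) - 1)] at ha
    rw [integral_const_mul] at ha
    have := mul_le_mul_of_nonneg_left ha (inv_nonneg.mpr (Nat.cast_nonneg (α := ℝ) n))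
    linarith

include hH hdet in
/-- The eigenfunctions of the closure of `-L_K` for the eigenvalue `1` are the quotients of linear
functions by `h_K`. -/
theorem exists_linHom_of_mem_one (hn : 3 ≤ n) {e : Lp ℝ 2 (coneVolume K)}
    (he : (e, e) ∈ graphClosure hH) : ∃ w : E n, e = toL2 K (quotMap hH (linHom w)) := by
  have hd : 3 ≤ finrank ℝ (E n) := by rwa [finrank_euclideanSpace_fin]
  obtain ⟨C, hC, hP⟩ := hH.exists_integral_sub_linear_le (volume : Measure (E n)) hd
  set T : E n →ₗ[ℝ] Lp ℝ 2 (coneVolume K) :=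
    (toL2 K : C(S n, ℝ) →ₗ[ℝ] _) ∘ₗ quotMap hH ∘ₗ linHom with hT
  have hmem := mem_of_norm_sub_sq_le hH (Y := LinearMap.range T)
    (g := fun q => C * ((n - 1) ^ 2 * ⟪q.1 - q.2, q.1 - q.2⟫_ℝ - (n - 2) * (n - 1) *
      ⟪q.1, q.1 - q.2⟫_ℝ)) (by fun_prop) (fun F => ?_) he (by simp)
  · obtain ⟨w, hw⟩ := hmem
    exact ⟨w, hw.symm⟩
  · obtain ⟨w, hw⟩ := hP F.1 F.2.1 F.2.2
    refine ⟨toL2 K (quotMap hH (linHom w)), ⟨w, rfl⟩, ?_⟩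
    simp only
    rw [← map_sub (toL2 K), ← map_sub (toL2 K), ← real_inner_self_eq_norm_sq, inner_toL2 hH hdet,
      inner_toL2 hH hdet, inner_toL2 hH hdet]
    set f := quotMap hH F
    set g := opMap hH F
    have h1 : ∀ x : S n, (f - quotMap hH (linHom w)) x * (f - quotMap hH (linHom w)) x =
        (F.1 x / homExt (supp K) x - ⟪(x : E n), w⟫_ℝ / homExt (supp K) x) ^ 2 := fun x => by
      rw [sq]; rfl
    simp only [h1]
    have h2 : ∀ x : S n, ctrace (hess F.1 x ∘L Ring.inverse (dbd (homExt (supp K)) x)) =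
        (n - 1) * ((f - g) x) := fun x => by
      have := opMap_apply hH (by omega) F x
      rw [finrank_euclideanSpace_fin] at this
      change _ = (n - 1 : ℝ) * (F.1 x / homExt (supp K) x - opMap hH F x)
      linarith
    have hcd := hH.continuous_abs_det
    have i1 : Integrable (fun x : S n => |(dbd (homExt (supp K)) x).det| *
        ((f - g) x * (f - g) x)) (volume : Measure (E n)).toSphere :=
      integrable_sphere (hcd.mul ((f - g).continuous.mul (f - g).continuous))
    have i2 : Integrable (fun x : S n => |(dbd (homExt (supp K)) x).det| *
        (f x * (f - g) x)) (volume : Measure (E n)).toSphere :=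
      integrable_sphere (hcd.mul (f.continuous.mul (f - g).continuous))
    have h3 : ∀ x : S n, |(dbd (homExt (supp K)) x).det| *
          (ctrace (hess F.1 x ∘L Ring.inverse (dbd (homExt (supp K)) x)) ^ 2 -
          ((finrank ℝ (E n) : ℝ) - 2) * (F.1 x / homExt (supp K) x *
            ctrace (hess F.1 x ∘L Ring.inverse (dbd (homExt (supp K)) x)))) =
        ((n : ℝ) - 1) ^ 2 * (|(dbd (homExt (supp K)) x).det| * ((f - g) x * (f - g) x)) -
        ((n : ℝ) - 2) * (n - 1) * (|(dbd (homExt (supp K)) x).det| * (f x * (f - g) x)) :=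
      fun x => by
        rw [h2, finrank_euclideanSpace_fin, show F.1 x / homExt (supp K) x = f x from rfl]
        ring
    simp only [h3] at hw
    rw [integral_sub (i1.const_mul _) (i2.const_mul _), integral_const_mul,
      integral_const_mul] at hw
    have := mul_le_mul_of_nonneg_left hw (inv_nonneg.mpr (Nat.cast_nonneg (α := ℝ) n))
    linarith

include hH hdet in
lemma toL2_ne_zero (hn : n ≠ 0) {f : C(S n, ℝ)} (hf : f ≠ 0) : toL2 K f ≠ 0 := by
  intro h
  have h1 := inner_toL2 hH hdet f f
  rw [h, inner_zero_left] at h1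
  have h2 := (mul_eq_zero.mp h1.symm).resolve_left
    (inv_ne_zero (by exact_mod_cast hn))
  have hc : Continuous fun x : S n => |(dbd (homExt (supp K)) x).det| * (f x * f x) :=
    hH.continuous_abs_det.mul (f.continuous.mul f.continuous)
  obtain ⟨x, hx⟩ : ∃ x, f x ≠ 0 := by
    by_contra hcon
    push Not at hcon
    exact hf (ContinuousMap.ext hcon)
  have h3 := hc.integral_pos_of_hasCompactSupport_nonneg_nonzero
    (μ := (volume : Measure (E n)).toSphere) (x := x) (HasCompactSupport.of_compactSpace _)
    (fun x => mul_nonneg (abs_nonneg _) (mul_self_nonneg _))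
    (mul_ne_zero (hH.abs_det_pos (sphere_ne_zero x)).ne' (mul_self_ne_zero.mpr hx))
  exact h3.ne' h2

lemma mem_negHbmSpectrum {e : Lp ℝ 2 (coneVolume K)} (he : e ≠ 0) {t : ℝ}
    (h : (e, t • e) ∈ graphClosure hH) : t ∈ negHbmSpectrum K := by
  rw [← relSpectrum_graphClosure hH]
  intro hcon
  obtain ⟨q, -, hq⟩ := hcon 0
  have h1 := hq (e, t • e) ⟨h, sub_self _⟩
  have h2 := hq 0 ⟨(graphClosure hH).zero_mem, by simp⟩
  exact he (congrArg Prod.fst (h1.trans h2.symm))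

include hH hdet in
lemma zero_mem_negHbmSpectrum (hn : 3 ≤ n) : (0 : ℝ) ∈ negHbmSpectrum K := by
  have : Nonempty (S n) := (NormedSpace.sphere_nonempty.mpr zero_le_one).to_subtype
  refine mem_negHbmSpectrum hH (toL2_ne_zero hH hdet (by omega) (one_ne_zero (α := C(S n, ℝ)))) ?_
  have h := mem_graphClosure hH (selfHom hH)
  rw [quotMap_selfHom, opMap_selfHom hH (by rw [finrank_euclideanSpace_fin]; omega), map_zero] at h
  rwa [zero_smul]

include hH hdet in
lemma one_mem_negHbmSpectrum (hn : 3 ≤ n) : (1 : ℝ) ∈ negHbmSpectrum K := by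
  obtain ⟨x⟩ : Nonempty (S n) := (NormedSpace.sphere_nonempty.mpr zero_le_one).to_subtype
  refine mem_negHbmSpectrum hH (toL2_ne_zero hH hdet (by omega)
    (f := quotMap hH (linHom (x : E n))) fun h0 => ?_) ?_
  · have h1 := DFunLike.congr_fun h0 x
    change ⟪(x : E n), (x : E n)⟫_ℝ / homExt (supp K) x = 0 at h1
    rw [real_inner_self_eq_norm_sq, norm_coe_sphere] at h1
    simp [(hH.pos _ (sphere_ne_zero x)).ne'] at h1
  · have h := mem_graphClosure hH (linHom (x : E n))
    rw [one_smul]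
    rwa [opMap_linHom] at h

include hH hdet in
/-- If `1 < Λ ≤ λ₂`, there is no spectrum below `Λ` besides `0` and `1`. -/
lemma eq_zero_or_one_of_lt_lam (hn : 3 ≤ n) {Λ : ℝ} (hΛ : 1 < Λ) (hlam : Λ ≤ lam K 2) {t : ℝ}
    (ht : t ∈ negHbmSpectrum K) (htΛ : t < Λ) : t = 0 ∨ t = 1 := by
  have key : ∀ s ∈ negHbmSpectrum K, 0 ≤ s → s < Λ → s = 0 ∨ s = 1 := fun s hs h0 hsΛ =>
    eq_zero_or_one_of_lt (zero_mem_negHbmSpectrum hH hdet hn)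
      (one_mem_negHbmSpectrum hH hdet hn) hΛ hlam hs h0 hsΛ
  have hhalf : (1 / 2 : ℝ) ∉ negHbmSpectrum K := fun h => by
    rcases key _ h (by norm_num) (by linarith) with h | h <;> norm_num at h
  refine key t ht ?_ htΛ
  by_contra hneg
  rw [← relSpectrum_graphClosure hH] at ht hhalf
  exact (isClosedSymm_graphClosure hH hdet (by omega)).notMem_of_neg hhalf (not_le.mp hneg) ht

include hH hdet in
/-- If `1 < λ₂`, the closure of `-L_K` is self-adjoint: it contains every weak solution. -/
lemma mem_graphClosure_of_weak (hn : 3 ≤ n) {Λ : ℝ} (hΛ : 1 < Λ) (hlam : Λ ≤ lam K 2)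
    {u v : Lp ℝ 2 (coneVolume K)}
    (h : ∀ F, ⟪u, toL2 K (opMap hH F)⟫_ℝ = ⟪v, toL2 K (quotMap hH F)⟫_ℝ) :
    (u, v) ∈ graphClosure hH := by
  have hhalf : (1 / 2 : ℝ) ∉ negHbmSpectrum K := fun hm => by
    rcases eq_zero_or_one_of_lt_lam hH hdet hn hΛ hlam hm (by linarith) with h | h <;>
      norm_num at h
  rw [← relSpectrum_graphClosure hH] at hhalf
  exact (isClosedSymm_graphClosure hH hdet (by omega)).mem_of_weak hhalf fun q hq =>
    graphClosure_induction hH (p := fun q => ⟪u, q.2⟫_ℝ = ⟪v, q.1⟫_ℝ)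
      (isClosed_eq (by fun_prop) (by fun_prop)) h hq

include hH hdet in
/-- If `1 < Λ ≤ λ₂`, then functions orthogonal to the eigenspaces of `0` and `1` satisfy the
spectral gap inequality with constant `Λ`. -/
theorem le_inner_of_le_lam (hn : 3 ≤ n) {Λ : ℝ} (hΛ : 1 < Λ) (hlam : Λ ≤ lam K 2)
    {u v : Lp ℝ 2 (coneVolume K)} (huv : (u, v) ∈ graphClosure hH) (h0 : ⟪u, toL2 K 1⟫_ℝ = 0)
    (h1 : ∀ w, ⟪u, toL2 K (quotMap hH (linHom w))⟫_ℝ = 0) : Λ * ‖u‖ ^ 2 ≤ ⟪v, u⟫_ℝ := by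
  refine (isClosedSymm_graphClosure hH hdet (by omega)).le_inner_of_orthogonal hΛ
    (fun t ht htΛ => ?_) huv (fun e he => ?_) fun e he => ?_
  · rw [relSpectrum_graphClosure] at ht
    exact eq_zero_or_one_of_lt_lam hH hdet hn hΛ hlam ht htΛ
  · obtain ⟨a, rfl⟩ := exists_smul_of_mem_zero hH hdet hn he
    rw [inner_smul_right, h0, mul_zero]
  · obtain ⟨w, rfl⟩ := exists_linHom_of_mem_one hH hdet hn he
    exact h1 w

end Closure

/-! ### The unit ball and integration by parts on the round sphere -/

section Round

variable {V : Type*} [NormedAddCommGroup V] [InnerProductSpace ℝ V] [FiniteDimensional ℝ V]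
  [Nontrivial V] [MeasurableSpace V] [BorelSpace V] {μ : Measure V} [μ.IsAddHaarMeasure]

lemma gradient_norm {x : V} (hx : x ≠ 0) : gradient (fun y : V => ‖y‖) x = ‖x‖⁻¹ • x := by
  refine HasGradientAt.gradient (hasGradientAt_iff_hasFDerivAt.mpr ?_)
  convert! hasFDerivAt_norm_of_ne hx using 1
  ext v
  simp

lemma hasFDerivAt_norm_inv {x : V} (hx : x ≠ 0) :
    HasFDerivAt (fun y : V => ‖y‖⁻¹) (-(‖x‖ ^ 2)⁻¹ • (‖x‖⁻¹ • innerSL ℝ x)) x :=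
  (hasDerivAt_inv (norm_ne_zero_iff.mpr hx)).comp_hasFDerivAt x (hasFDerivAt_norm_of_ne hx)

lemma isRegSupport_norm : IsRegSupport (fun x : V => ‖x‖) where
  smooth := fun _ hx => (contDiffAt_norm ℝ hx).contDiffWithinAt
  hom := fun t ht x => by
    simp only [norm_smul, Real.norm_of_nonneg ht.le, smul_eq_mul]
  pos := fun _ hx => norm_pos_iff.mpr hx
  sub := fun x hx z => by
    rw [gradient_norm hx, inner_smul_left, RCLike.conj_to_real, inv_mul_le_iff₀ (norm_pos_iff.mpr hx)]
    exact real_inner_le_norm x z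
  pd := fun x hx v hv hxv => by
    have hn := norm_pos_iff.mpr hx
    have h1 : gradient (fun y : V => ‖y‖) =ᶠ[nhds x] fun y => ‖y‖⁻¹ • y := by
      filter_upwards [compl_zero_mem_nhds hx] with y hy using gradient_norm hy
    have h2 := (hasFDerivAt_norm_inv hx).smul (hasFDerivAt_id x)
    rw [hess, (h2.congr_of_eventuallyEq h1).fderiv]
    simp only [_root_.add_apply, _root_.smul_apply,
      ContinuousLinearMap.smulRight_apply, ContinuousLinearMap.id_apply, innerSL_apply_apply, hxv,
      smul_zero, zero_smul, add_zero, inner_smul_left, RCLike.conj_to_real]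
    exact mul_pos (inv_pos.mpr hn) (real_inner_self_pos.mpr hv)

lemma dbd_of_eq_mul_norm {H : V → ℝ} (hH : IsRegSupport H) {r : ℝ} (h : ∀ x, H x = r * ‖x‖) {x : V}
    (hx : x ≠ 0) : dbd H x = r • ContinuousLinearMap.id ℝ V := by
  have h1 : bdMap H =ᶠ[nhds x] fun y => r • y := by
    filter_upwards [compl_zero_mem_nhds hx] with y hy
    have hn : ‖y‖ ≠ 0 := norm_ne_zero_iff.mpr hy
    have h2 : gradient H y = r • ‖y‖⁻¹ • y := by
      have h3 : H = fun y => r * ‖y‖ := funext h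
      rw [h3, ← gradient_norm hy, gradient, gradient, fderiv_const_mul
        ((hasFDerivAt_norm_of_ne hy).differentiableAt), map_smul]
    rw [bdMap, h2, smul_smul, smul_smul]
    congr 1
    field_simp
  exact (hH.hasFDerivAt_bdMap hx).unique
    (((hasFDerivAt_id x).const_smul r).congr_of_eventuallyEq h1)

/-- Integration by parts on the unit sphere, the case `H = ‖·‖` of `integral_ctrace`. -/
lemma integral_fderiv_sphere (hd : 2 ≤ finrank ℝ V) {φ : V → ℝ} (hφ : ContDiffOn ℝ 1 φ {0}ᶜ)
    (hφ0 : Hom0 φ) (w : V) :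
    ∫ s : sphere (0 : V) 1, fderiv ℝ φ s w ∂μ.toSphere =
      ((finrank ℝ V : ℝ) - 1) * ∫ s : sphere (0 : V) 1, φ s * ⟪(s : V), w⟫_ℝ ∂μ.toSphere := by
  have h := (isRegSupport_norm (V := V)).integral_ctrace (μ := μ) hd (w := fun x => φ x • w)
    (hφ.smul contDiffOn_const) (fun t ht x => by simp only [hφ0 ht])
  have hdb : ∀ s : sphere (0 : V) 1, dbd (fun x : V => ‖x‖) s = 1 := fun s => by
    rw [dbd_of_eq_mul_norm isRegSupport_norm (r := 1) (by simp) (coe_sphere_ne_zero s), one_smul]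
    rfl
  have h1 : (1 : V →L[ℝ] V).det = 1 := by
    rw [ContinuousLinearMap.det]; exact LinearMap.det_id
  have h2 : ∀ s : sphere (0 : V) 1,
      ctrace (fderiv ℝ (fun x => φ x • w) s ∘L (1 : V →L[ℝ] V)) = fderiv ℝ φ s w := fun s => by
    have h3 := (differentiableAt_of_contDiffOn one_ne_zero hφ (coe_sphere_ne_zero s))
    rw [fderiv_smul_const h3, ← ctrace_smulRight]
    rfl
  simpa only [hdb, h1, h2, Ring.inverse_one, abs_one, one_mul, norm_coe_sphere, div_one,
    inner_smul_right] using h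

namespace IsRegSupport

variable {H : V → ℝ} (hH : IsRegSupport H)
include hH

/-- Integration by parts on the sphere for a `0`-homogeneous function with the weight `H ^ (q + 1)`.
-/
lemma integral_rpow_mul_fderiv (hd : 2 ≤ finrank ℝ V) {Z : V → ℝ} (hZ : ContDiffOn ℝ 1 Z {0}ᶜ)
    (hZ0 : Hom0 Z) (w : V) (q : ℝ) :
    ∫ s : sphere (0 : V) 1, H s ^ (q + 1) * fderiv ℝ Z s w ∂μ.toSphere =
      ∫ s : sphere (0 : V) 1, H s ^ q * (Z s * ((finrank ℝ V + q) * (H s * ⟪(s : V), w⟫_ℝ) -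
        (q + 1) * ⟪gradient H s, w⟫_ℝ)) ∂μ.toSphere := by
  set N : V → ℝ := fun x => H x / ‖x‖ with hN
  have hNpos : ∀ x : V, x ≠ 0 → 0 < N x := fun x hx => div_pos (hH.pos x hx) (norm_pos_iff.mpr hx)
  have hNc : ContDiffOn ℝ 1 N {0}ᶜ :=
    isRegSupport_norm.contDiffOn_div_self (by norm_num) hH.smooth
  have hN0 : Hom0 N := isRegSupport_norm.hom0_div_self hH.hom
  have hG : ContDiffOn ℝ 1 (fun x => N x ^ (q + 1)) {0}ᶜ :=
    hNc.rpow_const_of_ne fun x hx => (hNpos x hx).ne'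
  have h := integral_fderiv_sphere (μ := μ) hd (hZ.mul hG)
    (fun t ht x => by simp only [hZ0 ht, hN0 ht]) w
  have hNs : ∀ s : sphere (0 : V) 1, N s = H s := fun s => by
    rw [hN]; simp only [norm_coe_sphere, div_one]
  have hder : ∀ s : sphere (0 : V) 1, fderiv ℝ (fun x => Z x * N x ^ (q + 1)) s w =
      H s ^ (q + 1) * fderiv ℝ Z s w +
      H s ^ q * ((q + 1) * (Z s * (⟪gradient H s, w⟫_ℝ - H s * ⟪(s : V), w⟫_ℝ))) := by
    intro s
    have hs := coe_sphere_ne_zero s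
    have h1 := (hH.diff hs).hasFDerivAt.mul (hasFDerivAt_norm_inv hs)
    have h2 : HasFDerivAt N _ (s : V) := h1
    have h3 := (differentiableAt_of_contDiffOn one_ne_zero hZ hs).hasFDerivAt.mul
      (h2.rpow_const (p := q + 1) (Or.inl (hNpos s hs).ne'))
    rw [show fderiv ℝ (fun x => Z x * N x ^ (q + 1)) s = _ from h3.fderiv]
    simp only [_root_.add_apply, _root_.smul_apply, innerSL_apply_apply,
      norm_coe_sphere, hNs, smul_eq_mul, inner_gradient_left, add_sub_cancel_right]
    ring
  simp only [hder] at h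
  have hcH := hH.continuous_coe
  have hr : ∀ q : ℝ, Continuous fun s : sphere (0 : V) 1 => H s ^ q := fun q =>
    hcH.rpow_const fun s => Or.inl (hH.pos _ (coe_sphere_ne_zero s)).ne'
  have hcZ := continuous_sphere_of_continuousOn hZ.continuousOn
  have hcD := continuous_sphere_of_continuousOn (continuousOn_fderiv hZ)
  have hcg := continuous_sphere_of_continuousOn hH.gradient_contDiffOn.continuousOn
  have hcw : Continuous fun s : sphere (0 : V) 1 => ⟪(s : V), w⟫_ℝ := by fun_prop
  have hcgw : Continuous fun s : sphere (0 : V) 1 => ⟪gradient H s, w⟫_ℝ :=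
    hcg.inner continuous_const
  have i1 : Integrable (fun s : sphere (0 : V) 1 => H s ^ (q + 1) * fderiv ℝ Z s w) μ.toSphere :=
    integrable_sphere ((hr _).mul (hcD.clm_apply continuous_const))
  have i2 : Integrable (fun s : sphere (0 : V) 1 => H s ^ q * ((q + 1) * (Z s *
      (⟪gradient H s, w⟫_ℝ - H s * ⟪(s : V), w⟫_ℝ)))) μ.toSphere :=
    integrable_sphere ((hr _).mul (continuous_const.mul (hcZ.mul (hcgw.sub (hcH.mul hcw)))))
  have i3 : Integrable (fun s : sphere (0 : V) 1 => (Z s * N s ^ (q + 1)) * ⟪(s : V), w⟫_ℝ)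
      μ.toSphere :=
    integrable_sphere ((continuous_sphere_of_continuousOn (hZ.mul hG).continuousOn).mul hcw)
  rw [integral_add i1 i2] at h
  rw [eq_sub_of_add_eq h, ← integral_const_mul, ← integral_sub (i3.const_mul _) i2]
  congr 1
  funext s
  have hp : H s ^ (q + 1) = H s ^ q * H s := by
    rw [Real.rpow_add (hH.pos _ (coe_sphere_ne_zero s)), Real.rpow_one]
  rw [hNs, hp]
  ring

end IsRegSupport

end Round

/-! ### The spectral inequality applied to the gradient of the support function -/

section Final

variable {n : ℕ} [Nontrivial (E n)] {K : ConvexBody (E n)} {p : ℝ}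

lemma det_D2_pos_of_solves (h0 : (0 : E n) ∈ interior (K : Set (E n)))
    (hsol : SolvesIsotropicLpMinkowski p K) (x : S n) : 0 < LinearMap.det (D2 (supp K) x) := by
  have h1 : 0 < supp K x := by
    rw [← homExt_coe (supp K) x]; exact homExt_supp_pos h0 (sphere_ne_zero x)
  have h2 := hsol x
  exact pos_of_mul_pos_right (a := supp K x ^ (1 - p)) (by rw [h2]; exact one_pos)
    (Real.rpow_nonneg h1.le _)

/-- The Minkowski equation in terms of `Ψ = bdMap`. -/
lemma abs_det_dbd_of_solves (hH : IsRegSupport (homExt (supp K)))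
    (hsol : SolvesIsotropicLpMinkowski p K) (x : S n) :
    |(dbd (homExt (supp K)) x).det| = homExt (supp K) x ^ p := by
  have h1 := supp_pos hH x
  have h2 : (dbd (homExt (supp K)) x).det = supp K x ^ p := by
    rw [det_dbd hH]
    have h3 : supp K x ^ p * (supp K x ^ (1 - p) * LinearMap.det (D2 (supp K) x)) =
        supp K x * LinearMap.det (D2 (supp K) x) := by
      rw [← mul_assoc, ← Real.rpow_add h1, add_sub_cancel, Real.rpow_one]
    rw [← h3, hsol x, mul_one]
  rw [h2, abs_of_nonneg (Real.rpow_nonneg h1.le _), homExt_coe]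

section Map

variable (hH : IsRegSupport (homExt (supp K)))

/-- The coordinate `⟪X, w⟫` of the boundary point `X = ∇H` with normal `x`. -/
def gradMap : E n →ₗ[ℝ] C(S n, ℝ) where
  toFun w := ⟨fun x => ⟪gradient (homExt (supp K)) x, w⟫_ℝ,
    (continuous_sphere_of_continuousOn hH.gradient_contDiffOn.continuousOn).inner
      continuous_const⟩
  map_add' v w := by ext x; simp [inner_add_right]
  map_smul' c w := by ext x; simp [inner_smul_right]

/-- The function `h_K ⟪x, w⟫` on the sphere. -/
def mulMap : E n →ₗ[ℝ] C(S n, ℝ) where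
  toFun w := ⟨fun x => homExt (supp K) x * ⟪(x : E n), w⟫_ℝ,
    hH.continuous_coe.mul (by fun_prop)⟩
  map_add' v w := by ext x; simp [inner_add_right, mul_add]
  map_smul' c w := by ext x; simp [inner_smul_right, mul_left_comm]

variable (hdet : ∀ x : S n, 0 < LinearMap.det (D2 (supp K) x)) [IsFiniteMeasure (coneVolume K)]

include hdet in
/-- The Dirichlet form of `⟪X, w⟫` and `F / h` is `∫ h ⟪w, ∇(F / h)⟫ dV`. -/
lemma inner_gradMap_opMap (hn : 2 ≤ n) (w : E n) (F : c2Hom (E n)) :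
    (n - 1) * ⟪toL2 K (gradMap hH w), toL2 K (opMap hH F)⟫_ℝ = (n : ℝ)⁻¹ *
      ∫ x : S n, |(dbd (homExt (supp K)) x).det| *
        (⟪gradient F.1 x, w⟫_ℝ - F.1 x / homExt (supp K) x * ⟪gradient (homExt (supp K)) x, w⟫_ℝ)
        ∂(volume : Measure (E n)).toSphere := by
  have hd : 2 ≤ finrank ℝ (E n) := by rwa [finrank_euclideanSpace_fin]
  have hZ : ContDiffOn ℝ 1 (fun x => ⟪gradient (homExt (supp K)) x, w⟫_ℝ) {0}ᶜ :=
    hH.gradient_contDiffOn.inner ℝ contDiffOn_const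
  have h := hH.integral_mul_eq (μ := (volume : Measure (E n))) hd hZ
    (fun t ht x => by simp only [hH.hom.gradient ht]) F.2.1 F.2.2
  have h1 : ∀ x : S n, fderiv ℝ (fun x => ⟪gradient (homExt (supp K)) x, w⟫_ℝ) x
      (Ring.inverse (dbd (homExt (supp K)) x) (gradient F.1 x)) =
      ⟪gradient F.1 x, w⟫_ℝ - F.1 x / homExt (supp K) x * ⟪gradient (homExt (supp K)) x, w⟫_ℝ := fun x => by
    have hx := coe_sphere_ne_zero x
    have h2 := (differentiableAt_gradient hH.smooth hx).hasFDerivAt.inner ℝ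
      (hasFDerivAt_const w (x : E n))
    rw [h2.fderiv]
    simp only [fderivInnerCLM_apply, ContinuousLinearMap.comp_apply,
      ContinuousLinearMap.prod_apply, _root_.zero_apply, inner_zero_right, zero_add]
    rw [show fderiv ℝ (gradient (homExt (supp K))) x (Ring.inverse (dbd (homExt (supp K)) x) (gradient F.1 x)) = _ from
      hH.hess_inverse_dbd_eq (norm_coe_sphere x) _, inner_sub_left, inner_smul_left,
      real_inner_comm (gradient F.1 x), F.2.2.inner_gradient
        (differentiableAt_of_contDiffOn two_ne_zero F.2.1 hx)]
    rfl
  simp only [h1] at h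
  rw [inner_toL2 hH hdet, ← h, mul_left_comm, ← integral_const_mul]
  congr 2
  funext x
  rw [← opMap_apply hH hd, finrank_euclideanSpace_fin]
  change _ = |(dbd (homExt (supp K)) x).det| * (gradMap hH w x * _)
  ring

include hdet in
lemma inner_gradMap_linHom (hn : 2 ≤ n) (v w : E n) :
    n * ⟪toL2 K (gradMap hH w), toL2 K (quotMap hH (linHom v))⟫_ℝ =
      ⟪v, w⟫_ℝ * ⟪toL2 K 1, toL2 K 1⟫_ℝ := by
  have h := inner_gradMap_opMap hH hdet hn w (linHom v)
  have h1 : ∀ x : S n, |(dbd (homExt (supp K)) x).det| *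
      (⟪gradient (linHom v : c2Hom (E n)).1 x, w⟫_ℝ - (linHom v : c2Hom (E n)).1 x /
        homExt (supp K) x * ⟪gradient (homExt (supp K)) x, w⟫_ℝ) =
      ⟪v, w⟫_ℝ * |(dbd (homExt (supp K)) x).det| -
      |(dbd (homExt (supp K)) x).det| * (gradMap hH w x * quotMap hH (linHom v) x) := fun x => by
    rw [show gradient (linHom v : c2Hom (E n)).1 (x : E n) = v from gradient_inner_const v _]
    change _ = _ - _ * (⟪gradient (homExt (supp K)) x, w⟫_ℝ *
      ((linHom v : c2Hom (E n)).1 x / homExt (supp K) x))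
    ring
  simp only [h1] at h
  have i1 : Integrable (fun x : S n => |(dbd (homExt (supp K)) x).det| *
      (gradMap hH w x * quotMap hH (linHom v) x)) (volume : Measure (E n)).toSphere :=
    integrable_sphere (hH.continuous_abs_det.mul
      ((gradMap hH w).continuous.mul (quotMap hH _).continuous))
  rw [integral_sub ((integrable_sphere hH.continuous_abs_det).const_mul _) i1,
    integral_const_mul, mul_sub, ← inner_toL2 hH hdet, opMap_linHom] at h
  rw [inner_toL2 hH hdet 1 1]
  simp only [ContinuousMap.one_apply, mul_one]
  linarith

include hdet in
/-- The equation turns the Dirichlet form of `⟪X, w⟫` into an `L²` pairing, so that `⟪X, w⟫`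
lies in the domain of the closure. -/
lemma inner_gradMap_opMap_of_solves (hn : 2 ≤ n) (hsol : SolvesIsotropicLpMinkowski p K) (w : E n)
    (F : c2Hom (E n)) :
    ⟪toL2 K (gradMap hH w), toL2 K (opMap hH F)⟫_ℝ =
      ⟪((-p - 1) / ((n : ℝ) - 1)) • toL2 K (gradMap hH w) +
        ((n + p) / ((n : ℝ) - 1)) • toL2 K (mulMap hH w), toL2 K (quotMap hH F)⟫_ℝ := by
  have h2 : (2 : ℝ) ≤ n := by exact_mod_cast hn
  have hn1 : (n : ℝ) - 1 ≠ 0 := by linarith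
  have hd : 2 ≤ finrank ℝ (E n) := by rwa [finrank_euclideanSpace_fin]
  have h := inner_gradMap_opMap hH hdet hn w F
  have h1 : ∀ x : S n, |(dbd (homExt (supp K)) x).det| * (⟪gradient F.1 x, w⟫_ℝ -
      F.1 x / homExt (supp K) x * ⟪gradient (homExt (supp K)) x, w⟫_ℝ) =
      homExt (supp K) x ^ (p + 1) * fderiv ℝ (fun y => F.1 y / homExt (supp K) y) x w := fun x => by
    have hx := coe_sphere_ne_zero x
    rw [abs_det_dbd_of_solves hH hsol, hH.gradient_div_eq F.2.1 hx, inner_add_left,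
      inner_smul_left, inner_smul_left, inner_gradient_left, Real.rpow_add (hH.pos x hx),
      Real.rpow_one]
    simp only [RCLike.conj_to_real]
    ring
  simp only [h1] at h
  rw [hH.integral_rpow_mul_fderiv hd (hH.contDiffOn_div_self (by norm_num) F.2.1)
    (hH.hom0_div_self F.2.2)] at h
  have h3 : ∀ x : S n, homExt (supp K) x ^ p * (F.1 x / homExt (supp K) x * ((finrank ℝ (E n) + p) *
      (homExt (supp K) x * ⟪(x : E n), w⟫_ℝ) - (p + 1) * ⟪gradient (homExt (supp K)) x, w⟫_ℝ)) =
      |(dbd (homExt (supp K)) x).det| * (((-p - 1) • gradMap hH w + ((n : ℝ) + p) • mulMap hH w) x *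
        quotMap hH F x) := fun x => by
    rw [abs_det_dbd_of_solves hH hsol, finrank_euclideanSpace_fin]
    change _ = _ * (((-p - 1) * ⟪gradient (homExt (supp K)) x, w⟫_ℝ + (n + p) * (homExt (supp K) x * ⟪(x : E n), w⟫_ℝ)) *
      (F.1 x / homExt (supp K) x))
    ring
  simp only [h3] at h
  rw [← inner_toL2 hH hdet, map_add, map_smul, map_smul] at h
  rw [inner_add_left, inner_smul_left, inner_smul_left] at h ⊢
  simp only [RCLike.conj_to_real] at h ⊢
  field_simp
  linarith

end Map

/-- A point lies in the body iff its preimage under `Ψ = bdMap` lies in the unit ball. -/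
lemma norm_bdInv_le_one_iff (hK : IsKPlusTwo K) (hH : IsRegSupport (homExt (supp K))) (y : E n) :
    ‖bdInv (homExt (supp K)) y‖ ≤ 1 ↔ y ∈ (K : Set (E n)) := by
  set H := homExt (supp K)
  have h0 : (0 : E n) ∈ (K : Set (E n)) := interior_subset hK.1
  rcases eq_or_ne y 0 with rfl | hy
  · rw [bdInv_zero]; simp [h0]
  have hξ := hH.bdInv_ne_zero hy
  have hy2 := hH.bdMap_bdInv hy
  set ξ := bdInv H y
  have hn := norm_pos_iff.mpr hξ
  constructor
  · intro h
    rw [← hy2]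
    have := K.convex.add_smul_sub_mem h0 (contDiffAt_homExt_supp hK hξ).2 ⟨hn.le, h⟩
    rwa [zero_add, sub_zero] at this
  · intro h
    have h1 := inner_le_homExt_supp h ξ
    rw [← hy2, bdMap, inner_smul_right, real_inner_comm, hH.inner_gradient hξ] at h1
    exact le_of_mul_le_mul_right (by rwa [one_mul]) (hH.pos ξ hξ)

/-- The centroid condition says that `⟪X, w⟫` has mean zero. -/
lemma integral_gradMap_of_centred (hn : 2 ≤ n) (hK : IsKPlusTwo K)
    (hH : IsRegSupport (homExt (supp K))) (hc : IsOriginCentred K) (w : E n) :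
    ∫ x : S n, |(dbd (homExt (supp K)) x).det| * ⟪gradient (homExt (supp K)) x, w⟫_ℝ
      ∂(volume : Measure (E n)).toSphere = 0 := by
  set H := homExt (supp K)
  have hpos : 0 < (volume : Measure (E n)) (K : Set (E n)) :=
    (isOpen_interior.measure_pos _ ⟨0, hK.1⟩).trans_le (measure_mono interior_subset)
  have hfin : (volume : Measure (E n)) (K : Set (E n)) ≠ ⊤ := K.isCompact.measure_ne_top
  have h0 : ∫ y in (K : Set (E n)), y = 0 := by
    rw [IsOriginCentred, setAverage_eq] at hc
    refine (smul_eq_zero.mp hc).resolve_left (inv_ne_zero ?_)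
    exact (ENNReal.toReal_pos hpos.ne' hfin).ne'
  set χ : ℝ → ℝ := (Iic (1 : ℝ)).indicator fun r => r with hχ
  have hint : IntegrableOn (fun y : E n => y) (K : Set (E n)) :=
    continuous_id.continuousOn.integrableOn_compact K.isCompact
  have h1 : ∫ y, χ ‖bdInv H y‖ * ⟪gradient H (bdInv H y), w⟫_ℝ = 0 := by
    have h2 : ∀ y, χ ‖bdInv H y‖ * ⟪gradient H (bdInv H y), w⟫_ℝ =
        (K : Set (E n)).indicator (fun y => ⟪w, y⟫_ℝ) y := by
      intro y
      by_cases hy : y ∈ (K : Set (E n))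
      · rw [indicator_of_mem hy, hχ, indicator_of_mem
          (show ‖bdInv H y‖ ∈ Iic (1 : ℝ) from (norm_bdInv_le_one_iff hK hH y).mpr hy)]
        rcases eq_or_ne y 0 with rfl | hy0
        · rw [bdInv_zero]; simp
        · conv_rhs => rw [← hH.bdMap_bdInv hy0, bdMap]
          rw [inner_smul_right, real_inner_comm]
      · rw [indicator_of_notMem hy, hχ, indicator_of_notMem
          (show ‖bdInv H y‖ ∉ Iic (1 : ℝ) from fun h => hy ((norm_bdInv_le_one_iff hK hH y).mp h)),
          zero_mul]
    simp only [h2]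
    rw [integral_indicator K.isCompact.measurableSet, integral_inner hint, h0, inner_zero_right]
  rw [hH.integral_comp_bdInv (g := fun x => ⟪gradient H x, w⟫_ℝ)
    (fun t ht x => by simp only [hH.hom.gradient ht]) χ] at h1
  refine (mul_eq_zero.mp h1).resolve_right ?_
  rw [finrank_euclideanSpace_fin]
  have h3 : ∀ r : ℝ, r ^ (n - 1) * χ r = (Iic (1 : ℝ)).indicator (fun r => r ^ n) r := fun r => by
    by_cases hr : r ∈ Iic (1 : ℝ)
    · rw [hχ, indicator_of_mem hr, indicator_of_mem hr, ← pow_succ]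
      congr 1; omega
    · rw [hχ, indicator_of_notMem hr, indicator_of_notMem hr, mul_zero]
  simp only [h3]
  rw [setIntegral_indicator measurableSet_Iic, Ioi_inter_Iic,
    ← intervalIntegral.integral_of_le zero_le_one, integral_pow]
  simp
  positivity

section Spectral

variable (hH : IsRegSupport (homExt (supp K)))

/-- The support function `h_K`, as an element of `C(S^{n-1})`. -/
def suppC : C(S n, ℝ) := ⟨fun x => homExt (supp K) x, hH.continuous_coe⟩

/-- The function `1 / h_K`. -/
def invSuppC : C(S n, ℝ) := ⟨fun x => (homExt (supp K) x)⁻¹,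
  hH.continuous_coe.inv₀ fun x => (hH.pos _ (sphere_ne_zero x)).ne'⟩

variable (hdet : ∀ x : S n, 0 < LinearMap.det (D2 (supp K) x))

include hH hdet in
lemma integral_lpSurfaceArea_two (g : S n → ℝ) : ∫ x, g x ∂lpSurfaceArea 2 K =
    ∫ x : S n, |(dbd (homExt (supp K)) x).det| * (g x / homExt (supp K) x ^ 2)
      ∂(volume : Measure (E n)).toSphere := by
  have h1 : ∀ x : S n, supp K x ^ ((1 : ℝ) - 2) * LinearMap.det (D2 (supp K) x) =
      |(dbd (homExt (supp K)) x).det| / homExt (supp K) x ^ 2 := fun x => by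
    have h2 := supp_pos hH x
    rw [det_dbd hH, abs_of_pos (mul_pos h2 (hdet x)), homExt_coe, show (1 : ℝ) - 2 = -1 by norm_num,
      Real.rpow_neg_one]
    field_simp
  have hne : ∀ x : S n, homExt (supp K) x ^ 2 ≠ 0 := fun x =>
    pow_ne_zero 2 (hH.pos _ (sphere_ne_zero x)).ne'
  have hm : Measurable fun x : S n =>
      ENNReal.ofReal (|(dbd (homExt (supp K)) x).det| / homExt (supp K) x ^ 2) :=
    (hH.continuous_abs_det.div (hH.continuous_coe.pow 2) hne).measurable.ennreal_ofReal
  rw [lpSurfaceArea]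
  simp only [h1]
  rw [integral_withDensity_eq_integral_toReal_smul hm
    (Filter.Eventually.of_forall fun x => ENNReal.ofReal_lt_top)]
  congr 1
  funext x
  rw [ENNReal.toReal_ofReal (by positivity), smul_eq_mul]
  ring

variable [IsFiniteMeasure (coneVolume K)]

include hdet in
/-- `S₂`-isotropy in terms of the eigenfunctions `⟪x, w⟫ / h` of the eigenvalue `1`. -/
lemma inner_linHom_linHom (hn : n ≠ 0) (hiso : IsS2Isotropic K) (v w : E n) :
    n * ⟪toL2 K (quotMap hH (linHom v)), toL2 K (quotMap hH (linHom w))⟫_ℝ =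
      ⟪v, w⟫_ℝ * ⟪toL2 K (invSuppC hH), toL2 K (invSuppC hH)⟫_ℝ := by
  have hn0 : (n : ℝ) ≠ 0 := by exact_mod_cast hn
  have hreal : (lpSurfaceArea 2 K).real univ =
      n * ⟪toL2 K (invSuppC hH), toL2 K (invSuppC hH)⟫_ℝ := by
    have h1 := integral_lpSurfaceArea_two hH hdet fun _ => 1
    rw [integral_const, smul_eq_mul, mul_one] at h1
    rw [h1, inner_toL2 hH hdet, mul_inv_cancel_left₀ hn0]
    congr 1
    funext x
    change _ = _ * ((homExt (supp K) x)⁻¹ * (homExt (supp K) x)⁻¹)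
    rw [one_div, sq, mul_inv]
  have hq : ∀ w : E n, n * ‖toL2 K (quotMap hH (linHom w))‖ ^ 2 =
      ‖w‖ ^ 2 * ⟪toL2 K (invSuppC hH), toL2 K (invSuppC hH)⟫_ℝ := by
    intro w
    have h1 := hiso w
    rw [integral_lpSurfaceArea_two hH hdet, hreal, mul_div_assoc, mul_right_comm] at h1
    rw [← real_inner_self_eq_norm_sq, inner_toL2 hH hdet, mul_inv_cancel_left₀ hn0]
    have h2 : (n : ℝ) * ‖w‖ ^ 2 * (⟪toL2 K (invSuppC hH), toL2 K (invSuppC hH)⟫_ℝ / n) =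
        ‖w‖ ^ 2 * ⟪toL2 K (invSuppC hH), toL2 K (invSuppC hH)⟫_ℝ := by field_simp
    rw [← h2, ← h1]
    congr 1
    funext x
    change _ * (⟪(x : E n), w⟫_ℝ / homExt (supp K) x * (⟪(x : E n), w⟫_ℝ / homExt (supp K) x)) = _
    rw [div_mul_div_comm, sq, sq]
  rw [real_inner_eq_norm_add_mul_self_sub_norm_mul_self_sub_norm_mul_self_div_two,
    real_inner_eq_norm_add_mul_self_sub_norm_mul_self_sub_norm_mul_self_div_two v w, ← map_add,
    ← map_add, ← map_add]
  have h1 := hq (v + w)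
  have h2 := hq v
  have h3 := hq w
  linarith

include hdet in
/-- The spectral inequality for `u = ⟪X, w⟫ - c ⟪x, w⟫ / h`, where `c` makes `u` orthogonal to the
eigenspaces of `0` and `1`. -/
lemma inner_mulMap_le (hn : 3 ≤ n) (hp : p < -(n : ℝ)) (hK : IsKPlusTwo K)
    (hcentred : IsOriginCentred K) (hiso : IsS2Isotropic K)
    (hsol : SolvesIsotropicLpMinkowski p K) (hlam : (-p - 1) / ((n : ℝ) - 1) ≤ lam K 2) {c : ℝ}
    (hc : c * ⟪toL2 K (invSuppC hH), toL2 K (invSuppC hH)⟫_ℝ = ⟪toL2 K 1, toL2 K 1⟫_ℝ) (w : E n) :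
    ⟪toL2 K (mulMap hH w), toL2 K (gradMap hH w)⟫_ℝ ≤
      c * ⟪toL2 K (mulMap hH w), toL2 K (quotMap hH (linHom w))⟫_ℝ := by
  have h3 : (3 : ℝ) ≤ n := by exact_mod_cast hn
  have hn1 : (0 : ℝ) < n - 1 := by linarith
  have hn0 : (0 : ℝ) < n := by linarith
  set Λ := (-p - 1) / ((n : ℝ) - 1) with hΛd
  have hΛ : 1 < Λ := by rw [hΛd, lt_div_iff₀ hn1]; linarith
  set κ := (n + p) / ((n : ℝ) - 1) with hκd
  have hκ : κ < 0 := div_neg_of_neg_of_pos (by linarith) hn1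
  set X := toL2 K (gradMap hH w) with hX
  set M := toL2 K (mulMap hH w) with hM
  set l : E n → Lp ℝ 2 (coneVolume K) := fun v => toL2 K (quotMap hH (linHom v)) with hl
  have hXmem : (X, Λ • X + κ • M) ∈ graphClosure hH :=
    mem_graphClosure_of_weak hH hdet hn hΛ hlam fun F =>
      inner_gradMap_opMap_of_solves hH hdet (by omega) hsol w F
  have hlmem : (l w, l w) ∈ graphClosure hH := by
    have := mem_graphClosure hH (linHom w)
    rwa [opMap_linHom] at this
  have h1mem : (toL2 K 1, (0 : Lp ℝ 2 (coneVolume K))) ∈ graphClosure hH := by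
    have := mem_graphClosure hH (selfHom hH)
    rwa [quotMap_selfHom, opMap_selfHom hH (by rw [finrank_euclideanSpace_fin]; omega),
      map_zero] at this
  have humem : (X - c • l w, Λ • X + κ • M - c • l w) ∈ graphClosure hH :=
    (graphClosure hH).sub_mem hXmem ((graphClosure hH).smul_mem c hlmem)
  -- `u ⊥ 1` because the centroid is the origin
  have hu0 : ⟪X - c • l w, toL2 K 1⟫_ℝ = 0 := by
    have e1 : ⟪X, toL2 K 1⟫_ℝ = 0 := by
      rw [hX, inner_toL2 hH hdet]
      have := integral_gradMap_of_centred (by omega) hK hH hcentred w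
      simp only [ContinuousMap.one_apply, mul_one]
      exact mul_eq_zero_of_right _ this
    have e2 : ⟪l w, toL2 K 1⟫_ℝ = 0 := by
      have := (isClosedSymm_graphClosure hH hdet (by omega)).symm _ hlmem _ h1mem
      rwa [inner_zero_right] at this
    rw [inner_sub_left, inner_smul_left, e1, e2, mul_zero, sub_zero]
  -- `u ⊥ ⟪x, v⟫ / h` for all `v`, by isotropy and the choice of `c`
  have hul : ∀ v, ⟪X - c • l w, l v⟫_ℝ = 0 := by
    intro v
    have e1 := inner_gradMap_linHom hH hdet (by omega) v w
    have e2 := inner_linHom_linHom hH hdet (by omega) hiso w v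
    rw [inner_sub_left, inner_smul_left, RCLike.conj_to_real]
    have e3 : (n : ℝ) * (⟪X, l v⟫_ℝ - c * ⟪l w, l v⟫_ℝ) = 0 := by
      rw [real_inner_comm] at e2
      rw [mul_sub, mul_left_comm]
      change (n : ℝ) * ⟪X, l v⟫_ℝ = _ at e1
      rw [real_inner_comm] at e2
      change (n : ℝ) * ⟪l w, l v⟫_ℝ = _ at e2
      rw [e1, e2, ← hc, real_inner_comm v w]
      ring
    exact (mul_eq_zero.mp e3).resolve_left hn0.ne'
  have hgap := le_inner_of_le_lam hH hdet hn hΛ hlam humem hu0 hul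
  have e4 : ⟪Λ • X + κ • M - c • l w, X - c • l w⟫_ℝ =
      Λ * ‖X - c • l w‖ ^ 2 + κ * ⟪M, X - c • l w⟫_ℝ := by
    have e5 : Λ • X + κ • M - c • l w = Λ • (X - c • l w) + κ • M + (Λ * c - c) • l w := by
      module
    rw [e5, inner_add_left, inner_add_left, inner_smul_left, inner_smul_left, inner_smul_left,
      real_inner_comm _ (l w), hul, real_inner_self_eq_norm_sq]
    simp
  rw [e4] at hgap
  -- the terms `Λ ‖u‖²` cancel and `κ < 0`
  have e6 : ⟪M, X - c • l w⟫_ℝ ≤ 0 := by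
    by_contra hcon
    push Not at hcon
    have := mul_neg_of_neg_of_pos hκ hcon
    linarith
  rw [inner_sub_right, inner_smul_right] at e6
  linarith

include hdet in
/-- Summing `inner_mulMap_le` over an orthonormal basis gives `∫ h² dV ≤ c V`, the equality case of
the Cauchy-Schwarz inequality for `h` and `1 / h`. -/
theorem suppC_eq_smul_invSuppC (hn : 3 ≤ n) (hp : p < -(n : ℝ)) (hK : IsKPlusTwo K)
    (hcentred : IsOriginCentred K) (hiso : IsS2Isotropic K)
    (hsol : SolvesIsotropicLpMinkowski p K) (hlam : (-p - 1) / ((n : ℝ) - 1) ≤ lam K 2) :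
    ∃ c : ℝ, suppC hH = c • invSuppC hH := by
  have hHx : ∀ x : S n, homExt (supp K) x ≠ 0 := fun x => (hH.pos _ (sphere_ne_zero x)).ne'
  have hI : ⟪toL2 K (invSuppC hH), toL2 K (invSuppC hH)⟫_ℝ ≠ 0 := by
    obtain ⟨x⟩ : Nonempty (S n) := (NormedSpace.sphere_nonempty.mpr zero_le_one).to_subtype
    rw [inner_self_ne_zero]
    exact toL2_ne_zero hH hdet (by omega) fun h => inv_ne_zero (hHx x) (DFunLike.congr_fun h x)
  set c := ⟪toL2 K 1, toL2 K 1⟫_ℝ / ⟪toL2 K (invSuppC hH), toL2 K (invSuppC hH)⟫_ℝ with hcd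
  have hc : c * ⟪toL2 K (invSuppC hH), toL2 K (invSuppC hH)⟫_ℝ = ⟪toL2 K 1, toL2 K 1⟫_ℝ :=
    div_mul_cancel₀ _ hI
  set b := EuclideanSpace.basisFun (Fin n) ℝ
  have hcd' := hH.continuous_abs_det
  have hsum : ∀ (f : E n → C(S n, ℝ)) (g : C(S n, ℝ)),
      (∀ x, ∑ i, mulMap hH (b i) x * f (b i) x = g x) →
      ∑ i, ⟪toL2 K (mulMap hH (b i)), toL2 K (f (b i))⟫_ℝ = (n : ℝ)⁻¹ *
        ∫ x : S n, |(dbd (homExt (supp K)) x).det| * g x ∂(volume : Measure (E n)).toSphere := by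
    intro f g hfg
    simp only [inner_toL2 hH hdet]
    have hint : ∀ i : Fin n, Integrable (fun x : S n => |(dbd (homExt (supp K)) x).det| *
        (mulMap hH (b i) x * f (b i) x)) (volume : Measure (E n)).toSphere := fun i =>
      integrable_sphere (hcd'.mul ((mulMap hH (b i)).continuous.mul (f (b i)).continuous))
    rw [← Finset.mul_sum, ← integral_finsetSum _ fun i _ => hint i]
    simp only [← Finset.mul_sum, hfg]
  have h1 := hsum (gradMap hH) (suppC hH * suppC hH) fun x => by
    have h2 : ∀ i, mulMap hH (b i) x * gradMap hH (b i) x = homExt (supp K) x *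
        (⟪(x : E n), b i⟫_ℝ * ⟪b i, gradient (homExt (supp K)) x⟫_ℝ) := fun i => by
      rw [real_inner_comm (gradient (homExt (supp K)) (x : E n)), ← mul_assoc]; rfl
    simp only [h2]
    rw [← Finset.mul_sum, b.sum_inner_mul_inner, real_inner_comm,
      hH.inner_gradient (sphere_ne_zero x)]
    rfl
  have h2 := hsum (fun w => quotMap hH (linHom w)) 1 fun x => by
    have h3 : ∀ i, mulMap hH (b i) x * quotMap hH (linHom (b i)) x =
        ⟪(x : E n), b i⟫_ℝ * ⟪b i, (x : E n)⟫_ℝ := fun i => by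
      rw [real_inner_comm (x : E n) (b i)]
      change homExt (supp K) x * ⟪(x : E n), b i⟫_ℝ *
        (⟪(x : E n), b i⟫_ℝ / homExt (supp K) x) = _
      have := hHx x
      field_simp
    simp only [h3]
    rw [b.sum_inner_mul_inner, real_inner_self_eq_norm_sq, norm_coe_sphere]
    simp
  have h3 : ∑ i, ⟪toL2 K (mulMap hH (b i)), toL2 K (gradMap hH (b i))⟫_ℝ ≤
      c * ∑ i, ⟪toL2 K (mulMap hH (b i)), toL2 K (quotMap hH (linHom (b i)))⟫_ℝ := by
    rw [Finset.mul_sum]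
    exact Finset.sum_le_sum fun i _ =>
      inner_mulMap_le hH hdet hn hp hK hcentred hiso hsol hlam hc (b i)
  have e1 : ⟪toL2 K (suppC hH), toL2 K (suppC hH)⟫_ℝ ≤ c * ⟪toL2 K 1, toL2 K 1⟫_ℝ := by
    rw [inner_toL2 hH hdet, inner_toL2 hH hdet]
    rw [h1, h2] at h3
    simpa only [ContinuousMap.mul_apply, ContinuousMap.one_apply, mul_one] using h3
  have e2 : ⟪toL2 K (suppC hH), toL2 K (invSuppC hH)⟫_ℝ = ⟪toL2 K 1, toL2 K 1⟫_ℝ := by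
    rw [inner_toL2 hH hdet, inner_toL2 hH hdet]
    congr 2
    funext x
    change _ * (homExt (supp K) x * (homExt (supp K) x)⁻¹) = _ * (1 * 1)
    rw [mul_inv_cancel₀ (hHx x), one_mul]
  refine ⟨c, ?_⟩
  by_contra hne
  refine toL2_ne_zero hH hdet (by omega) (sub_ne_zero.mpr hne) ?_
  rw [← inner_self_eq_zero (𝕜 := ℝ)]
  refine le_antisymm ?_ real_inner_self_nonneg
  rw [map_sub, map_smul, inner_sub_left, inner_sub_right, inner_sub_right, inner_smul_left,
    inner_smul_left, inner_smul_right, inner_smul_right,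
    real_inner_comm (toL2 K (suppC hH)) (toL2 K (invSuppC hH)), e2, hc]
  simp only [RCLike.conj_to_real]
  linarith

end Spectral

/-- A body of constant support function solving the equation is the unit ball. -/
lemma eq_closedBall_of_suppC_eq (hp : p < n) (hK : IsKPlusTwo K)
    (hH : IsRegSupport (homExt (supp K))) (hsol : SolvesIsotropicLpMinkowski p K) {c : ℝ}
    (hc : suppC hH = c • invSuppC hH) : (K : Set (E n)) = closedBall 0 1 := by
  have h1 : ∀ x : S n, homExt (supp K) x = √c := fun x => by
    have h2 : homExt (supp K) x = c * (homExt (supp K) x)⁻¹ := DFunLike.congr_fun hc x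
    have h3 := hH.pos _ (sphere_ne_zero x)
    have h4 : homExt (supp K) x ^ 2 = c := by
      rw [sq]; nth_rewrite 1 [h2]
      exact inv_mul_cancel_right₀ h3.ne' c
    rw [← h4, Real.sqrt_sq h3.le]
  set r := √c
  have h5 : ∀ y : E n, homExt (supp K) y = r * ‖y‖ := fun y => by
    rcases eq_or_ne y 0 with rfl | hy
    · rw [hH.hom.map_zero, norm_zero, mul_zero]
    · rw [homExt, dif_neg hy, ← homExt_coe (supp K) (radial y hy), h1, mul_comm]
  obtain ⟨x⟩ : Nonempty (S n) := (NormedSpace.sphere_nonempty.mpr zero_le_one).to_subtype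
  have hr : 0 < r := by rw [← h1 x]; exact hH.pos _ (sphere_ne_zero x)
  have hr1 : r = 1 := by
    have h6 := abs_det_dbd_of_solves hH hsol x
    rw [h1, dbd_of_eq_mul_norm hH h5 (sphere_ne_zero x)] at h6
    have h7 : (r • ContinuousLinearMap.id ℝ (E n)).det = r ^ n := by
      rw [ContinuousLinearMap.det]
      exact (LinearMap.det_smul r LinearMap.id).trans (by
        rw [LinearMap.det_id, mul_one, finrank_euclideanSpace_fin])
    rw [h7, abs_of_pos (pow_pos hr n), ← Real.rpow_natCast] at h6
    by_contra hne
    exact hp.ne' ((Real.rpow_right_inj hr hne).mp h6)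
  have h8 : ∀ y : E n, homExt (supp K) y = ‖y‖ := fun y => by rw [h5, hr1, one_mul]
  ext y
  rw [mem_closedBall_zero_iff]
  rcases eq_or_ne y 0 with rfl | hy
  · simpa using interior_subset hK.1
  constructor
  · intro h
    have h10 := inner_le_homExt_supp h y
    rw [h8, real_inner_self_eq_norm_sq, sq] at h10
    exact le_of_mul_le_mul_right (by rwa [one_mul]) (norm_pos_iff.mpr hy)
  · intro h
    have h11 : gradient (homExt (supp K)) y = ‖y‖⁻¹ • y := by
      rw [show homExt (supp K) = fun y => ‖y‖ from funext h8, gradient_norm hy]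
    have h12 := (contDiffAt_homExt_supp hK hy).2
    rw [h11] at h12
    have h13 := K.convex.add_smul_sub_mem (interior_subset hK.1) h12 ⟨norm_nonneg y, h⟩
    rwa [zero_add, sub_zero, smul_smul, mul_inv_cancel₀ (norm_ne_zero_iff.mpr hy),
      one_smul] at h13

end Final

end IsotropicLp

end

theorem mainTheorem1 (n : ℕ) (hn : 3 ≤ n) (p : ℝ)
    (hp : -2 * (n : ℝ) - 1 ≤ p) (hp' : p < -(n : ℝ))
    (K : ConvexBody (IsotropicLp.E n)) (hK : IsotropicLp.IsKPlusTwo K)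
    (hcentred : IsotropicLp.IsOriginCentred K) (hiso : IsotropicLp.IsS2Isotropic K)
    (hsol : IsotropicLp.SolvesIsotropicLpMinkowski p K)
    (hlam : (-p - 1) / ((n : ℝ) - 1) ≤ IsotropicLp.lam K 2) :
    (K : Set (IsotropicLp.E n)) = Metric.closedBall 0 1 := by
  have : Nontrivial (IsotropicLp.E n) := Module.nontrivial_of_finrank_pos (R := ℝ)
    (by rw [finrank_euclideanSpace_fin]; omega)
  have hdet := IsotropicLp.det_D2_pos_of_solves hK.1 hsol
  have hH := IsotropicLp.isRegSupport_of_isKPlusTwo hK fun x => (hdet x).ne'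
  have := IsotropicLp.isFiniteMeasure_coneVolume hH hdet (by omega)
  obtain ⟨c, hc⟩ :=
    IsotropicLp.suppC_eq_smul_invSuppC hH hdet hn hp' hK hcentred hiso hsol hlam
  have h0 : (0 : ℝ) ≤ n := Nat.cast_nonneg n
  exact IsotropicLp.eq_closedBall_of_suppC_eq (by linarith) hK hH hsol hc
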